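/- Let a grid representation of a finite simple graph $G$ assign to every vertex a nondegenerate closed horizontal or vertical segment in the plane such that parallel segments are pairwise disjoint and two distinct vertices are adjacent if and only if their segments intersect. $G$ is a UGIG if it has a grid representation in which all segments have length $1$, and it is in USEG if it has a grid representation in which all horizontal segments, or all vertical segments, have length $1$. Graphs with vertex set $\{0,\dots,n-1\}$ are encoded by bit strings ($n$ in unary followed by the adjacency matrix). A certificate for such a graph is a pair $D=(L_x,L_y)$ of lists: $L_x$ lists the $x$-coordinates of the left and right endpoints of the horizontal segments and of the vertical segments, $L_y$ lists the $y$-coordinates of the lower and upper endpoints of the vertical segments and of the horizontal segments, each entry being given only by the binary name of its vertex and its kind (lower endpoint, upper endpoint, position). $D$ is a UGIG-witness (USEG-witness) for $G$ if $L_x$ and $L_y$ are the strictly increasing orderings of these coordinates in some grid representation of $G$ with all segments of unit length (with all horizontal or all vertical segments of unit length). Then: 1. The recognition problems for UGIG and for USEG are in NP. 2. A graph is a UGIG (in USEG) if and only if it has a UGIG-witness (a USEG-witness). There is a function $s(n)=O(n\log n)$ such that every UGIG- or USEG-witness for a graph on $n$ vertices is encoded by at most $s(n)$ bits. 3. It can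 be decided in polynomial time (by a Turing machine, in the total length of the two strings) whether a given pair of bit strings consists of the encoding of a graph $G$ and the encoding of a UGIG-witness for $G$; likewise for USEG-witnesses. 4. Say that $D$ describes $G$ if, for some partition of the vertices into horizontal and vertical ones, $L_x$ and $L_y$ contain exactly the entries listed above, each once, the lower endpoint of each segment precedes its upper endpoint, and $u,v$ are adjacent if and only if one of them, say $u$, is horizontal, the other is vertical, the position of $v$ lies between the endpoints of $u$ in $L_x$, and the position of $u$ lies between the endpoints of $v$ in $L_y$. Call a list proper if there are no two vertices $u,v$ such that in the list the lower endpoint of $u$ precedes that of $v$ and the upper endpoint of $v$ precedes that of $u$. Then $D$ is a UGIG-witness for $G$ if and only if $D$ describes $G$ and both $L_x$ and $L_y$ are proper; and $D$ is a USEG-witness for $G$ if and only if $D$ describes $G$ and at least one of $L_x$, $L_y$ is proper. -/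

import Mathlib

open Asymptotics Filter

namespace UnitGrid

/-! ### Grid intersection representations -/

/-- The closed axis-parallel segment with endpoint coordinates `lo`, `hi` along its own direction
and constant other coordinate `pos`: horizontal if `h` holds, vertical otherwise. -/
def axisSegment (h : Prop) (lo hi pos : ℝ) : Set (ℝ × ℝ) :=
  {p | (h ∧ p.1 ∈ Set.Icc lo hi ∧ p.2 = pos) ∨ (¬ h ∧ p.2 ∈ Set.Icc lo hi ∧ p.1 = pos)}

/-- A grid intersection representation of a graph `G`: every vertex gets a nondegenerate closed
horizontal or vertical segment in the plane, parallel segments do not meet, and distinct vertices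
are adjacent exactly when their segments meet. -/
structure GridRep {V : Type*} (G : SimpleGraph V) where
  /-- the vertices represented by horizontal segments -/
  H : Set V
  /-- the left or bottom endpoint, along the segment's own direction -/
  lo : V → ℝ
  /-- the right or top endpoint, along the segment's own direction -/
  hi : V → ℝ
  /-- the constant other coordinate -/
  pos : V → ℝ
  lo_lt_hi : ∀ v, lo v < hi v
  disjoint_of_parallel : ∀ u v, u ≠ v → (u ∈ H ↔ v ∈ H) →
    Disjoint (axisSegment (u ∈ H) (lo u) (hi u) (pos u)) (axisSegment (v ∈ H) (lo v) (hi v) (pos v))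
  adj_iff : ∀ u v, G.Adj u v ↔ u ≠ v ∧
    (axisSegment (u ∈ H) (lo u) (hi u) (pos u) ∩ axisSegment (v ∈ H) (lo v) (hi v) (pos v)).Nonempty

/-- All segments have unit length. -/
def GridRep.IsUnit {V : Type*} {G : SimpleGraph V} (R : GridRep G) : Prop :=
  ∀ v, R.hi v = R.lo v + 1

/-- All segments of one of the two directions have unit length. -/
def GridRep.IsSemiUnit {V : Type*} {G : SimpleGraph V} (R : GridRep G) : Prop :=
  (∀ v ∈ R.H, R.hi v = R.lo v + 1) ∨ (∀ v ∉ R.H, R.hi v = R.lo v + 1)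

/-- `G` is a unit grid intersection graph. -/
def IsUGIG {V : Type*} (G : SimpleGraph V) : Prop := ∃ R : GridRep G, R.IsUnit

/-- `G` is a grid intersection graph with a representation in which the segments of one
partition have unit length. -/
def IsUSEG {V : Type*} (G : SimpleGraph V) : Prop := ∃ R : GridRep G, R.IsSemiUnit

/-! ### Orderings of the endpoints -/

/-- The three kinds of coordinates a segment contributes: its lower endpoint and its upper
endpoint on the axis it is parallel to, and its position on the other axis. -/
inductive Mark
  | lo
  | hi
  | pt

/-- A coordinate of a segment, as a formal object. -/
abbrev Event (n : ℕ) : Type := Fin n × Mark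

/-- A pair of lists of events, one for each axis. -/
structure Orders (n : ℕ) where
  /-- the events on the `x`-axis, from left to right -/
  xs : List (Event n)
  /-- the events on the `y`-axis, from bottom to top -/
  ys : List (Event n)

/-- The events on the axis to which exactly the segments of `A` are parallel: both endpoints for
the members of `A`, the position for the others. -/
def IsEventOf {n : ℕ} (A : Set (Fin n)) (e : Event n) : Prop :=
  (e.1 ∈ A ∧ (e.2 = Mark.lo ∨ e.2 = Mark.hi)) ∨ (e.1 ∉ A ∧ e.2 = Mark.pt)

/-- The real coordinate that a representation gives to an event. -/
def GridRep.coord {n : ℕ} {G : SimpleGraph (Fin n)} (R : GridRep G) : Event n → ℝ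
  | (v, Mark.lo) => R.lo v
  | (v, Mark.hi) => R.hi v
  | (v, Mark.pt) => R.pos v

/-- `D` lists, on each axis, precisely the events of the representation `R`, in strictly
increasing order of their coordinates. -/
def GridRep.Induces {n : ℕ} {G : SimpleGraph (Fin n)} (R : GridRep G) (D : Orders n) : Prop :=
  ((∀ e, e ∈ D.xs ↔ IsEventOf R.H e) ∧ D.xs.Pairwise (fun a b => R.coord a < R.coord b)) ∧
  ((∀ e, e ∈ D.ys ↔ IsEventOf R.Hᶜ e) ∧ D.ys.Pairwise (fun a b => R.coord a < R.coord b))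

/-- `D` is the pair of endpoint orderings of some unit grid representation of `G`. -/
def UGIGWitness {n : ℕ} (G : SimpleGraph (Fin n)) (D : Orders n) : Prop :=
  ∃ R : GridRep G, R.IsUnit ∧ R.Induces D

/-- `D` is the pair of endpoint orderings of some grid representation of `G` in which one
partition consists of unit segments. -/
def USEGWitness {n : ℕ} (G : SimpleGraph (Fin n)) (D : Orders n) : Prop :=
  ∃ R : GridRep G, R.IsSemiUnit ∧ R.Induces D

/-- `a` occurs before `b` in the list `l`. -/
def Before {α : Type*} (l : List α) (a b : α) : Prop := List.Sublist [a, b] l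

/-- In the orderings `D`, the horizontal segment `h` crosses the vertical segment `v`. -/
def Orders.Cross {n : ℕ} (D : Orders n) (h v : Fin n) : Prop :=
  (Before D.xs (h, Mark.lo) (v, Mark.pt) ∧ Before D.xs (v, Mark.pt) (h, Mark.hi)) ∧
  (Before D.ys (v, Mark.lo) (h, Mark.pt) ∧ Before D.ys (h, Mark.pt) (v, Mark.hi))

/-- The purely combinatorial condition that `D` describes `G`: for some partition into horizontal
and vertical segments, the two lists enumerate the appropriate events without repetition, lower
endpoints precede upper endpoints, and the crossings are exactly the edges of `G`. -/
def Orders.Describes {n : ℕ} (D : Orders n) (G : SimpleGraph (Fin n)) : Prop :=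
  ∃ H : Set (Fin n),
    (D.xs.Nodup ∧ ∀ e, e ∈ D.xs ↔ IsEventOf H e) ∧
    (D.ys.Nodup ∧ ∀ e, e ∈ D.ys ↔ IsEventOf Hᶜ e) ∧
    (∀ v ∈ H, Before D.xs (v, Mark.lo) (v, Mark.hi)) ∧
    (∀ v ∉ H, Before D.ys (v, Mark.lo) (v, Mark.hi)) ∧
    (∀ u v, G.Adj u v ↔ (u ∈ H ∧ v ∉ H ∧ D.Cross u v) ∨ (v ∈ H ∧ u ∉ H ∧ D.Cross v u))

/-- No segment parallel to the axis contains another one in its span. -/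
def Proper {n : ℕ} (l : List (Event n)) : Prop :=
  ¬ ∃ u v : Fin n, Before l (u, Mark.lo) (v, Mark.lo) ∧ Before l (v, Mark.hi) (u, Mark.hi)

/-! ### Encodings by bit strings -/

/-- The number of vertices in unary, closed by a `0`, followed by the rows of the adjacency
matrix. -/
noncomputable def encodeGraph {n : ℕ} (G : SimpleGraph (Fin n)) : List Bool :=
  List.replicate n true ++ false ::
    (List.finRange n).flatMap (fun i => (List.finRange n).map (fun j =>
      open scoped Classical in decide (G.Adj i j)))

/-- Three bits for the kind of an event, closing the name of its vertex. -/
def encodeMark : Mark → List Bool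
  | Mark.lo => [false, true, false]
  | Mark.hi => [false, true, true]
  | Mark.pt => [false, false, true]

/-- An event: the name of the vertex in binary, each digit `b` written as `1b`, and the kind. -/
def encodeEvent {n : ℕ} (e : Event n) : List Bool :=
  (Nat.bits e.1.val).flatMap (fun b => [true, b]) ++ encodeMark e.2

/-- An ordering: its events one after the other, closed by `000`. -/
def encodeOrder {n : ℕ} (l : List (Event n)) : List Bool :=
  l.flatMap encodeEvent ++ [false, false, false]

/-- The two orderings one after the other. -/
def Orders.encode {n : ℕ} (D : Orders n) : List Bool :=
  encodeOrder D.xs ++ encodeOrder D.ys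

/-! ### Polynomial time and the class NP -/

/-- Two bit strings on one tape, separated by a blank. -/
def encodePair (p : List Bool × List Bool) : List (Option Bool) :=
  p.1.map some ++ none :: p.2.map some

/-- The binary relation `r` on bit strings is decided by a Turing machine in time polynomial in
the total length of its two arguments. -/
def PolyTimeDecidable (r : List Bool → List Bool → Prop) : Prop :=
  Nonempty (Turing.TM2ComputableInPolyTime encodePair Computability.encodeBool
    (fun p => open scoped Classical in decide (r p.1 p.2)))

/-- The complexity class NP, by polynomial-time verifiers and polynomially long certificates. -/
def InNP (L : Language Bool) : Prop :=
  ∃ (r : List Bool → List Bool → Prop) (p : Polynomial ℕ), PolyTimeDecidable r ∧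
    ∀ x, x ∈ L ↔ ∃ w : List Bool, w.length ≤ p.eval x.length ∧ r x w

/-- The recognition problem of a graph class, as the language of the encodings of its members. -/
def recognition (C : (n : ℕ) → SimpleGraph (Fin n) → Prop) : Language Bool :=
  {x | ∃ (n : ℕ) (G : SimpleGraph (Fin n)), x = encodeGraph G ∧ C n G}

/-- The relation "`w` encodes a certificate for the graph encoded by `x`". -/
def certifies (W : (n : ℕ) → SimpleGraph (Fin n) → Orders n → Prop) (x w : List Bool) : Prop :=
  ∃ (n : ℕ) (G : SimpleGraph (Fin n)) (D : Orders n),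
    x = encodeGraph G ∧ w = D.encode ∧ W n G D

end UnitGrid

/-!
The theorem has a geometric half and a computational half.

*Geometry.* Two segments of equal length on one axis cannot contain each other strictly, so orderings
that come from unit segments are proper. Conversely, if a list of endpoints is proper, then the upper
endpoints occur in the same order as the lower ones, and coordinates can be chosen greedily from left
to right: an upper endpoint is put at distance one from its lower endpoint, every other event is put
below all upper endpoints that are still due (`exists_unit_coord`). The two axes do not interact, and
whether segments cross depends on the orderings only; this gives `ugigWitness_iff` and
`usegWitness_iff`. In an arbitrary representation several events may share a coordinate. Sorting the
events lexicographically by coordinate, kind (lower endpoint, position, upper endpoint) and vertex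
resolves the ties without changing the crossings and keeps unit segments free of containments
(`GridRep.exists_orders`); hence every graph of the class has a witness (`isUGIG_iff`, `isUSEG_iff`).
A witness lists at most `6n` events with names of `O(log n)` bits (`sizeBound_isBigO`).

*Computation.* Verifying a witness thus amounts to checking `Orders.Describes` and `Proper`, which
involve only quantifiers over vertices and positions in the two strings. To obtain an honest Turing
machine, programs over finitely many registers with values up to the length of the input are compiled
to multi-stack machines: a register is a pair of stacks holding the input split at the value of the
register, which is a counter and a reading head at the same time (`Exec.steps`,
`polyTimeDecidable_of_prog`). The functions computed by such programs in polynomial time (`Comp`)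
are closed under primitive recursion with bounded values (`Comp.rec`), and the decidable predicates
(`CompPred`) under bounded quantifiers and reading of the input. The codes of events form a prefix
code (`code_prefix_free`), so the events of a certificate are found by iterating a computable map on
positions (`next`, `evPos`), and `certifies_ugigWitness_iff`, `certifies_usegWitness_iff` express the
relation to be decided by bounded quantifiers over these positions. Membership in NP follows from the
bound on the length of witnesses (`inNP_recognition`).
-/

namespace UnitGrid

/-! ### Structured programs over bounded registers -/

/-- Structured programs over registers. A register of value `i` over a tape `W` is stored as two
stacks, the reversal of the first `i` symbols of `W` (side `false`) and the remaining symbols (side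
`true`); so it is at the same time a counter with values `0, …, |W|` and a two-way read-only head on
`W`. A test looks at the top of one of the two stacks. -/
inductive Prog
  /-- move the top symbol of the stack of the given side to the other side -/
  | mv (r : ℕ) (s : Bool)
  /-- sequential composition -/
  | seq (p q : Prog)
  /-- case distinction by a test -/
  | ite (r : ℕ) (s : Bool) (c : Option (Option Bool) → Bool) (p q : Prog)
  /-- iteration as long as a test succeeds -/
  | loop (r : ℕ) (s : Bool) (c : Option (Option Bool) → Bool) (p : Prog)

/-- The content of the stack of side `s` for a register of value `i`. -/
def side (W : List (Option Bool)) (i : ℕ) : Bool → List (Option Bool)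
  | true => W.drop i
  | false => (W.take i).reverse

/-- The value of a register after a symbol has been taken from side `s`. -/
def moved (W : List (Option Bool)) (i : ℕ) : Bool → ℕ
  | true => min W.length (i + 1)
  | false => i - 1

/-- `Exec W p ρ ρ' t`: over the tape `W`, the program `p` started with register values `ρ`
terminates with register values `ρ'` after `t` machine steps. -/
inductive Exec (W : List (Option Bool)) : Prog → (ℕ → ℕ) → (ℕ → ℕ) → ℕ → Prop
  | mv (r s ρ) : Exec W (.mv r s) ρ (Function.update ρ r (moved W (ρ r) s)) 1
  | seq {p q ρ ρ' ρ'' t t'} : Exec W p ρ ρ' t → Exec W q ρ' ρ'' t' →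
      Exec W (.seq p q) ρ ρ'' (t + t')
  | ite_true {r s c p q ρ ρ' t} : c (side W (ρ r) s).head? = true → Exec W p ρ ρ' t →
      Exec W (.ite r s c p q) ρ ρ' (1 + t)
  | ite_false {r s c p q ρ ρ' t} : c (side W (ρ r) s).head? = false → Exec W q ρ ρ' t →
      Exec W (.ite r s c p q) ρ ρ' (1 + t)
  | loop_false {r s c p ρ} : c (side W (ρ r) s).head? = false →
      Exec W (.loop r s c p) ρ ρ 1
  | loop_true {r s c p ρ ρ' ρ'' t t'} : c (side W (ρ r) s).head? = true → Exec W p ρ ρ' t →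
      Exec W (.loop r s c p) ρ' ρ'' t' → Exec W (.loop r s c p) ρ ρ'' (1 + t + t')

/-- A bound for the registers that a program uses. -/
def Prog.width : Prog → ℕ
  | .mv r _ => r
  | .seq p q => max p.width q.width
  | .ite r _ _ p q => max r (max p.width q.width)
  | .loop r _ _ p => max r p.width

theorem moved_le {W : List (Option Bool)} {i : ℕ} (h : i ≤ W.length) (s : Bool) :
    moved W i s ≤ W.length := by
  cases s
  · exact (Nat.sub_le _ _).trans h
  · exact min_le_left _ _

theorem Exec.le_length {W : List (Option Bool)} {p : Prog} {ρ ρ' : ℕ → ℕ} {t : ℕ}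
    (h : Exec W p ρ ρ' t) : (∀ r, ρ r ≤ W.length) → ∀ r, ρ' r ≤ W.length := by
  induction h with
  | mv r s ρ =>
    intro h r'
    by_cases e : r' = r
    · subst e
      rw [Function.update_self]
      exact moved_le (h _) s
    · rw [Function.update_of_ne e]
      exact h r'
  | seq _ _ ih₁ ih₂ => exact fun h => ih₂ (ih₁ h)
  | ite_true _ _ ih => exact ih
  | ite_false _ _ ih => exact ih
  | loop_false _ => exact id
  | loop_true _ _ _ ih₁ ih₂ => exact fun h => ih₂ (ih₁ h)

/-! ### Compilation to multi-stack Turing machines -/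

/-- The stacks of the compiled machine: input, output, and two for each of `d + 1` registers. -/
abbrev Stk (d : ℕ) : Type := Bool ⊕ (Fin (d + 1) × Bool)

/-- The alphabets of the stacks: bits on the output, bits and the blank elsewhere. -/
abbrev Alph (d : ℕ) : Stk d → Type
  | .inl true => Bool
  | .inl false => Option Bool
  | .inr _ => Option Bool

/-- The control states that the compiled machine needs for a program. -/
def Prog.Lbl : Prog → Type
  | .mv _ _ => Unit
  | .seq p q => p.Lbl ⊕ q.Lbl
  | .ite _ _ _ p q => Option (p.Lbl ⊕ q.Lbl)
  | .loop _ _ _ p => Option p.Lbl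

instance Prog.fintypeLbl : (p : Prog) → Fintype p.Lbl
  | .mv _ _ => inferInstanceAs (Fintype Unit)
  | .seq p q => letI := p.fintypeLbl; letI := q.fintypeLbl
    inferInstanceAs (Fintype (p.Lbl ⊕ q.Lbl))
  | .ite _ _ _ p q => letI := p.fintypeLbl; letI := q.fintypeLbl
    inferInstanceAs (Fintype (Option (p.Lbl ⊕ q.Lbl)))
  | .loop _ _ _ p => letI := p.fintypeLbl
    inferInstanceAs (Fintype (Option p.Lbl))

/-- The control state in which a program starts. -/
def Prog.entry : (p : Prog) → p.Lbl
  | .mv _ _ => ()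
  | .seq p _ => .inl p.entry
  | .ite _ _ _ _ _ => none
  | .loop _ _ _ _ => none

open Turing.TM2.Stmt in
/-- The code of a program, placed by `emb` among the control states `Λ` of a machine and continuing
at `exit`. The internal memory of the machine holds the last symbol read. -/
def Prog.code {Λ : Type} (d : ℕ) : (p : Prog) → (p.Lbl → Λ) → Λ → p.Lbl →
    Turing.TM2.Stmt (Alph d) Λ (Option (Option Bool))
  | .mv r s, _, exit, _ =>
    pop (.inr (Fin.ofNat (d + 1) r, s)) (fun _ a => a)
      (branch Option.isSome
        (push (.inr (Fin.ofNat (d + 1) r, !s)) (fun v => v.getD none) (goto fun _ => exit))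
        (goto fun _ => exit))
  | .seq p q, emb, exit, l =>
    match l with
    | .inl l => p.code d (fun i => emb (.inl i)) (emb (.inr q.entry)) l
    | .inr l => q.code d (fun i => emb (.inr i)) exit l
  | .ite r s c p q, emb, exit, l =>
    match l with
    | none => peek (.inr (Fin.ofNat (d + 1) r, s)) (fun _ a => a)
        (branch c (goto fun _ => emb (some (.inl p.entry))) (goto fun _ => emb (some (.inr q.entry))))
    | some (.inl l) => p.code d (fun i => emb (some (.inl i))) exit l
    | some (.inr l) => q.code d (fun i => emb (some (.inr i))) exit l
  | .loop r s c p, emb, exit, l =>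
    match l with
    | none => peek (.inr (Fin.ofNat (d + 1) r, s)) (fun _ a => a)
        (branch c (goto fun _ => emb (some p.entry)) (goto fun _ => exit))
    | some l => p.code d (fun i => emb (some i)) (emb none) l

/-- `n` steps of the partial map `f` lead from `a` to `b`. -/
def Steps {σ : Type*} (f : σ → Option σ) (n : ℕ) (a b : σ) : Prop :=
  (flip Bind.bind f)^[n] (some a) = some b

theorem Steps.one {σ : Type*} {f : σ → Option σ} {a b : σ} (h : f a = some b) : Steps f 1 a b := h

theorem Steps.trans {σ : Type*} {f : σ → Option σ} {m n : ℕ} {a b c : σ} (h₁ : Steps f m a b)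
    (h₂ : Steps f n b c) : Steps f (m + n) a c := by
  unfold Steps at *
  rw [add_comm, Function.iterate_add_apply, h₁, h₂]

theorem Steps.trans_eq {σ : Type*} {f : σ → Option σ} {m : ℕ} {a b c : σ} (h₁ : Steps f m a b)
    (h₂ : b = c) : Steps f m a c := h₂ ▸ h₁

/-- The stacks of a running program: the registers hold `ρ`, input and output are empty. -/
def contents (d : ℕ) (W : List (Option Bool)) (ρ : ℕ → ℕ) : (k : Stk d) → List (Alph d k)
  | .inl true => []
  | .inl false => []
  | .inr (r, s) => side W (ρ r) s

theorem ofNat_val_eq {d r : ℕ} (h : r ≤ d) : (Fin.ofNat (d + 1) r : ℕ) = r :=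
  Nat.mod_eq_of_lt (Nat.lt_succ_of_le h)

theorem contents_mv {d : ℕ} {W : List (Option Bool)} {ρ : ℕ → ℕ} {r : ℕ} (hr : r ≤ d) (s : Bool)
    {a : Option Bool} {l : List (Option Bool)} (hρ : ρ r ≤ W.length)
    (h : side W (ρ r) s = a :: l) :
    Function.update (Function.update (contents d W ρ) (.inr (Fin.ofNat (d + 1) r, s)) l)
      (.inr (Fin.ofNat (d + 1) r, !s)) (a :: side W (ρ r) (!s)) =
    contents d W (Function.update ρ r (moved W (ρ r) s)) := by
  have key : side W (moved W (ρ r) s) s = l ∧ side W (moved W (ρ r) s) (!s) =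
      a :: side W (ρ r) (!s) := by
    cases s
    · simp only [side, moved, Bool.not_false] at h ⊢
      obtain ⟨i, hi⟩ : ∃ i, ρ r = i + 1 := by
        refine ⟨ρ r - 1, ?_⟩
        have : ρ r ≠ 0 := by
          intro h0
          simp [h0] at h
        omega
      rw [hi] at h hρ ⊢
      have hlt : i < W.length := hρ
      rw [List.take_succ_eq_append_getElem hlt, List.reverse_append] at h
      simp only [List.reverse_cons, List.reverse_nil, List.nil_append, List.cons_append,
        List.cons.injEq] at h
      simp only [Nat.add_sub_cancel]
      refine ⟨h.2, ?_⟩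
      rw [← h.1, ← List.drop_eq_getElem_cons hlt]
    · simp only [side, moved, Bool.not_true] at h ⊢
      have hlt : ρ r < W.length := by
        by_contra hge
        rw [List.drop_eq_nil_of_le (not_lt.mp hge)] at h
        simp at h
      rw [min_eq_right (show ρ r + 1 ≤ W.length from hlt)]
      rw [List.drop_eq_getElem_cons hlt, List.cons.injEq] at h
      refine ⟨h.2, ?_⟩
      rw [List.take_succ_eq_append_getElem hlt, List.reverse_append, ← h.1]
      rfl
  funext k
  rcases k with b | ⟨r', s'⟩
  · rw [Function.update_of_ne (by simp), Function.update_of_ne (by simp)]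
    cases b <;> rfl
  · by_cases hr' : r' = Fin.ofNat (d + 1) r
    · subst hr'
      have e : contents d W (Function.update ρ r (moved W (ρ r) s)) (.inr (Fin.ofNat (d + 1) r, s')) =
          side W (moved W (ρ r) s) s' := by
        show side W (Function.update ρ r _ (Fin.ofNat (d + 1) r : ℕ)) s' = _
        rw [ofNat_val_eq hr, Function.update_self]
      rw [e]
      by_cases hs : s' = s
      · subst hs
        rw [Function.update_of_ne (by simp), Function.update_self, key.1]
      · have hs : s' = !s := by cases s <;> cases s' <;> simp_all
        subst hs
        rw [Function.update_self, key.2]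
    · have hne : ∀ s'', (Sum.inr (r', s') : Stk d) ≠ .inr (Fin.ofNat (d + 1) r, s'') :=
        fun s'' e => hr' (congrArg Prod.fst (Sum.inr.inj e))
      rw [Function.update_of_ne (hne _), Function.update_of_ne (hne _)]
      show side W (ρ r') s' = side W (Function.update ρ r _ (r' : ℕ)) s'
      rw [Function.update_of_ne]
      rintro rfl
      exact hr' (Fin.ext (by rw [ofNat_val_eq hr]))

theorem moved_of_side_eq_nil {W : List (Option Bool)} {i : ℕ} (hi : i ≤ W.length) {s : Bool}
    (h : side W i s = []) : moved W i s = i := by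
  cases s
  · simp only [side, List.reverse_eq_nil_iff, List.take_eq_nil_iff] at h
    rcases h with h | h
    · simp [moved, h]
    · subst h
      have : i = 0 := by simpa using hi
      simp [moved, this]
  · simp only [side, List.drop_eq_nil_iff] at h
    simp only [moved]
    omega

/-- The compiled code simulates a program step by step. -/
theorem Exec.steps {Λ : Type} {d : ℕ} {W : List (Option Bool)}
    {M : Λ → Turing.TM2.Stmt (Alph d) Λ (Option (Option Bool))} {p : Prog} {ρ ρ' : ℕ → ℕ} {t : ℕ}
    (h : Exec W p ρ ρ' t) : (∀ r, ρ r ≤ W.length) → p.width ≤ d → ∀ (emb : p.Lbl → Λ) (exit : Λ),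
      (∀ l, M (emb l) = p.code d emb exit l) → ∀ v, ∃ v',
      Steps (Turing.TM2.step M) t ⟨some (emb p.entry), v, contents d W ρ⟩
        ⟨some exit, v', contents d W ρ'⟩ := by
  have top : ∀ (ρ : ℕ → ℕ) (r : ℕ) (s : Bool), r ≤ d →
      contents d W ρ (.inr (Fin.ofNat (d + 1) r, s)) = side W (ρ r) s := by
    intro ρ r s hr
    show side W (ρ (Fin.ofNat (d + 1) r : ℕ)) s = _
    rw [ofNat_val_eq hr]
  induction h with
  | mv r s ρ =>
    intro hρ hd emb exit hM v
    have hr : r ≤ d := hd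
    refine ⟨(side W (ρ r) s).head?, Steps.one ?_⟩
    simp only [Turing.TM2.step, Option.some.injEq]
    rw [hM]
    simp only [Prog.code, Turing.TM2.stepAux, top _ _ _ hr]
    cases hs : side W (ρ r) s with
    | nil =>
      simp only [List.head?_nil, Option.isSome_none, cond_false, List.tail_nil]
      congr 1
      rw [moved_of_side_eq_nil (hρ r) hs, Function.update_eq_self]
      conv_rhs => rw [← Function.update_eq_self (.inr (Fin.ofNat (d + 1) r, s)) (contents d W ρ)]
      rw [top _ _ _ hr, hs]
    | cons a l =>
      simp only [List.head?_cons, Option.isSome_some, cond_true, List.tail_cons, Option.getD_some]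
      congr 1
      rw [← contents_mv hr s (hρ r) hs, Function.update_of_ne (by simp), top _ _ _ hr]
  | seq h₁ h₂ ih₁ ih₂ =>
    rename_i p q _ _ _ _ _
    intro hρ hd emb exit hM v
    have hd : p.width ≤ d ∧ q.width ≤ d := max_le_iff.mp hd
    obtain ⟨v₁, e₁⟩ := ih₁ hρ hd.1 (fun i => emb (.inl i)) (emb (.inr q.entry))
      (fun l => hM (.inl l)) v
    obtain ⟨v₂, e₂⟩ := ih₂ (h₁.le_length hρ) hd.2 (fun i => emb (.inr i)) exit
      (fun l => hM (.inr l)) v₁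
    exact ⟨v₂, e₁.trans e₂⟩
  | ite_true hc h₁ ih =>
    rename_i r s c p q ρ₀ _ _
    intro hρ hd emb exit hM v
    have hd : r ≤ d ∧ p.width ≤ d ∧ q.width ≤ d := by simpa [Prog.width] using hd
    obtain ⟨v₁, e₁⟩ := ih hρ hd.2.1 (fun i => emb (some (.inl i))) exit
      (fun l => hM (some (.inl l))) ((side W (ρ₀ r) s).head?)
    refine ⟨v₁, (Steps.one ?_).trans e₁⟩
    simp only [Turing.TM2.step, Option.some.injEq]
    erw [hM none]
    simp only [Prog.code, Turing.TM2.stepAux, top _ _ _ hd.1, hc, cond_true]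
  | ite_false hc h₁ ih =>
    rename_i r s c p q ρ₀ _ _
    intro hρ hd emb exit hM v
    have hd : r ≤ d ∧ p.width ≤ d ∧ q.width ≤ d := by simpa [Prog.width] using hd
    obtain ⟨v₁, e₁⟩ := ih hρ hd.2.2 (fun i => emb (some (.inr i))) exit
      (fun l => hM (some (.inr l))) ((side W (ρ₀ r) s).head?)
    refine ⟨v₁, (Steps.one ?_).trans e₁⟩
    simp only [Turing.TM2.step, Option.some.injEq]
    erw [hM none]
    simp only [Prog.code, Turing.TM2.stepAux, top _ _ _ hd.1, hc, cond_false]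
  | loop_false hc =>
    rename_i r s c p ρ
    intro hρ hd emb exit hM v
    have hd : r ≤ d ∧ p.width ≤ d := by simpa [Prog.width] using hd
    refine ⟨(side W (ρ r) s).head?, Steps.one ?_⟩
    simp only [Turing.TM2.step, Option.some.injEq]
    erw [hM none]
    simp only [Prog.code, Turing.TM2.stepAux, top _ _ _ hd.1, hc, cond_false]
  | loop_true hc h₁ h₂ ih₁ ih₂ =>
    rename_i r s c p ρ₀ _ _ _ _
    intro hρ hd emb exit hM v
    have hd' : r ≤ d ∧ p.width ≤ d := by simpa [Prog.width] using hd
    obtain ⟨v₁, e₁⟩ := ih₁ hρ hd'.2 (fun i => emb (some i)) (emb none) (fun l => hM (some l))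
      ((side W (ρ₀ r) s).head?)
    obtain ⟨v₂, e₂⟩ := ih₂ (h₁.le_length hρ) hd emb exit hM v₁
    refine ⟨v₂, ((Steps.one ?_).trans e₁).trans e₂⟩
    simp only [Turing.TM2.step, Option.some.injEq]
    erw [hM none]
    simp only [Prog.code, Turing.TM2.stepAux, top _ _ _ hd'.1, hc, cond_true]

open Turing.TM2.Stmt in
/-- Push a symbol on the left stacks of several registers. -/
def pushAll {d : ℕ} {Λ : Type} (g : Option (Option Bool) → Option Bool)
    (q : Turing.TM2.Stmt (Alph d) Λ (Option (Option Bool))) :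
    List (Fin (d + 1)) → Turing.TM2.Stmt (Alph d) Λ (Option (Option Bool))
  | [] => q
  | r :: rs => push (.inr (r, false)) g (pushAll g q rs)

open Turing.TM2.Stmt in
/-- Pop several register stacks, remembering a popped symbol if there is one. -/
def popAll {d : ℕ} {Λ : Type} (q : Turing.TM2.Stmt (Alph d) Λ (Option (Option Bool))) :
    List (Fin (d + 1) × Bool) → Turing.TM2.Stmt (Alph d) Λ (Option (Option Bool))
  | [] => q
  | x :: xs => pop (.inr x) (fun v a => v.or a) (popAll q xs)

/-- Nothing but the left stacks of the registers is filled. -/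
def leftStacks (d : ℕ) (i l : List (Option Bool)) : (k : Stk d) → List (Alph d k)
  | .inl true => []
  | .inl false => i
  | .inr (_, true) => []
  | .inr (_, false) => l

theorem stepAux_pushAll {d : ℕ} {Λ : Type} (g : Option (Option Bool) → Option Bool)
    (q : Turing.TM2.Stmt (Alph d) Λ (Option (Option Bool))) (v : Option (Option Bool))
    (rs : List (Fin (d + 1))) (hrs : rs.Nodup) (S S' : (k : Stk d) → List (Alph d k))
    (h : ∀ b, S' (.inl b) = S (.inl b)) (h' : ∀ r, S' (.inr (r, true)) = S (.inr (r, true)))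
    (h'' : ∀ r, S' (.inr (r, false)) =
      if r ∈ rs then g v :: S (.inr (r, false)) else S (.inr (r, false))) :
    Turing.TM2.stepAux (pushAll g q rs) v S = Turing.TM2.stepAux q v S' := by
  induction rs generalizing S with
  | nil =>
    have : S = S' := by
      funext k
      rcases k with b | ⟨r, s⟩
      · exact (h b).symm
      · cases s
        · simpa using (h'' r).symm
        · exact (h' r).symm
    rw [this]
    rfl
  | cons r rs ih =>
    rw [List.nodup_cons] at hrs
    simp only [pushAll, Turing.TM2.stepAux]
    refine ih hrs.2 _ (fun b => ?_) (fun r' => ?_) (fun r' => ?_)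
    · rw [h, Function.update_of_ne (by simp)]
    · rw [h', Function.update_of_ne (by simp)]
    · rw [h'']
      by_cases e : r' = r
      · subst e
        rw [if_pos (by simp), if_neg hrs.1, Function.update_self]
      · rw [Function.update_of_ne (fun e' => e (congrArg Prod.fst (Sum.inr.inj e')))]
        simp [e]

theorem stepAux_pushAll_leftStacks {d : ℕ} {Λ : Type} (g : Option (Option Bool) → Option Bool)
    (q : Turing.TM2.Stmt (Alph d) Λ (Option (Option Bool))) (v : Option (Option Bool))
    (i l : List (Option Bool)) :
    Turing.TM2.stepAux (pushAll g q (List.finRange (d + 1))) v (leftStacks d i l) =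
      Turing.TM2.stepAux q v (leftStacks d i (g v :: l)) :=
  stepAux_pushAll g q v _ (List.nodup_finRange _) _ _ (fun b => by cases b <;> rfl) (fun _ => rfl)
    (fun r => by simp [leftStacks])

theorem stepAux_iterate_pushAll {d : ℕ} {Λ : Type} (a : Option Bool)
    (q : Turing.TM2.Stmt (Alph d) Λ (Option (Option Bool))) (v : Option (Option Bool)) (n : ℕ)
    (i l : List (Option Bool)) :
    Turing.TM2.stepAux ((fun q' => pushAll (fun _ => a) q' (List.finRange (d + 1)))^[n] q) v
        (leftStacks d i l) =
      Turing.TM2.stepAux q v (leftStacks d i (List.replicate n a ++ l)) := by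
  induction n generalizing l with
  | zero => rfl
  | succ n ih =>
    rw [Function.iterate_succ_apply', stepAux_pushAll_leftStacks, ih]
    congr 2
    rw [List.replicate_succ', List.append_assoc]
    rfl

theorem exists_stepAux_popAll {d : ℕ} {Λ : Type}
    (q : Turing.TM2.Stmt (Alph d) Λ (Option (Option Bool)))
    (xs : List (Fin (d + 1) × Bool)) (hxs : xs.Nodup) (v : Option (Option Bool))
    (S : (k : Stk d) → List (Alph d k)) :
    ∃ v' S', Turing.TM2.stepAux (popAll q xs) v S = Turing.TM2.stepAux q v' S' ∧
      (∀ b, S' (.inl b) = S (.inl b)) ∧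
      (∀ x, S' (.inr x) = if x ∈ xs then (S (.inr x)).tail else S (.inr x)) ∧
      (v' = none ↔ v = none ∧ ∀ x ∈ xs, S (.inr x) = []) := by
  induction xs generalizing v S with
  | nil => exact ⟨v, S, rfl, by simp, by simp, by simp⟩
  | cons x xs ih =>
    rw [List.nodup_cons] at hxs
    obtain ⟨v', S', h₁, h₂, h₃, h₄⟩ := ih hxs.2 (v.or (S (.inr x)).head?)
      (Function.update S (.inr x) (S (.inr x)).tail)
    refine ⟨v', S', ?_, fun b => ?_, fun y => ?_, ?_⟩
    · rw [← h₁]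
      rfl
    · rw [h₂, Function.update_of_ne (by simp)]
    · rw [h₃]
      by_cases e : y = x
      · subst e
        rw [if_neg hxs.1, if_pos (by simp), Function.update_self]
      · rw [Function.update_of_ne (fun e' => e (Sum.inr.inj e'))]
        simp [e]
    · rw [h₄, Option.or_eq_none_iff, List.head?_eq_none_iff, List.forall_mem_cons, and_assoc]
      refine and_congr_right fun _ => and_congr_right fun _ => forall₂_congr fun y hy => ?_
      rw [Function.update_of_ne]
      intro e
      exact hxs.1 (Sum.inr.inj e ▸ hy)

open Turing.TM2.Stmt in
/-- The code of the machine that copies its input, followed by eight blanks, into all registers,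
runs the program `p`, writes on the output whether register `0` is nonzero, and cleans up. -/
noncomputable def Prog.machineCode (p : Prog) :
    Option Bool ⊕ p.Lbl → Turing.TM2.Stmt (Alph p.width) (Option Bool ⊕ p.Lbl) (Option (Option Bool))
  | .inl none =>
    pop (.inl false) (fun _ a => a)
      (branch Option.isSome
        (pushAll (fun v => v.getD none) (goto fun _ => .inl none) (List.finRange (p.width + 1)))
        ((fun q => pushAll (fun _ => none) q (List.finRange (p.width + 1)))^[8]
          (goto fun _ => .inr p.entry)))
  | .inl (some false) =>
    peek (.inr (0, false)) (fun _ a => a)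
      (branch Option.isSome
        (push (.inl true) (fun _ => true) (goto fun _ => .inl (some true)))
        (push (.inl true) (fun _ => false) (goto fun _ => .inl (some true))))
  | .inl (some true) =>
    load (fun _ => none) (popAll (branch Option.isSome (goto fun _ => .inl (some true)) halt)
      Finset.univ.toList)
  | .inr l => p.code p.width .inr (.inl (some false)) l

/-- The machine executing a program. -/
noncomputable def Prog.machine (p : Prog) : Turing.FinTM2 where
  K := Stk p.width
  k₀ := .inl false
  k₁ := .inl true
  Γ := Alph p.width
  Λ := Option Bool ⊕ p.Lbl
  main := .inl none
  σ := Option (Option Bool)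
  initialState := none
  Γk₀Fin := inferInstanceAs (Fintype (Option Bool))
  m := p.machineCode

/-- The tape on which programs run: the input followed by some blanks, which make sure that small
numbers can be stored in the registers. -/
def pad (I : List (Option Bool)) : List (Option Bool) := I ++ List.replicate 8 none

theorem Prog.steps_init (p : Prog) (i l : List (Option Bool)) (v : Option (Option Bool)) :
    Steps (Turing.TM2.step p.machineCode) (i.length + 1)
      ⟨some (.inl none), v, leftStacks p.width i l⟩
      ⟨some (.inr p.entry), none,
        leftStacks p.width [] (List.replicate 8 none ++ (i.reverse ++ l))⟩ := by
  induction i generalizing l v with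
  | nil =>
    refine Steps.one ?_
    simp only [Turing.TM2.step, Prog.machineCode, Turing.TM2.stepAux, Option.some.injEq]
    have e : Function.update (leftStacks p.width [] l) (.inl false)
        (leftStacks p.width [] l (.inl false)).tail = leftStacks p.width [] l :=
      Function.update_eq_self _ _
    rw [e, show (leftStacks p.width [] l (.inl false)).head? = none from rfl]
    simp only [Option.isSome_none, cond_false]
    rw [stepAux_iterate_pushAll]
    rfl
  | cons a i ih =>
    rw [show (a :: i).length + 1 = 1 + (i.length + 1) by simp only [List.length_cons]; omega]
    refine (Steps.one ?_).trans ((ih (a :: l) (some a)).trans_eq ?_)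
    · simp only [Turing.TM2.step, Prog.machineCode, Turing.TM2.stepAux, Option.some.injEq]
      have e : Function.update (leftStacks p.width (a :: i) l) (.inl false)
          (leftStacks p.width (a :: i) l (.inl false)).tail = leftStacks p.width i l := by
        funext k
        rcases k with b | ⟨r, s⟩
        · cases b
          · rw [Function.update_self]
            rfl
          · rw [Function.update_of_ne (by simp)]
            rfl
        · rw [Function.update_of_ne (by simp)]
          cases s <;> rfl
      rw [e, show (leftStacks p.width (a :: i) l (.inl false)).head? = some a from rfl]
      simp only [Option.isSome_some, cond_true]
      rw [stepAux_pushAll_leftStacks]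
      rfl
    · simp

/-- Only the output stack is filled. -/
def outStacks (d : ℕ) (b : Bool) : (k : Stk d) → List (Alph d k)
  | .inl true => [b]
  | .inl false => []
  | .inr _ => []

theorem Prog.steps_clean (p : Prog) (b : Bool) (n : ℕ) (v : Option (Option Bool))
    (S : (k : Stk p.width) → List (Alph p.width k)) (h : S (.inl false) = [])
    (h' : S (.inl true) = [b]) (hn : ∀ x, (S (.inr x)).length ≤ n) :
    ∃ t ≤ n + 1, Steps (Turing.TM2.step p.machineCode) t ⟨some (.inl (some true)), v, S⟩
      ⟨none, none, outStacks p.width b⟩ := by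
  induction n generalizing v S with
  | zero =>
    obtain ⟨v', S', h₁, h₂, h₃, h₄⟩ := exists_stepAux_popAll
      (.branch Option.isSome (.goto fun _ => Sum.inl (β := p.Lbl) (some true)) .halt) Finset.univ.toList
      (Finset.nodup_toList _) none S
    have hS : ∀ x, S (.inr x) = [] := fun x => List.eq_nil_of_length_eq_zero (Nat.le_zero.mp (hn x))
    obtain rfl : v' = none := h₄.mpr ⟨rfl, fun x _ => hS x⟩
    refine ⟨1, le_rfl, Steps.one ?_⟩
    simp only [Turing.TM2.step, Prog.machineCode, Turing.TM2.stepAux, Option.some.injEq]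
    rw [h₁]
    simp only [Turing.TM2.stepAux, Option.isSome_none, cond_false]
    congr 1
    funext k
    rcases k with c | x
    · cases c
      · rw [h₂, h]
        rfl
      · rw [h₂, h']
        rfl
    · rw [h₃, hS, if_pos (by simp)]
      rfl
  | succ n ih =>
    obtain ⟨v', S', h₁, h₂, h₃, h₄⟩ := exists_stepAux_popAll
      (.branch Option.isSome (.goto fun _ => Sum.inl (β := p.Lbl) (some true)) .halt) Finset.univ.toList
      (Finset.nodup_toList _) none S
    cases v' with
    | none =>
      refine ⟨1, by omega, Steps.one ?_⟩
      simp only [Turing.TM2.step, Prog.machineCode, Turing.TM2.stepAux, Option.some.injEq]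
      rw [h₁]
      simp only [Turing.TM2.stepAux, Option.isSome_none, cond_false]
      congr 1
      funext k
      rcases k with c | x
      · cases c
        · rw [h₂, h]
          rfl
        · rw [h₂, h']
          rfl
      · rw [h₃, (h₄.mp rfl).2 x (by simp), if_pos (by simp)]
        rfl
    | some a =>
      obtain ⟨t, ht, e⟩ := ih (some a) S' (by rw [h₂, h]) (by rw [h₂, h']) (fun x => by
        rw [h₃, if_pos (by simp), List.length_tail]
        have := hn x
        omega)
      refine ⟨1 + t, by omega, (Steps.one ?_).trans e⟩
      simp only [Turing.TM2.step, Prog.machineCode, Turing.TM2.stepAux, Option.some.injEq]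
      rw [h₁]
      simp only [Turing.TM2.stepAux, Option.isSome_some, cond_true]

/-- A relation decided by a program in a polynomial number of steps is decided by a Turing machine
in polynomial time. -/
theorem polyTimeDecidable_of_prog {r : List Bool → List Bool → Prop} (p : Prog) (T : Polynomial ℕ)
    (h : ∀ x, ∃ ρ' t, Exec (pad (encodePair x)) p (fun _ => (pad (encodePair x)).length) ρ' t ∧
      t ≤ T.eval (pad (encodePair x)).length ∧ (ρ' 0 ≠ 0 ↔ r x.1 x.2)) : PolyTimeDecidable r := by
  classical
  refine ⟨{
    tm := p.machine
    inputAlphabet := Equiv.refl (Option Bool)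
    outputAlphabet := Equiv.refl Bool
    time := (T.comp (Polynomial.X + 8)) + 2 * Polynomial.X + 11
    outputsFun := fun x => Classical.choice ?_ }⟩
  obtain ⟨ρ', t, he, ht, hr⟩ := h x
  set I := encodePair x with hI
  have hlen : (pad I).length = I.length + 8 := by simp [pad]
  have hle := he.le_length (fun _ => le_rfl)
  -- copying the input
  have s₁ := p.steps_init I [] none
  -- running the program
  obtain ⟨v, s₂⟩ := he.steps (d := p.width) (M := p.machineCode) (fun _ => le_rfl) le_rfl .inr
    (.inl (some false)) (fun _ => rfl) none
  have e₁ : leftStacks p.width [] (List.replicate 8 none ++ (I.reverse ++ [])) =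
      contents p.width (pad I) (fun _ => (pad I).length) := by
    funext k
    rcases k with b | ⟨r, s⟩
    · cases b <;> rfl
    · cases s
      · show List.replicate 8 none ++ (I.reverse ++ []) = ((pad I).take (pad I).length).reverse
        simp only [List.take_length, pad, List.reverse_append, List.reverse_replicate,
          List.append_nil]
      · simp [leftStacks, contents, side]
  rw [e₁] at s₁
  -- writing the answer
  have s₃ : Steps (Turing.TM2.step p.machineCode) 1
      ⟨some (.inl (some false)), v, contents p.width (pad I) ρ'⟩
      ⟨some (.inl (some true)), (side (pad I) (ρ' 0) false).head?,
        Function.update (contents p.width (pad I) ρ') (.inl true) [decide (r x.1 x.2)]⟩ := by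
    refine Steps.one ?_
    simp only [Turing.TM2.step, Prog.machineCode, Turing.TM2.stepAux, Option.some.injEq]
    have e : contents p.width (pad I) ρ' (.inr (0, false)) = side (pad I) (ρ' 0) false := rfl
    have e' : (side (pad I) (ρ' 0) false).head?.isSome = decide (r x.1 x.2) := by
      rw [Bool.eq_iff_iff, decide_eq_true_iff, ← hr, List.isSome_head?]
      simp [side, pad]
    rw [e, e']
    cases decide (r x.1 x.2) <;> rfl
  -- cleaning up
  obtain ⟨t₄, ht₄, s₄⟩ := p.steps_clean (decide (r x.1 x.2)) (pad I).length
    (side (pad I) (ρ' 0) false).head?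
    (Function.update (contents p.width (pad I) ρ') (.inl true) [decide (r x.1 x.2)])
    (by rw [Function.update_of_ne (by simp)]; rfl) (by rw [Function.update_self])
    (fun ⟨r, s⟩ => by
      rw [Function.update_of_ne (by simp)]
      cases s
      · simp [contents, side]
      · simp [contents, side])
  have s := ((s₁.trans s₂).trans s₃).trans s₄
  refine ⟨⟨⟨I.length + 1 + t + 1 + t₄, ?_⟩, ?_⟩⟩
  · have a : Turing.initList p.machine (List.map (Equiv.refl (Option Bool)).invFun I) =
        (⟨some (.inl none), none, leftStacks p.width I []⟩ : p.machine.Cfg) := by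
      refine congrArg (Turing.TM2.Cfg.mk (some (Sum.inl none)) none) ?_
      funext k
      rcases k with b | ⟨r, s⟩
      · cases b
        · exact (dif_pos rfl).trans (List.map_id _)
        · exact dif_neg (by simp [Prog.machine])
      · refine (dif_neg (by simp [Prog.machine])).trans ?_
        cases s <;> rfl
    have b : Turing.haltList p.machine (List.map (Equiv.refl Bool).invFun
        (Computability.encodeBool (decide (r x.1 x.2)))) =
        (⟨none, none, outStacks p.width (decide (r x.1 x.2))⟩ : p.machine.Cfg) := by
      refine congrArg (Turing.TM2.Cfg.mk none none) ?_
      funext k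
      rcases k with b | x
      · cases b
        · exact dif_neg (by simp [Prog.machine])
        · exact (dif_pos rfl).trans (List.map_id _)
      · exact dif_neg (by simp [Prog.machine])
    show (flip Bind.bind _)^[_] (some (Turing.initList p.machine _)) =
      some (Turing.haltList p.machine _)
    erw [a, b]
    exact s
  · simp only [Polynomial.eval_add, Polynomial.eval_comp, Polynomial.eval_X, Polynomial.eval_mul,
      Polynomial.eval_ofNat]
    rw [hlen] at ht ht₄
    omega

end UnitGrid

namespace UnitGrid

/-! ### Running times of basic programs -/

/-- The program `p` leads from `ρ` to `ρ'` in at most `T` steps. -/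
def Run (W : List (Option Bool)) (T : ℕ) (p : Prog) (ρ ρ' : ℕ → ℕ) : Prop :=
  ∃ t ≤ T, Exec W p ρ ρ' t

section Run

variable {W : List (Option Bool)} {T T' : ℕ} {p q : Prog} {ρ ρ' ρ'' : ℕ → ℕ}

theorem Run.mono (h : Run W T p ρ ρ') (hT : T ≤ T') : Run W T' p ρ ρ' :=
  let ⟨t, ht, e⟩ := h
  ⟨t, ht.trans hT, e⟩

theorem Run.seq (h : Run W T p ρ ρ') (h' : Run W T' q ρ' ρ'') :
    Run W (T + T') (.seq p q) ρ ρ'' :=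
  let ⟨_, ht, e⟩ := h
  let ⟨_, ht', e'⟩ := h'
  ⟨_, add_le_add ht ht', .seq e e'⟩

theorem Run.mv (r : ℕ) (s : Bool) : Run W 1 (.mv r s) ρ (Function.update ρ r (moved W (ρ r) s)) :=
  ⟨1, le_rfl, .mv r s ρ⟩

theorem Run.le_length (h : Run W T p ρ ρ') (hρ : ∀ r, ρ r ≤ W.length) (r : ℕ) :
    ρ' r ≤ W.length :=
  let ⟨_, _, e⟩ := h
  e.le_length hρ r

theorem isSome_side_false {i : ℕ} (h : i ≤ W.length) :
    (side W i false).head?.isSome = decide (0 < i) := by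
  rw [Bool.eq_iff_iff, List.isSome_head?, decide_eq_true_iff, Nat.pos_iff_ne_zero]
  simp only [side, ne_eq, List.reverse_eq_nil_iff, List.take_eq_nil_iff, not_or]
  refine ⟨fun h' => h'.1, fun h' => ⟨h', ?_⟩⟩
  rintro rfl
  exact h' (Nat.le_zero.mp h)

/-- A loop that counts a register down, with an invariant indexed by the value of that register. -/
theorem exists_run_loop {r : ℕ} (I : ℕ → (ℕ → ℕ) → Prop)
    (hI : ∀ j ρ, I j ρ → ρ r = j ∧ ∀ x, ρ x ≤ W.length)
    (step : ∀ j ρ, I (j + 1) ρ → ∃ ρ', Run W T p ρ ρ' ∧ I j ρ') (j : ℕ) (ρ : ℕ → ℕ) (h : I j ρ) :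
    ∃ ρ', Run W (W.length * (T + 1) + 1) (.loop r false Option.isSome p) ρ ρ' ∧ I 0 ρ' := by
  have main : ∀ j ρ, I j ρ →
      ∃ ρ', Run W (j * (T + 1) + 1) (.loop r false Option.isSome p) ρ ρ' ∧ I 0 ρ' := by
    intro j
    induction j with
    | zero =>
      intro ρ h
      refine ⟨ρ, ⟨1, by omega, .loop_false ?_⟩, h⟩
      rw [isSome_side_false ((hI _ _ h).2 r), (hI _ _ h).1]
      rfl
    | succ j ih =>
      intro ρ h
      obtain ⟨ρ₁, ⟨t₁, ht₁, e₁⟩, h₁⟩ := step j ρ h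
      obtain ⟨ρ₂, ⟨t₂, ht₂, e₂⟩, h₂⟩ := ih ρ₁ h₁
      refine ⟨ρ₂, ⟨1 + t₁ + t₂, ?_, .loop_true ?_ e₁ e₂⟩, h₂⟩
      · have : (j + 1) * (T + 1) = j * (T + 1) + T + 1 := by ring
        omega
      · rw [isSome_side_false ((hI _ _ h).2 r), (hI _ _ h).1]
        simp
  obtain ⟨ρ', h₁, h₂⟩ := main j ρ h
  refine ⟨ρ', h₁.mono ?_, h₂⟩
  have := (hI j ρ h).1 ▸ (hI j ρ h).2 r
  gcongr

/-- Set a register to zero. -/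
def Prog.clear (b : ℕ) : Prog := .loop b false Option.isSome (.mv b false)

theorem exists_run_clear (b : ℕ) (hρ : ∀ r, ρ r ≤ W.length) :
    ∃ ρ', Run W (2 * W.length + 1) (.clear b) ρ ρ' ∧ ρ' b = 0 ∧ ∀ x, x ≠ b → ρ' x = ρ x := by
  obtain ⟨ρ', h₁, h₂⟩ := exists_run_loop (W := W) (r := b) (p := .mv b false) (T := 1)
    (fun j ρ' => ρ' b = j ∧ (∀ x, ρ' x ≤ W.length) ∧ ∀ x, x ≠ b → ρ' x = ρ x)
    (fun j ρ h => ⟨h.1, h.2.1⟩)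
    (fun j ρ' h => ⟨_, .mv b false, by simp [moved, h.1], (Run.mv b false).le_length h.2.1, fun x hx => by
      rw [Function.update_of_ne hx]
      exact h.2.2 x hx⟩) _ ρ ⟨rfl, hρ, fun _ _ => rfl⟩
  exact ⟨ρ', h₁.mono (by omega), h₂.1, h₂.2.2⟩

/-- Copy the register `r` to the register `b`, using `c` as an auxiliary register. -/
def Prog.copy (r b c : ℕ) : Prog :=
  .seq (.clear b) (.seq (.clear c) (.seq
    (.loop r false Option.isSome (.seq (.mv r false) (.seq (.mv b true) (.mv c true))))
    (.loop c false Option.isSome (.seq (.mv c false) (.mv r true)))))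

theorem exists_run_copy {r b c : ℕ} (hrb : r ≠ b) (hrc : r ≠ c) (hbc : b ≠ c)
    (hρ : ∀ r, ρ r ≤ W.length) :
    ∃ ρ', Run W (11 * W.length + 4) (.copy r b c) ρ ρ' ∧ ρ' b = ρ r ∧
      ∀ x, x ≠ b → x ≠ c → ρ' x = ρ x := by
  obtain ⟨ρ₁, h₁, e₁, f₁⟩ := exists_run_clear b hρ
  obtain ⟨ρ₂, h₂, e₂, f₂⟩ := exists_run_clear c (h₁.le_length hρ)
  have hρ₂ := h₂.le_length (h₁.le_length hρ)
  obtain ⟨ρ₃, h₃, e₃⟩ := exists_run_loop (W := W) (r := r)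
    (p := .seq (.mv r false) (.seq (.mv b true) (.mv c true))) (T := 1 + (1 + 1))
    (fun j s => s r = j ∧ (∀ x, s x ≤ W.length) ∧ s b + j = ρ r ∧ s c + j = ρ r ∧
      ∀ x, x ≠ r → x ≠ b → x ≠ c → s x = ρ x)
    (fun j s h => ⟨h.1, h.2.1⟩)
    (fun j s h => by
      have hr := (Run.mv r false).seq ((Run.mv b true).seq (Run.mv c true)) (W := W) (ρ := s)
      refine ⟨_, hr, ?_, hr.le_length h.2.1, ?_, ?_, ?_⟩
      · simp [Function.update_of_ne hrb, Function.update_of_ne hrc, moved, h.1]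
      · have := hρ r
        have := h.2.2.1
        simp only [Function.update_of_ne hbc, Function.update_self, Function.update_of_ne hrb.symm,
          moved]
        omega
      · have := hρ r
        have := h.2.2.2.1
        simp only [Function.update_of_ne hbc.symm, Function.update_self,
          Function.update_of_ne hrc.symm, moved]
        omega
      · intro x hx hx' hx''
        rw [Function.update_of_ne hx'', Function.update_of_ne hx', Function.update_of_ne hx]
        exact h.2.2.2.2 x hx hx' hx'')
    (ρ r) ρ₂ ⟨by rw [f₂ r hrc, f₁ r hrb], hρ₂, by rw [f₂ b hbc, e₁, zero_add],
      by rw [e₂, zero_add], fun x _ hb hc => by rw [f₂ x hc, f₁ x hb]⟩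
  obtain ⟨ρ₄, h₄, e₄⟩ := exists_run_loop (W := W) (r := c)
    (p := .seq (.mv c false) (.mv r true)) (T := 1 + 1)
    (fun j s => s c = j ∧ (∀ x, s x ≤ W.length) ∧ s r + j = ρ r ∧ s b = ρ r ∧
      ∀ x, x ≠ r → x ≠ b → x ≠ c → s x = ρ x)
    (fun j s h => ⟨h.1, h.2.1⟩)
    (fun j s h => by
      have hr := (Run.mv c false).seq (Run.mv r true) (W := W) (ρ := s)
      refine ⟨_, hr, ?_, hr.le_length h.2.1, ?_, ?_, ?_⟩
      · simp [Function.update_of_ne hrc.symm, moved, h.1]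
      · have := hρ r
        have := h.2.2.1
        simp only [Function.update_self, Function.update_of_ne hrc, moved]
        omega
      · rw [Function.update_of_ne hrb.symm, Function.update_of_ne hbc]
        exact h.2.2.2.1
      · intro x hx hx' hx''
        rw [Function.update_of_ne hx, Function.update_of_ne hx'']
        exact h.2.2.2.2 x hx hx' hx'')
    (ρ r) ρ₃ ⟨by have := e₃.2.2.2.1; omega, e₃.2.1, by rw [e₃.1, zero_add],
      by have := e₃.2.2.1; omega, e₃.2.2.2.2⟩
  refine ⟨ρ₄, (h₁.seq (h₂.seq (h₃.seq h₄))).mono (by omega), e₄.2.2.2.1, fun x hb hc => ?_⟩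
  by_cases hx : x = r
  · rw [hx]
    exact e₄.2.2.1
  · exact e₄.2.2.2.2 x hx hb hc

end Run

/-! ### Functions computed by programs in polynomial time -/

/-- The tape that holds a pair of bit strings. -/
def tape (x : List Bool × List Bool) : List (Option Bool) := pad (encodePair x)

/-- A type of assignments: a pair of bit strings together with a fixed number of numerical
variables. -/
class Ctx (α : Type) where
  /-- the pair of bit strings -/
  base : α → List Bool × List Bool
  /-- the number of variables -/
  arity : ℕ
  /-- the values of the variables -/
  var : α → ℕ → ℕ

instance : Ctx (List Bool × List Bool) := ⟨id, 0, fun _ _ => 0⟩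

instance {α : Type} [Ctx α] : Ctx (α × ℕ) where
  base a := Ctx.base a.1
  arity := Ctx.arity α + 1
  var a i := if i = Ctx.arity α then a.2 else Ctx.var a.1 i

variable {α : Type} [Ctx α]

/-- The length of the tape, which bounds all numbers in computations. -/
def cap (a : α) : ℕ := (tape (Ctx.base a)).length

/-- The variables obey the bound. -/
def Ok (a : α) : Prop := ∀ i < Ctx.arity α, Ctx.var a i ≤ cap a

theorem ok_base (x : List Bool × List Bool) : Ok x := fun i hi => absurd hi (Nat.not_lt_zero i)

@[simp] theorem cap_prod (a : α) (i : ℕ) : cap (a, i) = cap a := rfl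

theorem ok_prod {a : α} {i : ℕ} : Ok (a, i) ↔ Ok a ∧ i ≤ cap a := by
  constructor
  · intro h
    refine ⟨fun j hj => ?_, ?_⟩
    · have := h j (Nat.lt_succ_of_lt hj)
      simpa [Ctx.var, Nat.ne_of_lt hj] using this
    · simpa [Ctx.var] using h (Ctx.arity α) (Nat.lt_succ_self _)
  · rintro ⟨h, hi⟩ j hj
    by_cases e : j = Ctx.arity α
    · simpa [Ctx.var, e] using hi
    · have : j < Ctx.arity α := lt_of_le_of_ne (Nat.le_of_lt_succ hj) e
      simpa [Ctx.var, e] using h j this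

/-- The function `f` is computed in polynomial time, up to truncation at the length of the tape:
whatever registers below `b` the variables are stored in, a program puts the value of `f` into the
register `b` and leaves the registers below `b` as they are. -/
def Comp (f : α → ℕ) : Prop :=
  ∀ (R : ℕ → ℕ) (b : ℕ), (∀ i < Ctx.arity α, R i < b) → ∃ (p : Prog) (T : Polynomial ℕ),
    ∀ (a : α) (ρ : ℕ → ℕ), Ok a → (∀ r, ρ r ≤ cap a) → (∀ i < Ctx.arity α, ρ (R i) = Ctx.var a i) →
      ∃ ρ', Run (tape (Ctx.base a)) (T.eval (cap a)) p ρ ρ' ∧ ρ' b = min (cap a) (f a) ∧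
        ∀ r < b, ρ' r = ρ r

open scoped Classical in
/-- The predicate `P` is decided in polynomial time. -/
def CompPred (P : α → Prop) : Prop := Comp fun a => if P a then 1 else 0

/-- The values of `f` do not exceed the length of the tape. -/
def Bdd (f : α → ℕ) : Prop := ∀ a, Ok a → f a ≤ cap a

/-- The separator and the blanks at the end of the tape leave room for small constants. -/
theorem cap_ge (a : α) : 9 ≤ cap a := by
  simp [cap, tape, pad, encodePair]
  omega

theorem Comp.congr' {f g : α → ℕ} (hf : Comp f)
    (h : ∀ a, Ok a → min (cap a) (f a) = min (cap a) (g a)) : Comp g := by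
  intro R b hR
  obtain ⟨p, T, hp⟩ := hf R b hR
  refine ⟨p, T, fun a ρ ha hρ hv => ?_⟩
  rw [← h a ha]
  exact hp a ρ ha hρ hv

theorem Comp.congr {f g : α → ℕ} (hf : Comp f) (h : ∀ a, Ok a → f a = g a) : Comp g :=
  hf.congr' fun a ha => by rw [h a ha]

theorem CompPred.congr {P Q : α → Prop} (hP : CompPred P) (h : ∀ a, Ok a → (P a ↔ Q a)) :
    CompPred Q := by
  classical
  exact Comp.congr hP fun a ha => if_congr (h a ha) rfl rfl

theorem Comp.trunc {f : α → ℕ} (hf : Comp f) : Comp fun a => min (cap a) (f a) :=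
  hf.congr' fun a _ => by rw [← min_assoc, min_self]

theorem bdd_trunc (f : α → ℕ) : Bdd fun a => min (cap a) (f a) := fun _ _ => min_le_left _ _

/-- A computable function depends on further variables only formally. -/
theorem Comp.weaken {f : α → ℕ} (hf : Comp f) : Comp fun a : α × ℕ => f a.1 := by
  intro R b hR
  obtain ⟨p, T, hp⟩ := hf R b fun i hi => hR i (Nat.lt_succ_of_lt hi)
  refine ⟨p, T, fun a ρ ha hρ hv => hp a.1 ρ (ok_prod.mp ha).1 hρ fun i hi => ?_⟩
  rw [hv i (Nat.lt_succ_of_lt hi)]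
  simp [Ctx.var, Nat.ne_of_lt hi]

theorem CompPred.weaken {P : α → Prop} (hP : CompPred P) : CompPred fun a : α × ℕ => P a.1 :=
  Comp.weaken hP

theorem Comp.snd : Comp fun a : α × ℕ => a.2 := by
  intro R b hR
  have hb := hR (Ctx.arity α) (Nat.lt_succ_self _)
  refine ⟨.copy (R (Ctx.arity α)) b (b + 1), 11 * Polynomial.X + 4, fun a ρ ha hρ hv => ?_⟩
  obtain ⟨ρ', h₁, h₂, h₃⟩ := exists_run_copy (b := b) (c := b + 1) (Nat.ne_of_lt hb)
    (show R (Ctx.arity α) ≠ b + 1 by omega) (by omega) hρ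
  refine ⟨ρ', h₁.mono ?_, ?_, fun r hr => h₃ r (by omega) (by omega)⟩
  · simp [cap]
  · rw [h₂, hv _ (Nat.lt_succ_self _)]
    have := (ok_prod.mp ha).2
    simp only [Ctx.var, if_true]
    exact (min_eq_right this).symm

theorem Comp.succ {f : α → ℕ} (hf : Comp f) : Comp fun a => f a + 1 := by
  intro R b hR
  obtain ⟨p, T, hp⟩ := hf R b hR
  refine ⟨.seq p (.mv b true), T + 1, fun a ρ ha hρ hv => ?_⟩
  obtain ⟨ρ', h₁, h₂, h₃⟩ := hp a ρ ha hρ hv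
  refine ⟨_, (h₁.seq (.mv b true)).mono (by simp), ?_, fun r hr => ?_⟩
  · rw [Function.update_self, h₂]
    show min (cap a) (min (cap a) (f a) + 1) = min (cap a) (f a + 1)
    omega
  · rw [Function.update_of_ne (Nat.ne_of_lt hr), h₃ r hr]

theorem Comp.pred {f : α → ℕ} (hf : Comp f) (hb : Bdd f) : Comp fun a => f a - 1 := by
  intro R b hR
  obtain ⟨p, T, hp⟩ := hf R b hR
  refine ⟨.seq p (.mv b false), T + 1, fun a ρ ha hρ hv => ?_⟩
  obtain ⟨ρ', h₁, h₂, h₃⟩ := hp a ρ ha hρ hv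
  refine ⟨_, (h₁.seq (.mv b false)).mono (by simp), ?_, fun r hr => ?_⟩
  · rw [Function.update_self, h₂]
    have := hb a ha
    show min (cap a) (f a) - 1 = min (cap a) (f a - 1)
    omega
  · rw [Function.update_of_ne (Nat.ne_of_lt hr), h₃ r hr]

theorem Comp.const (c : ℕ) : Comp fun _ : α => c := by
  induction c with
  | zero =>
    intro R b _
    refine ⟨.clear b, 2 * Polynomial.X + 1, fun a ρ _ hρ _ => ?_⟩
    obtain ⟨ρ', h₁, h₂, h₃⟩ := exists_run_clear b hρ
    exact ⟨ρ', h₁.mono (by simp [cap]), by simp [h₂], fun r hr => h₃ r (Nat.ne_of_lt hr)⟩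
  | succ c ih => exact ih.succ

/-- Case distinction by a test on the tape symbol at a computed position, or on the question whether
a computed number is zero. -/
theorem Comp.ite_test {f g h : α → ℕ} (s : Bool) (c : Option (Option Bool) → Bool) (hf : Comp f)
    (hg : Comp g) (hh : Comp h) :
    Comp fun a => if c (side (tape (Ctx.base a)) (min (cap a) (f a)) s).head? = true then g a
      else h a := by
  intro R b hR
  obtain ⟨p, T, hp⟩ := hf R b hR
  obtain ⟨q, T', hq⟩ := hg R b hR
  obtain ⟨q', T'', hq'⟩ := hh R b hR
  refine ⟨.seq p (.ite b s c q q'), T + (1 + (T' + T'')), fun a ρ ha hρ hv => ?_⟩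
  obtain ⟨ρ', h₁, h₂, h₃⟩ := hp a ρ ha hρ hv
  have hρ' := h₁.le_length hρ
  have hv' : ∀ i < Ctx.arity α, ρ' (R i) = Ctx.var a i := fun i hi => by
    rw [h₃ _ (hR i hi), hv i hi]
  by_cases hc : c (side (tape (Ctx.base a)) (min (cap a) (f a)) s).head? = true
  · beta_reduce
    rw [if_pos hc]
    obtain ⟨ρ'', ⟨t, ht, e⟩, h₅, h₆⟩ := hq a ρ' ha hρ' hv'
    refine ⟨ρ'', (h₁.seq (q := .ite b s c q q') ⟨1 + t, le_rfl, .ite_true ?_ e⟩).mono ?_, h₅,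
      fun r hr => (h₆ r hr).trans (h₃ r hr)⟩
    · rw [h₂]
      exact hc
    · simp only [Polynomial.eval_add, Polynomial.eval_one]
      omega
  · beta_reduce
    rw [if_neg hc]
    obtain ⟨ρ'', ⟨t, ht, e⟩, h₅, h₆⟩ := hq' a ρ' ha hρ' hv'
    refine ⟨ρ'', (h₁.seq (q := .ite b s c q q') ⟨1 + t, le_rfl, .ite_false ?_ e⟩).mono ?_, h₅,
      fun r hr => (h₆ r hr).trans (h₃ r hr)⟩
    · rw [h₂]
      exact Bool.eq_false_of_not_eq_true hc
    · simp only [Polynomial.eval_add, Polynomial.eval_one]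
      omega

/-- Primitive recursion, as long as all values are bounded by the length of the tape. -/
theorem Comp.rec {z n : α → ℕ} {h : (α × ℕ) × ℕ → ℕ} (hz : Comp z) (hn : Comp n) (hh : Comp h)
    (bz : Bdd z) (bn : Bdd n) (bh : Bdd h) :
    Comp fun a => Nat.rec (motive := fun _ => ℕ) (z a) (fun i v => h ((a, i), v)) (n a) := by
  intro R b hR
  -- the register `b` holds the value, `b + 1` the number of remaining rounds, `b + 2` the index
  obtain ⟨p, T, hp⟩ := hz R b hR
  obtain ⟨q, T', hq⟩ := hn R (b + 1) fun i hi => (hR i hi).trans (Nat.lt_succ_self b)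
  let R' : ℕ → ℕ := fun i => if i = Ctx.arity α then b + 2 else if i = Ctx.arity α + 1 then b else R i
  obtain ⟨s, T'', hs⟩ := hh R' (b + 3) (by
    intro i hi
    have hi : i < Ctx.arity α + 1 + 1 := hi
    simp only [R']
    split_ifs
    · omega
    · omega
    · have := hR i (by omega)
      omega)
  refine ⟨.seq p (.seq q (.seq (.clear (b + 2)) (.loop (b + 1) false Option.isSome
    (.seq s (.seq (.copy (b + 3) b (b + 4)) (.seq (.mv (b + 2) true) (.mv (b + 1) false))))))),
    T + (T' + ((2 * Polynomial.X + 1) +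
      (Polynomial.X * ((T'' + ((11 * Polynomial.X + 4) + (1 + 1))) + 1) + 1))),
    fun a ρ ha hρ hv => ?_⟩
  obtain ⟨ρ₁, h₁, e₁, f₁⟩ := hp a ρ ha hρ hv
  have hρ₁ := h₁.le_length hρ
  obtain ⟨ρ₂, h₂, e₂, f₂⟩ := hq a ρ₁ ha hρ₁ fun i hi => by rw [f₁ _ (hR i hi), hv i hi]
  have hρ₂ := h₂.le_length hρ₁
  obtain ⟨ρ₃, h₃, e₃, f₃⟩ := exists_run_clear (b + 2) hρ₂
  have hρ₃ := h₃.le_length hρ₂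
  rw [min_eq_right (bz a ha)] at e₁
  rw [min_eq_right (bn a ha)] at e₂
  let F : ℕ → ℕ := fun k => Nat.rec (motive := fun _ => ℕ) (z a) (fun i v => h ((a, i), v)) k
  have hF : ∀ k ≤ n a, F k ≤ cap a := by
    intro k
    induction k with
    | zero => exact fun _ => bz a ha
    | succ k ih =>
      intro hk
      exact bh ((a, k), F k) (ok_prod.mpr ⟨ok_prod.mpr ⟨ha, (Nat.le_of_succ_le hk).trans (bn a ha)⟩,
        ih (Nat.le_of_succ_le hk)⟩)
  obtain ⟨ρ₄, h₄, e₄⟩ := exists_run_loop (W := tape (Ctx.base a)) (r := b + 1)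
    (p := .seq s (.seq (.copy (b + 3) b (b + 4)) (.seq (.mv (b + 2) true) (.mv (b + 1) false))))
    (T := T''.eval (cap a) + ((11 * cap a + 4) + (1 + 1)))
    (fun j σ => σ (b + 1) = j ∧ (∀ x, σ x ≤ cap a) ∧ σ (b + 2) + j = n a ∧ σ b = F (σ (b + 2)) ∧
      ∀ x < b, σ x = ρ x)
    (fun j σ h => ⟨h.1, h.2.1⟩)
    (fun j σ hσ => by
      obtain ⟨g₁, g₂, g₃, g₄, g₅⟩ := hσ
      have hok : Ok (((a, σ (b + 2)), σ b) : (α × ℕ) × ℕ) :=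
        ok_prod.mpr ⟨ok_prod.mpr ⟨ha, g₂ _⟩, g₂ _⟩
      obtain ⟨σ₁, k₁, l₁, m₁⟩ := hs ((a, σ (b + 2)), σ b) σ hok g₂ (by
        intro i hi
        have hi : i < Ctx.arity α + 1 + 1 := hi
        by_cases c₁ : i = Ctx.arity α
        · simp [R', c₁, Ctx.var, Ctx.arity]
        · by_cases c₂ : i = Ctx.arity α + 1
          · simp [R', c₂, Ctx.var, Ctx.arity]
          · have : i < Ctx.arity α := by omega
            simp only [R', c₁, c₂, if_false, Ctx.var, Ctx.arity]
            rw [g₅ _ (hR i this), hv i this])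
      have k₁ : Run (tape (Ctx.base a)) (T''.eval (cap a)) s σ σ₁ := k₁
      have hσ₁ := k₁.le_length g₂
      obtain ⟨σ₂, k₂, l₂, m₂⟩ := exists_run_copy (r := b + 3) (b := b) (c := b + 4) (by omega)
        (by omega) (by omega) hσ₁
      have kk := k₁.seq (k₂.seq ((Run.mv (b + 2) true).seq (Run.mv (b + 1) false)))
      have hi : σ (b + 2) + 1 ≤ n a := by omega
      have hi' := hi.trans (bn a ha)
      have v₁ : σ₂ (b + 1) = j + 1 := by rw [m₂ _ (by omega) (by omega), m₁ _ (by omega), g₁]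
      have v₂ : σ₂ (b + 2) = σ (b + 2) := by rw [m₂ _ (by omega) (by omega), m₁ _ (by omega)]
      have v₃ : σ₂ b = F (σ (b + 2) + 1) := by
        rw [l₂, l₁, min_eq_right (bh _ hok)]
        show h ((a, σ (b + 2)), σ b) = h ((a, σ (b + 2)), F (σ (b + 2)))
        rw [g₄]
      have v₄ : moved (tape (Ctx.base a)) (σ (b + 2)) true = σ (b + 2) + 1 := min_eq_right hi'
      refine ⟨_, kk, ?_, kk.le_length g₂, ?_, ?_, ?_⟩
      · rw [Function.update_self, Function.update_of_ne (by omega), v₁]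
        rfl
      · rw [Function.update_of_ne (by omega), Function.update_self, v₂, v₄]
        omega
      · rw [Function.update_of_ne (by omega), Function.update_of_ne (by omega),
          Function.update_of_ne (by omega), Function.update_self, v₂, v₄, v₃]
      · intro x hx
        rw [Function.update_of_ne (by omega), Function.update_of_ne (by omega),
          m₂ _ (by omega) (by omega), m₁ _ (by omega), g₅ x hx])
    (n a) ρ₃ ⟨by rw [f₃ _ (by omega), e₂], hρ₃, by rw [e₃, zero_add],
      by rw [e₃, f₃ _ (by omega), f₂ _ (by omega), e₁]; rfl,
      fun x hx => by rw [f₃ _ (by omega), f₂ _ (by omega), f₁ _ hx]⟩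
  refine ⟨ρ₄, (h₁.seq (h₂.seq (h₃.seq h₄))).mono ?_, ?_, e₄.2.2.2.2⟩
  · simp only [Polynomial.eval_add, Polynomial.eval_mul, Polynomial.eval_X, Polynomial.eval_one,
      Polynomial.eval_ofNat]
    exact le_rfl
  · rw [e₄.2.2.2.1, show ρ₄ (b + 2) = n a from e₄.2.2.1]
    exact (min_eq_right (hF _ le_rfl)).symm

end UnitGrid

namespace UnitGrid

/-! ### Arithmetic and bounded quantifiers -/

section Logic

variable {α : Type} [Ctx α] {f g : α → ℕ} {P Q : α → Prop}

theorem Bdd.weaken (hf : Bdd f) : Bdd fun a : α × ℕ => f a.1 :=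
  fun a ha => hf a.1 (ok_prod.mp ha).1

theorem bdd_snd : Bdd fun a : α × ℕ => a.2 := fun _ ha => (ok_prod.mp ha).2

theorem Bdd.of_le (hf : Bdd f) (h : ∀ a, Ok a → g a ≤ f a) : Bdd g :=
  fun a ha => (h a ha).trans (hf a ha)

theorem bdd_const {c : ℕ} (hc : c ≤ 9) : Bdd fun _ : α => c := fun a _ => hc.trans (cap_ge a)

theorem compPred_iff [DecidablePred P] : CompPred P ↔ Comp fun a => if P a then 1 else 0 :=
  ⟨fun h => Comp.congr h fun a _ => by by_cases h : P a <;> simp [h],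
    fun h => Comp.congr h fun a _ => by by_cases h : P a <;> simp [h]⟩

theorem Comp.ite [DecidablePred P] (hP : CompPred P) (hf : Comp f) (hg : Comp g) :
    Comp fun a => if P a then f a else g a := by
  refine (Comp.ite_test false Option.isSome (compPred_iff.mp hP) hf hg).congr fun a ha => if_congr ?_ rfl rfl
  have := cap_ge a
  rw [isSome_side_false (show min (UnitGrid.cap a) _ ≤ (tape (Ctx.base a)).length from min_le_left _ _),
    decide_eq_true_iff]
  split_ifs with h
  · simp only [h, iff_true]
    omega
  · simp [h]

theorem CompPred.not (hP : CompPred P) : CompPred fun a => ¬ P a := by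
  classical
  exact compPred_iff.mpr ((Comp.ite hP (.const 0) (.const 1)).congr fun a _ => by
    by_cases h : P a <;> simp [h])

theorem CompPred.and (hP : CompPred P) (hQ : CompPred Q) : CompPred fun a => P a ∧ Q a := by
  classical
  exact compPred_iff.mpr ((Comp.ite hP (compPred_iff.mp hQ) (.const 0)).congr fun a _ => by
    by_cases h : P a <;> simp [h])

theorem CompPred.or (hP : CompPred P) (hQ : CompPred Q) : CompPred fun a => P a ∨ Q a := by
  classical
  exact compPred_iff.mpr ((Comp.ite hP (.const 1) (compPred_iff.mp hQ)).congr fun a _ => by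
    by_cases h : P a <;> simp [h])

theorem CompPred.imp (hP : CompPred P) (hQ : CompPred Q) : CompPred fun a => P a → Q a := by
  classical
  exact compPred_iff.mpr ((Comp.ite hP (compPred_iff.mp hQ) (.const 1)).congr fun a _ => by
    by_cases h : P a <;> simp [h])

theorem CompPred.iff (hP : CompPred P) (hQ : CompPred Q) : CompPred fun a => P a ↔ Q a :=
  ((hP.imp hQ).and (hQ.imp hP)).congr fun _ _ => iff_iff_implies_and_implies.symm

theorem CompPred.pos (hf : Comp f) : CompPred fun a => 0 < f a := by
  refine compPred_iff.mpr ((Comp.ite_test false Option.isSome hf (.const 1) (.const 0)).congr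
    fun a ha => if_congr ?_ rfl rfl)
  have := cap_ge a
  rw [isSome_side_false (show min (UnitGrid.cap a) _ ≤ (tape (Ctx.base a)).length from min_le_left _ _),
    decide_eq_true_iff]
  omega

theorem Comp.add (hf : Comp f) (hg : Comp g) : Comp fun a => f a + g a := by
  refine (Comp.rec hf.trunc hg.trunc (Comp.snd (α := α × ℕ)).succ.trunc (bdd_trunc _) (bdd_trunc _)
    (bdd_trunc _)).congr' fun a _ => ?_
  have : ∀ n, Nat.rec (motive := fun _ => ℕ) (min (cap a) (f a))
      (fun _ v => min (cap a) (v + 1)) n = min (cap a) (f a + n) := by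
    intro n
    induction n with
    | zero => rfl
    | succ n ih =>
      show min (cap a) (Nat.rec (motive := fun _ => ℕ) (min (cap a) (f a))
        (fun _ v => min (cap a) (v + 1)) n + 1) = _
      rw [ih]
      omega
  refine (congrArg (min (cap a)) (this _)).trans ?_
  omega

theorem Comp.mul (hf : Comp f) (hg : Comp g) : Comp fun a => f a * g a := by
  refine (Comp.rec (.const 0) hg.trunc ((Comp.snd (α := α × ℕ)).add hf.weaken.weaken).trunc
    (bdd_const (by norm_num)) (bdd_trunc _) (bdd_trunc _)).congr' fun a _ => ?_
  have : ∀ n, Nat.rec (motive := fun _ => ℕ) 0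
      (fun _ v => min (cap a) (v + f a)) n = min (cap a) (f a * n) := by
    intro n
    induction n with
    | zero => simp
    | succ n ih =>
      show min (cap a) (Nat.rec (motive := fun _ => ℕ) 0
        (fun _ v => min (cap a) (v + f a)) n + f a) = _
      rw [ih, mul_add_one]
      omega
  refine (congrArg (min (cap a)) (this _)).trans ?_
  rw [← min_assoc, min_self]
  rcases le_total (g a) (cap a) with h | h
  · rw [min_eq_right h]
  · rw [min_eq_left h]
    rcases Nat.eq_zero_or_pos (f a) with h' | h'
    · simp [h']
    · rw [min_eq_left (Nat.le_mul_of_pos_left _ h'),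
        min_eq_left (h.trans (Nat.le_mul_of_pos_left _ h'))]

theorem Comp.sub (hf : Comp f) (hg : Comp g) (bf : Bdd f) (bg : Bdd g) :
    Comp fun a => f a - g a := by
  refine (Comp.rec hf hg ((Comp.snd (α := α × ℕ)).pred bdd_snd) bf bg
    (bdd_snd.of_le fun _ _ => Nat.sub_le _ _)).congr fun a _ => ?_
  generalize g a = n
  induction n with
  | zero => rfl
  | succ n ih =>
    show Nat.rec (motive := fun _ => ℕ) (f a) (fun _ v => v - 1) n - 1 = _
    rw [ih]
    rfl

theorem CompPred.lt (hf : Comp f) (hg : Comp g) (bf : Bdd f) (bg : Bdd g) :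
    CompPred fun a => f a < g a :=
  (CompPred.pos (hg.sub hf bg bf)).congr fun _ _ => Nat.sub_pos_iff_lt

theorem CompPred.eq (hf : Comp f) (hg : Comp g) (bf : Bdd f) (bg : Bdd g) :
    CompPred fun a => f a = g a :=
  ((CompPred.lt hf hg bf bg).not.and (CompPred.lt hg hf bg bf).not).congr fun a _ => by omega

theorem CompPred.exists_lt {P : α → ℕ → Prop} (hg : Comp g) (bg : Bdd g)
    (hP : CompPred fun a : α × ℕ => P a.1 a.2) : CompPred fun a => ∃ i < g a, P a i := by
  classical
  refine compPred_iff.mpr ((Comp.rec (h := fun a : (α × ℕ) × ℕ => if P a.1.1 a.1.2 then 1 else a.2)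
    (.const 0) hg (.ite (CompPred.weaken hP) (.const 1) .snd) (bdd_const (by norm_num)) bg
    fun a ha => ?_).congr fun a _ => ?_)
  · have h₁ := cap_ge a
    have h₂ := (ok_prod.mp ha).2
    dsimp only
    split_ifs
    · omega
    · exact h₂
  · show Nat.rec (motive := fun _ => ℕ) 0 (fun i v => if P a i then 1 else v) (g a) =
      if ∃ i < g a, P a i then 1 else 0
    generalize g a = n
    induction n with
    | zero => exact (if_neg (by simp)).symm
    | succ n ih =>
      show (if P a n then 1 else Nat.rec (motive := fun _ => ℕ) 0
        (fun i v => if P a i then 1 else v) n) = _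
      refine (congrArg (fun v => if P a n then 1 else v) ih).trans ?_
      by_cases h : P a n
      · rw [if_pos h, if_pos ⟨n, Nat.lt_succ_self n, h⟩]
      · rw [if_neg h]
        refine if_congr ⟨fun ⟨i, hi, h'⟩ => ⟨i, by omega, h'⟩, fun ⟨i, hi, h'⟩ => ⟨i, ?_, h'⟩⟩ rfl rfl
        rcases Nat.lt_succ_iff_lt_or_eq.mp hi with hi | rfl
        · exact hi
        · exact absurd h' h

theorem CompPred.forall_lt {P : α → ℕ → Prop} (hg : Comp g) (bg : Bdd g)
    (hP : CompPred fun a : α × ℕ => P a.1 a.2) : CompPred fun a => ∀ i < g a, P a i :=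
  (CompPred.exists_lt (P := fun a i => ¬ P a i) hg bg hP.not).not.congr fun a _ => by simp

/-- The length of the tape is found by moving to its end. -/
theorem Comp.cap : Comp fun a : α => cap a := by
  intro R b hR
  obtain ⟨p, T, hp⟩ := (Comp.const (α := α) 0) R b hR
  refine ⟨.seq p (.loop b true Option.isSome (.mv b true)), T + (2 * Polynomial.X + 1),
    fun a ρ ha hρ hv => ?_⟩
  obtain ⟨ρ', h₁, h₂, h₃⟩ := hp a ρ ha hρ hv
  have main : ∀ n (ρ' : ℕ → ℕ), ρ' b + n = UnitGrid.cap a → ∃ ρ'', Run (tape (Ctx.base a)) (2 * n + 1)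
      (.loop b true Option.isSome (.mv b true)) ρ' ρ'' ∧ ρ'' b = UnitGrid.cap a ∧
        ∀ r < b, ρ'' r = ρ' r := by
    intro n
    induction n with
    | zero =>
      intro ρ' h
      refine ⟨ρ', ⟨1, le_rfl, .loop_false ?_⟩, h, fun _ _ => rfl⟩
      simp only [side, add_zero] at h ⊢
      rw [h, show UnitGrid.cap a = (tape (Ctx.base a)).length from rfl, List.drop_length]
      rfl
    | succ n ih =>
      intro ρ' h
      have hb : ρ' b < (tape (Ctx.base a)).length := show _ < UnitGrid.cap a by omega
      obtain ⟨ρ'', ⟨t, ht, e⟩, h₂, h₃⟩ := ih (Function.update ρ' b (moved (tape (Ctx.base a)) (ρ' b) true)) (by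
        rw [Function.update_self]
        show min (UnitGrid.cap a) (ρ' b + 1) + n = _
        omega)
      refine ⟨ρ'', ⟨1 + 1 + t, by omega, .loop_true ?_ (.mv b true ρ') e⟩, h₂, fun r hr => ?_⟩
      · simp only [side]
        rw [List.drop_eq_getElem_cons hb]
        rfl
      · rw [h₃ r hr, Function.update_of_ne (Nat.ne_of_lt hr)]
  obtain ⟨ρ'', h₄, h₅, h₆⟩ := main (UnitGrid.cap a) ρ' (by rw [h₂]; simp)
  exact ⟨ρ'', (h₁.seq h₄).mono (by simp), by simp [h₅], fun r hr => (h₆ r hr).trans (h₃ r hr)⟩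

theorem bdd_cap : Bdd fun a : α => cap a := fun _ _ => le_rfl

/-- A function is computed by searching for its value. -/
theorem Comp.of_graph (bf : Bdd f)
    (hf : CompPred fun a : α × ℕ => a.2 = f a.1) : Comp f := by
  refine (Comp.rec (h := fun a : (α × ℕ) × ℕ => if a.1.2 = f a.1.1 then a.1.2 else a.2) Comp.cap Comp.cap
    (.ite (CompPred.weaken hf) Comp.snd.weaken .snd) bdd_cap bdd_cap
    fun a ha => ?_).congr fun a ha => ?_
  · dsimp only
    split_ifs
    · exact (ok_prod.mp (ok_prod.mp ha).1).2
    · exact (ok_prod.mp ha).2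
  · have : ∀ n, Nat.rec (motive := fun _ => ℕ) (UnitGrid.cap a)
        (fun i v => if i = f a then i else v) n = if f a < n then f a else UnitGrid.cap a := by
      intro n
      induction n with
      | zero => rfl
      | succ n ih =>
        refine (congrArg (fun v => if n = f a then n else v) ih).trans ?_
        split_ifs <;> omega
    refine (this _).trans ?_
    have := bf a ha
    split_ifs <;> omega

/-! ### Reading the two strings -/

theorem CompPred.tape_eq (hf : Comp f) (s : Option Bool) :
    CompPred fun a => (tape (Ctx.base a))[f a]? = some s := by
  refine compPred_iff.mpr ((Comp.ite_test true (fun o => decide (o = some s)) hf (.const 1)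
    (.const 0)).congr fun a ha => if_congr ?_ rfl rfl)
  simp only [side, List.head?_drop, decide_eq_true_iff]
  rcases le_total (f a) (UnitGrid.cap a) with h | h
  · rw [min_eq_right h]
  · rw [min_eq_left h, List.getElem?_eq_none (show (tape (Ctx.base a)).length ≤ f a from h),
      List.getElem?_eq_none (show (tape (Ctx.base a)).length ≤ UnitGrid.cap a from le_rfl)]

theorem cap_eq (a : α) :
    cap a = (Ctx.base a).1.length + 1 + (Ctx.base a).2.length + 8 := by
  simp [cap, tape, pad, encodePair]
  omega

theorem tape_getElem? (x : List Bool × List Bool) (i : ℕ) :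
    (tape x)[i]? = if i < x.1.length then x.1[i]?.map some else if i = x.1.length then some none
      else if i < x.1.length + 1 + x.2.length then x.2[i - (x.1.length + 1)]?.map some
      else if i < x.1.length + 1 + x.2.length + 8 then some none else none := by
  simp only [tape, pad, encodePair, List.append_assoc, List.cons_append]
  split_ifs with h₁ h₂ h₃ h₄
  · rw [List.getElem?_append_left (by simpa using h₁), List.getElem?_map]
  · rw [List.getElem?_append_right (by simp [h₂])]
    simp [h₂]
  · rw [List.getElem?_append_right (by simp; omega)]
    obtain ⟨j, rfl⟩ : ∃ j, i = x.1.length + 1 + j := ⟨i - (x.1.length + 1), by omega⟩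
    rw [show x.1.length + 1 + j - (x.1.map some).length = j + 1 by simp; omega,
      List.getElem?_cons_succ, List.getElem?_append_left (by simp; omega), List.getElem?_map]
    simp
  · rw [List.getElem?_append_right (by simp; omega)]
    obtain ⟨j, rfl⟩ : ∃ j, i = x.1.length + 1 + x.2.length + j :=
      ⟨i - (x.1.length + 1 + x.2.length), by omega⟩
    rw [show x.1.length + 1 + x.2.length + j - (x.1.map some).length = x.2.length + j + 1 by simp; omega,
      List.getElem?_cons_succ, List.getElem?_append_right (by simp)]
    simp only [List.length_map, Nat.add_sub_cancel_left, List.getElem?_replicate]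
    rw [if_pos (by omega)]
  · rw [List.getElem?_eq_none]
    simp
    omega

theorem Comp.length_fst : Comp fun a : α => (Ctx.base a).1.length := by
  refine .of_graph (fun a _ => by
    have := cap_eq a
    omega) ?_
  refine ((CompPred.tape_eq (Comp.snd (α := α)) none).and (CompPred.forall_lt .snd bdd_snd
    (P := fun a i => ¬ (tape (Ctx.base a))[i]? = some none)
    (CompPred.tape_eq .snd none).not)).congr fun a _ => ?_
  obtain ⟨a, i⟩ := a
  show ((tape (Ctx.base a))[i]? = _ ∧ ∀ j < i, ¬ (tape (Ctx.base a))[j]? = _) ↔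
    i = (Ctx.base a).1.length
  constructor
  · rintro ⟨h₁, h₂⟩
    rcases lt_trichotomy i (Ctx.base a).1.length with h | h | h
    · rw [tape_getElem?, if_pos h] at h₁
      simp at h₁
    · exact h
    · exact absurd (by rw [tape_getElem?]; simp) (h₂ _ h)
  · rintro rfl
    refine ⟨by rw [tape_getElem?]; simp, fun j hj => ?_⟩
    rw [tape_getElem?, if_pos hj]
    simp

theorem bdd_length_fst : Bdd fun a : α => (Ctx.base a).1.length := fun a _ => by
  have := cap_eq a
  show (Ctx.base a).1.length ≤ UnitGrid.cap a
  omega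

theorem Comp.length_snd : Comp fun a : α => (Ctx.base a).2.length := by
  refine (Comp.sub (Comp.cap (α := α)) (Comp.length_fst.add (.const 9)) bdd_cap
    (fun a _ => by
    have := cap_eq a
    omega)).congr fun a _ => ?_
  rw [cap_eq]
  omega

theorem bdd_length_snd : Bdd fun a : α => (Ctx.base a).2.length := fun a _ => by
  have := cap_eq a
  show (Ctx.base a).2.length ≤ UnitGrid.cap a
  omega

theorem CompPred.fst_eq (hf : Comp f) (b : Bool) :
    CompPred fun a => (Ctx.base a).1[f a]? = some b := by
  refine ((CompPred.lt hf.trunc Comp.length_fst (bdd_trunc _) bdd_length_fst).and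
    (CompPred.tape_eq hf (some b))).congr fun a _ => ?_
  have := cap_eq a
  rw [tape_getElem?]
  by_cases h : f a < (Ctx.base a).1.length
  · have : min (UnitGrid.cap a) (f a) < (Ctx.base a).1.length := by omega
    rw [if_pos h]
    simp [this]
  · have : ¬ min (UnitGrid.cap a) (f a) < (Ctx.base a).1.length := by omega
    simp only [this, false_and, false_iff]
    rw [List.getElem?_eq_none (not_lt.mp h)]
    simp

theorem CompPred.snd_eq (hf : Comp f) (b : Bool) :
    CompPred fun a => (Ctx.base a).2[f a]? = some b := by
  refine (CompPred.tape_eq ((Comp.length_fst.add (.const 1)).add hf) (some b)).congr fun a _ => ?_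
  rw [tape_getElem?, if_neg (by omega), if_neg (by omega)]
  by_cases h : f a < (Ctx.base a).2.length
  · rw [if_pos (by omega), Nat.add_sub_cancel_left]
    simp
  · rw [if_neg (by omega), List.getElem?_eq_none (not_lt.mp h)]
    split_ifs <;> simp

end Logic

/-- A relation that is decided by a program in the sense of `CompPred` is decided by a Turing machine
in polynomial time. -/
theorem CompPred.polyTimeDecidable {r : List Bool → List Bool → Prop}
    (h : CompPred fun x : List Bool × List Bool => r x.1 x.2) : PolyTimeDecidable r := by
  obtain ⟨p, T, hp⟩ := h (fun _ => 0) 0 (fun i hi => absurd hi (Nat.not_lt_zero i))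
  refine polyTimeDecidable_of_prog p T fun x => ?_
  obtain ⟨ρ', ⟨t, ht, e⟩, h₂, _⟩ := hp x (fun _ => (pad (encodePair x)).length) (ok_base x)
    (fun _ => le_rfl) (fun i hi => absurd hi (Nat.not_lt_zero i))
  refine ⟨ρ', t, e, ht, ?_⟩
  have := cap_ge x
  rw [h₂]
  beta_reduce
  split_ifs with h
  · simp only [h, iff_true]
    omega
  · simp [h]

end UnitGrid

namespace UnitGrid

/-! ### The order of a list -/

section Before

variable {ι : Type*} {l : List ι} {a b e : ι}

theorem before_cons : Before (e :: l) a b ↔ Before l a b ∨ (e = a ∧ b ∈ l) := by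
  constructor
  · intro h
    rcases List.sublist_cons_iff.mp h with h | ⟨r, hr, h⟩
    · exact .inl h
    · obtain ⟨rfl, rfl⟩ := List.cons.inj hr
      exact .inr ⟨rfl, List.singleton_sublist.mp h⟩
  · rintro (h | ⟨rfl, h⟩)
    · exact h.cons e
    · exact (List.singleton_sublist.mpr h).cons_cons e

theorem Before.left_mem (h : Before l a b) : a ∈ l := h.subset (by simp)

theorem Before.right_mem (h : Before l a b) : b ∈ l := h.subset (by simp)

theorem before_concat : Before (l ++ [e]) a b ↔ Before l a b ∨ (a ∈ l ∧ b = e) := by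
  induction l with
  | nil => simp [Before]
  | cons x l ih =>
    rw [List.cons_append, before_cons, before_cons, ih]
    simp only [List.mem_append, List.mem_cons, List.not_mem_nil, or_false]
    constructor
    · rintro ((h | h) | ⟨rfl, h | h⟩)
      · exact .inl (.inl h)
      · exact .inr ⟨.inr h.1, h.2⟩
      · exact .inl (.inr ⟨rfl, h⟩)
      · exact .inr ⟨.inl rfl, h⟩
    · rintro ((h | h) | ⟨rfl | h, h'⟩)
      · exact .inl (.inl h)
      · exact .inr ⟨h.1, .inl h.2⟩
      · exact .inr ⟨rfl, .inr h'⟩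
      · exact .inl (.inr ⟨h, h'⟩)

theorem before_iff_getElem? :
    Before l a b ↔ ∃ i j : ℕ, i < j ∧ l[i]? = some a ∧ l[j]? = some b := by
  induction l with
  | nil => simp [Before]
  | cons x l ih =>
    rw [before_cons, ih]
    constructor
    · rintro (⟨i, j, hij, hi, hj⟩ | ⟨rfl, h⟩)
      · exact ⟨i + 1, j + 1, by omega, by simpa using hi, by simpa using hj⟩
      · obtain ⟨j, hj⟩ := List.mem_iff_getElem?.mp h
        exact ⟨0, j + 1, by omega, by simp, by simpa using hj⟩
    · rintro ⟨i, j, hij, hi, hj⟩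
      obtain ⟨j, rfl⟩ : ∃ j', j = j' + 1 := ⟨j - 1, by omega⟩
      rw [List.getElem?_cons_succ] at hj
      rcases i with _ | i
      · exact .inr ⟨by simpa using hi, List.mem_of_getElem? hj⟩
      · exact .inl ⟨i, j, by omega, by simpa using hi, hj⟩

theorem before_iff_of_pairwise {β : Type*} [Preorder β] {c : ι → β}
    (h : l.Pairwise fun a b => c a < c b) : Before l a b ↔ a ∈ l ∧ b ∈ l ∧ c a < c b := by
  constructor
  · intro h'
    have := h.sublist h'
    exact ⟨h'.left_mem, h'.right_mem, by simpa using this⟩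
  · induction l with
    | nil => simp
    | cons x l ih =>
      rw [List.pairwise_cons] at h
      rw [before_cons]
      rintro ⟨ha, hb, hab⟩
      rcases List.mem_cons.mp ha with rfl | ha'
      · rcases List.mem_cons.mp hb with rfl | hb
        · exact absurd hab (lt_irrefl _)
        · exact .inr ⟨rfl, hb⟩
      · rcases List.mem_cons.mp hb with rfl | hb
        · exact absurd hab (h.1 a ha').not_gt
        · exact .inl (ih h.2 ⟨ha', hb, hab⟩)

theorem nodup_of_pairwise_lt {β : Type*} [Preorder β] {c : ι → β}
    (h : l.Pairwise fun a b => c a < c b) : l.Nodup :=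
  h.imp fun {a b} hab (e : a = b) => lt_irrefl (c b) (e ▸ hab)

theorem exists_pairwise_lt (h : l.Nodup) : ∃ c : ι → ℝ, l.Pairwise fun a b => c a < c b := by
  classical
  refine ⟨fun e => l.idxOf e, List.pairwise_iff_getElem.mpr fun i j hi hj hij => ?_⟩
  beta_reduce
  rw [h.idxOf_getElem, h.idxOf_getElem]
  exact_mod_cast hij

theorem before_trichotomy (ha : a ∈ l) (hb : b ∈ l) :
    Before l a b ∨ a = b ∨ Before l b a := by
  obtain ⟨i, hi⟩ := List.mem_iff_getElem?.mp ha
  obtain ⟨j, hj⟩ := List.mem_iff_getElem?.mp hb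
  rcases lt_trichotomy i j with hij | rfl | hij
  · exact .inl (before_iff_getElem?.mpr ⟨i, j, hij, hi, hj⟩)
  · exact .inr (.inl (Option.some.inj (hi.symm.trans hj)))
  · exact .inr (.inr (before_iff_getElem?.mpr ⟨j, i, hij, hj, hi⟩))

theorem Before.ne (h : l.Nodup) (hab : Before l a b) : a ≠ b := by
  rintro rfl
  have := h.sublist hab
  simp at this

/-- A finite set can be listed in the order of an injective function. -/
theorem exists_sorted_list [Fintype ι] {β : Type*} [LinearOrder β] {c : ι → β}
    (hc : Function.Injective c) (P : ι → Prop) :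
    ∃ l : List ι, (∀ e, e ∈ l ↔ P e) ∧ l.Pairwise fun a b => c a < c b := by
  classical
  let _ := LinearOrder.lift' c hc
  refine ⟨(Finset.univ.filter P).sort (· ≤ ·), fun e => by simp, ?_⟩
  have := (Finset.sortedLT_sort (Finset.univ.filter P)).pairwise
  exact this

end Before

/-! ### Unit lengths from proper orderings -/

/-- The events can be placed from left to right: an upper endpoint goes at distance one from its
lower endpoint, and any other event goes below the upper endpoints that are still due. If the
endpoints of unclosed segments are to come in the order in which the segments were opened, then each
of them lies above all events placed before. -/
theorem exists_unit_coord {n : ℕ} (l : List (Event n)) (hl : l.Nodup)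
    (hlo : ∀ v, (v, Mark.hi) ∈ l → Before l (v, Mark.lo) (v, Mark.hi))
    (hord : ∀ u v, Before l (u, Mark.lo) (v, Mark.lo) → (v, Mark.hi) ∈ l →
      Before l (u, Mark.hi) (v, Mark.hi)) :
    ∃ c : Event n → ℝ, l.Pairwise (fun a b => c a < c b) ∧
      (∀ v, (v, Mark.hi) ∈ l → c (v, Mark.hi) = c (v, Mark.lo) + 1) ∧
      ∀ v, (v, Mark.lo) ∈ l → (v, Mark.hi) ∉ l → ∀ e ∈ l, c e < c (v, Mark.lo) + 1 := by
  classical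
  induction l using List.reverseRecOn with
  | nil => exact ⟨fun _ => 0, by simp⟩
  | append_singleton l e ih =>
    rw [List.nodup_append] at hl
    obtain ⟨hl, -, hle⟩ := hl
    have he : e ∉ l := fun h => hle e h e (by simp) rfl
    have hlo' : ∀ v, (v, Mark.hi) ∈ l → Before l (v, Mark.lo) (v, Mark.hi) := by
      intro v hv
      rcases before_concat.mp (hlo v (by simp [hv])) with h | ⟨_, h⟩
      · exact h
      · exact absurd (h ▸ hv) he
    obtain ⟨c, h₁, h₂, h₃⟩ := ih hl hlo' (fun u v h hv => by
      rcases before_concat.mp (hord u v (before_concat.mpr (.inl h)) (by simp [hv])) with h | ⟨_, h⟩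
      · exact h
      · exact absurd (h ▸ hv) he)
    -- it suffices to find a suitable place for the last event
    suffices ∃ x : ℝ, (∀ a ∈ l, c a < x) ∧ (∀ v, (v, Mark.hi) = e → x = c (v, Mark.lo) + 1) ∧
        ∀ v, (v, Mark.lo) ∈ l → (v, Mark.hi) ∉ l → (v, Mark.hi) ≠ e → x < c (v, Mark.lo) + 1 by
      obtain ⟨x, hx₁, hx₂, hx₃⟩ := this
      have upd : ∀ a ∈ l, Function.update c e x a = c a := fun a ha =>
        Function.update_of_ne (fun h : a = e => he (h ▸ ha)) _ _
      refine ⟨Function.update c e x, ?_, ?_, ?_⟩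
      · rw [List.pairwise_append]
        refine ⟨?_, by simp, fun a ha b hb => ?_⟩
        · refine h₁.imp_of_mem fun ha hb hab => ?_
          rwa [upd _ ha, upd _ hb]
        · rw [List.mem_singleton.mp hb, upd a ha, Function.update_self]
          exact hx₁ a ha
      · intro v hv
        rcases List.mem_append.mp hv with hv | hv
        · rw [upd _ hv, upd _ (hlo' v hv).left_mem]
          exact h₂ v hv
        · have hv := List.mem_singleton.mp hv
          have hmem : (v, Mark.lo) ∈ l := by
            rcases before_concat.mp (hlo v (by simp [hv])) with h | ⟨h, _⟩
            · exact h.left_mem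
            · exact h
          rw [upd _ hmem, hv, Function.update_self]
          exact hx₂ v hv
      · intro v hv hv' a ha
        simp only [List.mem_append, List.mem_singleton, not_or] at hv hv' ha
        rcases hv with hv | hv
        · rw [upd _ hv]
          rcases ha with ha | ha
          · rw [upd _ ha]
            exact h₃ v hv hv'.1 a ha
          · rw [ha, Function.update_self]
            exact hx₃ v hv hv'.1 hv'.2
        · rw [hv, Function.update_self]
          rcases ha with ha | ha
          · rw [upd _ ha]
            linarith [hx₁ a ha]
          · rw [ha, Function.update_self]
            linarith
    by_cases hhi : ∃ v, (v, Mark.hi) = e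
    · obtain ⟨v, rfl⟩ := hhi
      have hmem : (v, Mark.lo) ∈ l := by
        rcases before_concat.mp (hlo v (by simp)) with h | ⟨h, _⟩
        · exact absurd h.right_mem he
        · exact h
      refine ⟨c (v, Mark.lo) + 1, h₃ v hmem he, ?_, ?_⟩
      · rintro u hu
        rw [(Prod.mk.inj hu).1]
      · intro u hu hu' hne
        have hlt : c (v, Mark.lo) < c (u, Mark.lo) := by
          rcases before_trichotomy hmem hu with h | h | h
          · exact ((before_iff_of_pairwise h₁).mp h).2.2
          · exact absurd (by rw [(Prod.mk.inj h).1]) hne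
          · rcases before_concat.mp (hord u v (before_concat.mpr (.inl h)) (by simp)) with h | ⟨h, _⟩
            · exact absurd h.left_mem hu'
            · exact absurd h hu'
        linarith
    · obtain ⟨x, hx₁, hx₂⟩ := Order.exists_between_finsets (l.toFinset.image c)
        ((Finset.univ.filter fun v : Fin n => (v, Mark.lo) ∈ l ∧ (v, Mark.hi) ∉ l).image
          fun v => c (v, Mark.lo) + 1) (by
          intro x hx y hy
          simp only [Finset.mem_image, List.mem_toFinset, Finset.mem_filter, Finset.mem_univ,
            true_and] at hx hy
          obtain ⟨a, ha, rfl⟩ := hx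
          obtain ⟨v, hv, rfl⟩ := hy
          exact h₃ v hv.1 hv.2 a ha)
      refine ⟨x, fun a ha => hx₁ _ (Finset.mem_image_of_mem c (List.mem_toFinset.mpr ha)),
        fun v hv => absurd ⟨v, hv⟩ hhi, fun v hv hv' _ => hx₂ _ (Finset.mem_image.mpr ⟨v, ?_, rfl⟩)⟩
      simp [hv, hv']

theorem exists_unit_coord_of_proper {n : ℕ} {l : List (Event n)} {A : Set (Fin n)} (hl : l.Nodup)
    (hA : ∀ e, e ∈ l ↔ IsEventOf A e) (hlo : ∀ v ∈ A, Before l (v, Mark.lo) (v, Mark.hi))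
    (hp : Proper l) :
    ∃ c : Event n → ℝ, l.Pairwise (fun a b => c a < c b) ∧
      ∀ v ∈ A, c (v, Mark.hi) = c (v, Mark.lo) + 1 := by
  have mem_lo : ∀ v, (v, Mark.lo) ∈ l → v ∈ A := fun v hv => by
    simpa [IsEventOf] using (hA _).mp hv
  have mem_hi : ∀ v, (v, Mark.hi) ∈ l ↔ v ∈ A := fun v => by
    rw [hA]
    simp [IsEventOf]
  obtain ⟨c, h₁, h₂, -⟩ := exists_unit_coord l hl (fun v hv => hlo v ((mem_hi v).mp hv)) (by
    intro u v h hv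
    rcases before_trichotomy ((mem_hi u).mpr (mem_lo u h.left_mem)) hv with h' | h' | h'
    · exact h'
    · exact absurd (by rw [(Prod.mk.inj h').1]) (h.ne hl)
    · exact absurd ⟨u, v, h, h'⟩ hp)
  exact ⟨c, h₁, fun v hv => h₂ v ((mem_hi v).mpr hv)⟩

/-! ### Representations and orderings -/

theorem axisSegment_inter_nonempty_of_not_iff {h h' : Prop} (H : h) (H' : ¬ h')
    {lo hi pos lo' hi' pos' : ℝ} :
    (axisSegment h lo hi pos ∩ axisSegment h' lo' hi' pos').Nonempty ↔
      pos' ∈ Set.Icc lo hi ∧ pos ∈ Set.Icc lo' hi' := by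
  constructor
  · rintro ⟨p, hp, hp'⟩
    simp only [axisSegment, Set.mem_ofPred_eq, H, H', true_and, not_true_eq_false, false_and,
      or_false, not_false_eq_true, false_or] at hp hp'
    rw [← hp'.2, ← hp.2]
    exact ⟨hp.1, hp'.1⟩
  · rintro ⟨h₁, h₂⟩
    exact ⟨(pos', pos), .inl ⟨H, h₁, rfl⟩, .inr ⟨H', h₂, rfl⟩⟩

/-- Two segments meet exactly if one of them is horizontal, the other one is vertical and each of
them has its position in the span of the other. -/
theorem GridRep.adj_iff_pos_mem {V : Type*} {G : SimpleGraph V} (R : GridRep G) (u v : V) :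
    G.Adj u v ↔
      (u ∈ R.H ∧ v ∉ R.H ∧ R.pos v ∈ Set.Icc (R.lo u) (R.hi u) ∧ R.pos u ∈ Set.Icc (R.lo v) (R.hi v)) ∨
      (v ∈ R.H ∧ u ∉ R.H ∧ R.pos u ∈ Set.Icc (R.lo v) (R.hi v) ∧ R.pos v ∈ Set.Icc (R.lo u) (R.hi u)) := by
  rw [R.adj_iff]
  by_cases hu : u ∈ R.H <;> by_cases hv : v ∈ R.H
  · simp only [hu, hv, not_true_eq_false, false_and, and_false, or_false, iff_false, not_and]
    intro hne
    rw [Set.not_nonempty_iff_eq_empty, ← Set.disjoint_iff_inter_eq_empty]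
    have := R.disjoint_of_parallel u v hne (by simp [hu, hv])
    simpa only [hu, hv] using this
  · rw [axisSegment_inter_nonempty_of_not_iff hu hv]
    have : u ≠ v := fun h => hv (h ▸ hu)
    simp [hu, hv, this]
  · rw [Set.inter_comm, axisSegment_inter_nonempty_of_not_iff hv hu]
    have : u ≠ v := fun h => hu (h ▸ hv)
    simp [hu, hv, this]
  · simp only [hu, hv, false_and, or_false, iff_false, not_and]
    intro hne
    rw [Set.not_nonempty_iff_eq_empty, ← Set.disjoint_iff_inter_eq_empty]
    have := R.disjoint_of_parallel u v hne (by simp [hu, hv])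
    simpa only [hu, hv] using this

variable {n : ℕ} {G : SimpleGraph (Fin n)} {D : Orders n}

theorem GridRep.Induces.describes {R : GridRep G} (h : R.Induces D) : D.Describes G := by
  obtain ⟨⟨hx, px⟩, hy, py⟩ := h
  refine ⟨R.H, ⟨nodup_of_pairwise_lt px, hx⟩, ⟨nodup_of_pairwise_lt py, hy⟩, fun v hv => ?_,
    fun v hv => ?_, fun u v => ?_⟩
  · rw [before_iff_of_pairwise px, hx, hx]
    exact ⟨.inl ⟨hv, .inl rfl⟩, .inl ⟨hv, .inr rfl⟩, R.lo_lt_hi v⟩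
  · rw [before_iff_of_pairwise py, hy, hy]
    exact ⟨.inl ⟨hv, .inl rfl⟩, .inl ⟨hv, .inr rfl⟩, R.lo_lt_hi v⟩
  · -- distinct events have distinct coordinates, so the inequalities are strict
    have ne_x : ∀ a b : Event n, a ∈ D.xs → b ∈ D.xs → a ≠ b → R.coord a ≠ R.coord b := by
      intro a b ha hb hab
      rcases before_trichotomy ha hb with h | h | h
      · exact ((before_iff_of_pairwise px).mp h).2.2.ne
      · exact absurd h hab
      · exact ((before_iff_of_pairwise px).mp h).2.2.ne'
    have ne_y : ∀ a b : Event n, a ∈ D.ys → b ∈ D.ys → a ≠ b → R.coord a ≠ R.coord b := by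
      intro a b ha hb hab
      rcases before_trichotomy ha hb with h | h | h
      · exact ((before_iff_of_pairwise py).mp h).2.2.ne
      · exact absurd h hab
      · exact ((before_iff_of_pairwise py).mp h).2.2.ne'
    have cross : ∀ u v, u ∈ R.H → v ∉ R.H → (D.Cross u v ↔
        R.pos v ∈ Set.Icc (R.lo u) (R.hi u) ∧ R.pos u ∈ Set.Icc (R.lo v) (R.hi v)) := by
      intro u v hu hv
      have xl : (u, Mark.lo) ∈ D.xs := (hx _).mpr (.inl ⟨hu, .inl rfl⟩)
      have xh : (u, Mark.hi) ∈ D.xs := (hx _).mpr (.inl ⟨hu, .inr rfl⟩)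
      have xp : (v, Mark.pt) ∈ D.xs := (hx _).mpr (.inr ⟨hv, rfl⟩)
      have yl : (v, Mark.lo) ∈ D.ys := (hy _).mpr (.inl ⟨hv, .inl rfl⟩)
      have yh : (v, Mark.hi) ∈ D.ys := (hy _).mpr (.inl ⟨hv, .inr rfl⟩)
      have yp : (u, Mark.pt) ∈ D.ys := (hy _).mpr (.inr ⟨not_not_intro hu, rfl⟩)
      unfold Orders.Cross
      rw [before_iff_of_pairwise px, before_iff_of_pairwise px, before_iff_of_pairwise py,
        before_iff_of_pairwise py]
      simp only [xl, xh, xp, yl, yh, yp, true_and, Set.mem_Icc]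
      have n₁ : R.lo u ≠ R.pos v := ne_x _ _ xl xp (by simp)
      have n₂ : R.pos v ≠ R.hi u := ne_x _ _ xp xh (by simp)
      have n₃ : R.lo v ≠ R.pos u := ne_y _ _ yl yp (by simp)
      have n₄ : R.pos u ≠ R.hi v := ne_y _ _ yp yh (by simp)
      show (R.lo u < R.pos v ∧ R.pos v < R.hi u) ∧ (R.lo v < R.pos u ∧ R.pos u < R.hi v) ↔ _
      rw [n₁.le_iff_lt, n₂.le_iff_lt, n₃.le_iff_lt, n₄.le_iff_lt]
    rw [R.adj_iff_pos_mem]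
    refine or_congr (and_congr_right fun hu => and_congr_right fun hv => (cross u v hu hv).symm)
      (and_congr_right fun hv => and_congr_right fun hu => (cross v u hv hu).symm)

theorem proper_of_pairwise {R : GridRep G} {A : Set (Fin n)} {l : List (Event n)}
    (hA : ∀ e, e ∈ l ↔ IsEventOf A e) (hl : l.Pairwise fun a b => R.coord a < R.coord b)
    (hu : ∀ v ∈ A, R.hi v = R.lo v + 1) : Proper l := by
  rintro ⟨u, v, h₁, h₂⟩
  have mem_lo : ∀ v, (v, Mark.lo) ∈ l → v ∈ A := fun v hv => by
    simpa [IsEventOf] using (hA _).mp hv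
  have e₁ : R.lo u < R.lo v := ((before_iff_of_pairwise hl).mp h₁).2.2
  have e₂ : R.hi v < R.hi u := ((before_iff_of_pairwise hl).mp h₂).2.2
  rw [hu _ (mem_lo _ h₁.left_mem), hu _ (mem_lo _ h₁.right_mem)] at e₂
  linarith

/-- Orderings that describe a graph are realized by any strictly increasing assignments of
coordinates. -/
theorem exists_gridRep {H : Set (Fin n)} (hx : ∀ e, e ∈ D.xs ↔ IsEventOf H e)
    (hy : ∀ e, e ∈ D.ys ↔ IsEventOf Hᶜ e)
    (hlx : ∀ v ∈ H, Before D.xs (v, Mark.lo) (v, Mark.hi))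
    (hly : ∀ v ∉ H, Before D.ys (v, Mark.lo) (v, Mark.hi))
    (hG : ∀ u v, G.Adj u v ↔ (u ∈ H ∧ v ∉ H ∧ D.Cross u v) ∨ (v ∈ H ∧ u ∉ H ∧ D.Cross v u))
    {cx cy : Event n → ℝ} (px : D.xs.Pairwise fun a b => cx a < cx b)
    (py : D.ys.Pairwise fun a b => cy a < cy b) :
    ∃ R : GridRep G, R.H = H ∧ R.Induces D ∧
      (∀ v ∈ H, R.lo v = cx (v, Mark.lo) ∧ R.hi v = cx (v, Mark.hi)) ∧
      ∀ v ∉ H, R.lo v = cy (v, Mark.lo) ∧ R.hi v = cy (v, Mark.hi) := by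
  classical
  let lo : Fin n → ℝ := fun v => if v ∈ H then cx (v, Mark.lo) else cy (v, Mark.lo)
  let hi : Fin n → ℝ := fun v => if v ∈ H then cx (v, Mark.hi) else cy (v, Mark.hi)
  let pos : Fin n → ℝ := fun v => if v ∈ H then cy (v, Mark.pt) else cx (v, Mark.pt)
  have xl : ∀ v ∈ H, (v, Mark.lo) ∈ D.xs := fun v hv => (hx _).mpr (.inl ⟨hv, .inl rfl⟩)
  have xh : ∀ v ∈ H, (v, Mark.hi) ∈ D.xs := fun v hv => (hx _).mpr (.inl ⟨hv, .inr rfl⟩)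
  have xp : ∀ v ∉ H, (v, Mark.pt) ∈ D.xs := fun v hv => (hx _).mpr (.inr ⟨hv, rfl⟩)
  have yl : ∀ v ∉ H, (v, Mark.lo) ∈ D.ys := fun v hv => (hy _).mpr (.inl ⟨hv, .inl rfl⟩)
  have yh : ∀ v ∉ H, (v, Mark.hi) ∈ D.ys := fun v hv => (hy _).mpr (.inl ⟨hv, .inr rfl⟩)
  have yp : ∀ v ∈ H, (v, Mark.pt) ∈ D.ys := fun v hv =>
    (hy _).mpr (.inr ⟨not_not_intro hv, rfl⟩)
  have inj : ∀ {l : List (Event n)} {c : Event n → ℝ}, (l.Pairwise fun a b => c a < c b) →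
      ∀ a b : Event n, a ∈ l → b ∈ l → c a = c b → a = b := by
    intro l c hl a b ha hb hab
    rcases before_trichotomy ha hb with h | h | h
    · exact absurd hab ((before_iff_of_pairwise hl).mp h).2.2.ne
    · exact h
    · exact absurd hab ((before_iff_of_pairwise hl).mp h).2.2.ne'
  have par : ∀ u v, u ≠ v → (u ∈ H ↔ v ∈ H) → pos u ≠ pos v := by
    intro u v hne huv h
    by_cases hu : u ∈ H
    · have hv := huv.mp hu
      simp only [pos, hu, hv, if_true] at h
      exact hne (Prod.mk.inj (inj py _ _ (yp u hu) (yp v hv) h)).1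
    · have hv : v ∉ H := fun hv => hu (huv.mpr hv)
      simp only [pos, hu, hv, if_false] at h
      exact hne (Prod.mk.inj (inj px _ _ (xp u hu) (xp v hv) h)).1
  have disj : ∀ u v, u ≠ v → (u ∈ H ↔ v ∈ H) →
      Disjoint (axisSegment (u ∈ H) (lo u) (hi u) (pos u))
        (axisSegment (v ∈ H) (lo v) (hi v) (pos v)) := by
    intro u v hne huv
    rw [Set.disjoint_left]
    intro p hp hp'
    refine par u v hne huv ?_
    by_cases hu : u ∈ H
    · have hv := huv.mp hu
      simp only [axisSegment, Set.mem_ofPred_eq, hu, hv, true_and, not_true_eq_false, false_and,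
        or_false] at hp hp'
      exact hp.2.symm.trans hp'.2
    · have hv : v ∉ H := fun hv => hu (huv.mpr hv)
      simp only [axisSegment, Set.mem_ofPred_eq, hu, hv, false_and, not_false_eq_true, true_and,
        false_or] at hp hp'
      exact hp.2.symm.trans hp'.2
  have cross : ∀ u v, u ∈ H → v ∉ H → (D.Cross u v ↔
      pos v ∈ Set.Icc (lo u) (hi u) ∧ pos u ∈ Set.Icc (lo v) (hi v)) := by
    intro u v hu hv
    unfold Orders.Cross
    rw [before_iff_of_pairwise px, before_iff_of_pairwise px, before_iff_of_pairwise py,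
      before_iff_of_pairwise py]
    simp only [xl u hu, xh u hu, xp v hv, yl v hv, yh v hv, yp u hu, true_and, Set.mem_Icc, lo, hi,
      pos, hu, hv, if_true, if_false]
    have n₁ : cx (u, Mark.lo) ≠ cx (v, Mark.pt) := fun h => by
      simpa using inj px _ _ (xl u hu) (xp v hv) h
    have n₂ : cx (v, Mark.pt) ≠ cx (u, Mark.hi) := fun h => by
      simpa using inj px _ _ (xp v hv) (xh u hu) h
    have n₃ : cy (v, Mark.lo) ≠ cy (u, Mark.pt) := fun h => by
      simpa using inj py _ _ (yl v hv) (yp u hu) h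
    have n₄ : cy (u, Mark.pt) ≠ cy (v, Mark.hi) := fun h => by
      simpa using inj py _ _ (yp u hu) (yh v hv) h
    rw [n₁.le_iff_lt, n₂.le_iff_lt, n₃.le_iff_lt, n₄.le_iff_lt]
  let R : GridRep G :=
    { H := H
      lo := lo
      hi := hi
      pos := pos
      lo_lt_hi := by
        intro v
        by_cases hv : v ∈ H
        · simp only [lo, hi, hv, if_true]
          exact ((before_iff_of_pairwise px).mp (hlx v hv)).2.2
        · simp only [lo, hi, hv, if_false]
          exact ((before_iff_of_pairwise py).mp (hly v hv)).2.2
      disjoint_of_parallel := disj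
      adj_iff := by
        intro u v
        rw [hG]
        by_cases hu : u ∈ H <;> by_cases hv : v ∈ H
        · have := disj u v
          simp only [hu, hv, not_true_eq_false, false_and, and_false, or_false, false_iff, not_and,
            forall_const] at this ⊢
          intro hne
          rw [Set.not_nonempty_iff_eq_empty, ← Set.disjoint_iff_inter_eq_empty]
          exact this hne
        · rw [axisSegment_inter_nonempty_of_not_iff hu hv, cross u v hu hv]
          have : u ≠ v := fun h => hv (h ▸ hu)
          simp [hu, hv, this]
        · rw [Set.inter_comm, axisSegment_inter_nonempty_of_not_iff hv hu, cross v u hv hu]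
          have : u ≠ v := fun h => hu (h ▸ hv)
          simp [hu, hv, this]
        · have := disj u v
          simp only [hu, hv, false_and, or_false, false_iff, not_and, forall_const] at this ⊢
          intro hne
          rw [Set.not_nonempty_iff_eq_empty, ← Set.disjoint_iff_inter_eq_empty]
          exact this hne }
  have ex : ∀ e ∈ D.xs, R.coord e = cx e := by
    rintro ⟨v, m⟩ he
    have he := (hx _).mp he
    cases m
    · have : v ∈ H := by simpa [IsEventOf] using he
      exact if_pos this
    · have : v ∈ H := by simpa [IsEventOf] using he
      exact if_pos this
    · have : v ∉ H := by simpa [IsEventOf] using he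
      exact if_neg this
  have ey : ∀ e ∈ D.ys, R.coord e = cy e := by
    rintro ⟨v, m⟩ he
    have he := (hy _).mp he
    cases m
    · have : v ∉ H := by simpa [IsEventOf] using he
      exact if_neg this
    · have : v ∉ H := by simpa [IsEventOf] using he
      exact if_neg this
    · have : v ∈ H := by simpa [IsEventOf] using he
      exact if_pos this
  refine ⟨R, rfl, ⟨⟨hx, px.imp_of_mem fun ha hb hab => ?_⟩,
    hy, py.imp_of_mem fun ha hb hab => ?_⟩, fun v hv => ⟨if_pos hv, if_pos hv⟩,
    fun v hv => ⟨if_neg hv, if_neg hv⟩⟩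
  · rwa [ex _ ha, ex _ hb]
  · rwa [ey _ ha, ey _ hb]

/-- Orderings are realizable by unit segments exactly when they are free of containments. -/
theorem ugigWitness_iff :
    UGIGWitness G D ↔ D.Describes G ∧ Proper D.xs ∧ Proper D.ys := by
  constructor
  · rintro ⟨R, hu, hR⟩
    exact ⟨hR.describes, proper_of_pairwise hR.1.1 hR.1.2 fun v _ => hu v,
      proper_of_pairwise hR.2.1 hR.2.2 fun v _ => hu v⟩
  · rintro ⟨⟨H, ⟨nx, hx⟩, ⟨ny, hy⟩, hlx, hly, hG⟩, hpx, hpy⟩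
    obtain ⟨cx, px, ux⟩ := exists_unit_coord_of_proper nx hx hlx hpx
    obtain ⟨cy, py, uy⟩ := exists_unit_coord_of_proper ny hy hly hpy
    obtain ⟨R, rfl, hR, h₁, h₂⟩ := exists_gridRep hx hy hlx hly hG px py
    refine ⟨R, fun v => ?_, hR⟩
    by_cases hv : v ∈ R.H
    · rw [(h₁ v hv).1, (h₁ v hv).2, ux v hv]
    · rw [(h₂ v hv).1, (h₂ v hv).2, uy v hv]

theorem usegWitness_iff :
    USEGWitness G D ↔ D.Describes G ∧ (Proper D.xs ∨ Proper D.ys) := by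
  constructor
  · rintro ⟨R, hu, hR⟩
    exact ⟨hR.describes, hu.imp (proper_of_pairwise hR.1.1 hR.1.2)
      (proper_of_pairwise hR.2.1 hR.2.2)⟩
  · rintro ⟨⟨H, ⟨nx, hx⟩, ⟨ny, hy⟩, hlx, hly, hG⟩, hp | hp⟩
    · obtain ⟨cx, px, ux⟩ := exists_unit_coord_of_proper nx hx hlx hp
      obtain ⟨cy, py⟩ := exists_pairwise_lt ny
      obtain ⟨R, rfl, hR, h₁, -⟩ := exists_gridRep hx hy hlx hly hG px py
      exact ⟨R, .inl fun v hv => by rw [(h₁ v hv).1, (h₁ v hv).2, ux v hv], hR⟩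
    · obtain ⟨cx, px⟩ := exists_pairwise_lt nx
      obtain ⟨cy, py, uy⟩ := exists_unit_coord_of_proper ny hy hly hp
      obtain ⟨R, rfl, hR, -, h₂⟩ := exists_gridRep hx hy hlx hly hG px py
      exact ⟨R, .inr fun v hv => by rw [(h₂ v hv).1, (h₂ v hv).2, uy v hv], hR⟩

end UnitGrid

namespace UnitGrid

/-! ### Every representation has orderings -/

instance : DecidableEq Mark := fun a b => by
  cases a <;> cases b <;> first | exact isTrue rfl | exact isFalse nofun

instance : Fintype Mark := ⟨{.lo, .hi, .pt}, by rintro ⟨⟩ <;> simp⟩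

/-- The order of the kinds of events at the same place: segments are opened first and closed last,
so that touching segments cross. -/
def Mark.rank : Mark → ℕ
  | .lo => 0
  | .pt => 1
  | .hi => 2

section

variable {n : ℕ} {G : SimpleGraph (Fin n)}

/-- Events ordered by coordinate, then by kind, and finally by vertex. -/
noncomputable def GridRep.key (R : GridRep G) (e : Event n) : ℝ ×ₗ (ℕ ×ₗ ℕ) :=
  toLex (R.coord e, toLex (e.2.rank, e.1.val))

theorem GridRep.key_injective (R : GridRep G) : Function.Injective R.key := by
  rintro ⟨v, m⟩ ⟨v', m'⟩ h
  simp only [GridRep.key, EmbeddingLike.apply_eq_iff_eq, Prod.mk.injEq] at h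
  obtain ⟨-, hm, hv⟩ := h
  have : m = m' := by cases m <;> cases m' <;> simp_all [Mark.rank]
  exact Prod.ext (Fin.ext hv) this

theorem GridRep.key_lt_iff (R : GridRep G) (e e' : Event n) : R.key e < R.key e' ↔
    R.coord e < R.coord e' ∨ R.coord e = R.coord e' ∧
      (e.2.rank < e'.2.rank ∨ e.2.rank = e'.2.rank ∧ e.1.val < e'.1.val) := by
  simp only [GridRep.key, Prod.Lex.toLex_lt_toLex]

theorem GridRep.key_lo_lt_pt (R : GridRep G) (u v : Fin n) :
    R.key (u, Mark.lo) < R.key (v, Mark.pt) ↔ R.lo u ≤ R.pos v := by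
  rw [R.key_lt_iff, le_iff_lt_or_eq]
  simp [Mark.rank, GridRep.coord]

theorem GridRep.key_pt_lt_hi (R : GridRep G) (u v : Fin n) :
    R.key (v, Mark.pt) < R.key (u, Mark.hi) ↔ R.pos v ≤ R.hi u := by
  rw [R.key_lt_iff, le_iff_lt_or_eq]
  simp [Mark.rank, GridRep.coord]

/-- With ties among endpoints broken in the same way for lower and upper ones, unit segments do not
contain each other. -/
theorem GridRep.proper_of_key (R : GridRep G) {A : Set (Fin n)} {l : List (Event n)}
    (hA : ∀ e, e ∈ l ↔ IsEventOf A e) (hl : l.Pairwise fun a b => R.key a < R.key b)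
    (hu : ∀ v ∈ A, R.hi v = R.lo v + 1) : Proper l := by
  rintro ⟨u, v, h₁, h₂⟩
  have mem_lo : ∀ v, (v, Mark.lo) ∈ l → v ∈ A := fun v hv => by
    simpa [IsEventOf] using (hA _).mp hv
  have e₁ := ((before_iff_of_pairwise hl).mp h₁).2.2
  have e₂ := ((before_iff_of_pairwise hl).mp h₂).2.2
  rw [R.key_lt_iff] at e₁ e₂
  simp only [GridRep.coord, hu _ (mem_lo _ h₁.left_mem), hu _ (mem_lo _ h₁.right_mem), lt_irrefl,
    true_and, false_or, add_left_inj, add_lt_add_iff_right] at e₁ e₂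
  rcases e₁ with e₁ | e₁ <;> rcases e₂ with e₂ | e₂
  · exact lt_asymm e₁ e₂
  · exact e₁.ne' e₂.1
  · exact e₂.ne' e₁.1
  · exact lt_asymm e₁.2 e₂.2

theorem GridRep.exists_orders (R : GridRep G) : ∃ D : Orders n, D.Describes G ∧
    ((∀ v ∈ R.H, R.hi v = R.lo v + 1) → Proper D.xs) ∧
    ((∀ v ∉ R.H, R.hi v = R.lo v + 1) → Proper D.ys) := by
  obtain ⟨xs, hx, px⟩ := exists_sorted_list R.key_injective (IsEventOf R.H)
  obtain ⟨ys, hy, py⟩ := exists_sorted_list R.key_injective (IsEventOf R.Hᶜ)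
  refine ⟨⟨xs, ys⟩, ⟨R.H, ⟨nodup_of_pairwise_lt px, hx⟩, ⟨nodup_of_pairwise_lt py, hy⟩,
    fun v hv => ?_, fun v hv => ?_, fun u v => ?_⟩, R.proper_of_key hx px, R.proper_of_key hy py⟩
  · rw [before_iff_of_pairwise px, hx, hx, R.key_lt_iff]
    exact ⟨.inl ⟨hv, .inl rfl⟩, .inl ⟨hv, .inr rfl⟩, .inl (R.lo_lt_hi v)⟩
  · rw [before_iff_of_pairwise py, hy, hy, R.key_lt_iff]
    exact ⟨.inl ⟨hv, .inl rfl⟩, .inl ⟨hv, .inr rfl⟩, .inl (R.lo_lt_hi v)⟩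
  · have cross : ∀ u v, u ∈ R.H → v ∉ R.H → ((⟨xs, ys⟩ : Orders n).Cross u v ↔
        R.pos v ∈ Set.Icc (R.lo u) (R.hi u) ∧ R.pos u ∈ Set.Icc (R.lo v) (R.hi v)) := by
      intro u v hu hv
      have xl : (u, Mark.lo) ∈ xs := (hx _).mpr (.inl ⟨hu, .inl rfl⟩)
      have xh : (u, Mark.hi) ∈ xs := (hx _).mpr (.inl ⟨hu, .inr rfl⟩)
      have xp : (v, Mark.pt) ∈ xs := (hx _).mpr (.inr ⟨hv, rfl⟩)
      have yl : (v, Mark.lo) ∈ ys := (hy _).mpr (.inl ⟨hv, .inl rfl⟩)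
      have yh : (v, Mark.hi) ∈ ys := (hy _).mpr (.inl ⟨hv, .inr rfl⟩)
      have yp : (u, Mark.pt) ∈ ys := (hy _).mpr (.inr ⟨not_not_intro hu, rfl⟩)
      unfold Orders.Cross
      rw [before_iff_of_pairwise px, before_iff_of_pairwise px, before_iff_of_pairwise py,
        before_iff_of_pairwise py]
      simp only [xl, xh, xp, yl, yh, yp, true_and, Set.mem_Icc, R.key_lo_lt_pt, R.key_pt_lt_hi]
    rw [R.adj_iff_pos_mem]
    exact or_congr (and_congr_right fun hu => and_congr_right fun hv => (cross u v hu hv).symm)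
      (and_congr_right fun hv => and_congr_right fun hu => (cross v u hv hu).symm)

theorem isUGIG_iff : IsUGIG G ↔ ∃ D : Orders n, UGIGWitness G D := by
  constructor
  · rintro ⟨R, hR⟩
    obtain ⟨D, h, hx, hy⟩ := R.exists_orders
    exact ⟨D, ugigWitness_iff.mpr ⟨h, hx fun v _ => hR v, hy fun v _ => hR v⟩⟩
  · rintro ⟨D, R, hR, -⟩
    exact ⟨R, hR⟩

theorem isUSEG_iff : IsUSEG G ↔ ∃ D : Orders n, USEGWitness G D := by
  constructor
  · rintro ⟨R, hR⟩
    obtain ⟨D, h, hx, hy⟩ := R.exists_orders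
    exact ⟨D, usegWitness_iff.mpr ⟨h, hR.imp hx hy⟩⟩
  · rintro ⟨D, R, hR, -⟩
    exact ⟨R, hR⟩

end

/-! ### The length of certificates -/

theorem length_encodeEvent {n : ℕ} (e : Event n) :
    (encodeEvent e).length = 2 * Nat.size e.1.val + 3 := by
  have h : ∀ l : List Bool, (l.flatMap fun b => [true, b]).length = 2 * l.length := by
    intro l
    induction l with
    | nil => rfl
    | cons b l ih => simp [List.flatMap_cons, ih]; omega
  rw [encodeEvent, List.length_append, h, ← Nat.size_eq_bits_len]
  cases e.2 <;> rfl

/-- A bound for the number of bits of a pair of orderings of `n` vertices. -/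
def sizeBound (n : ℕ) : ℕ := 6 * n * (2 * Nat.size n + 3) + 6

theorem length_encodeOrder_le {n : ℕ} {l : List (Event n)} (hl : l.Nodup) :
    (encodeOrder l).length ≤ 3 * n * (2 * Nat.size n + 3) + 3 := by
  have h₁ : l.length ≤ 3 * n := by
    have := hl.length_le_card
    rw [Fintype.card_prod, Fintype.card_fin, show Fintype.card Mark = 3 from rfl] at this
    omega
  have h₂ : ∀ l : List (Event n),
      (l.flatMap encodeEvent).length ≤ l.length * (2 * Nat.size n + 3) := by
    intro l
    induction l with
    | nil => simp
    | cons e l ih =>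
      have : Nat.size e.1.val ≤ Nat.size n := Nat.size_le_size e.1.isLt.le
      rw [List.flatMap_cons, List.length_append, length_encodeEvent, List.length_cons, add_mul]
      omega
  rw [encodeOrder, List.length_append]
  exact Nat.add_le_add_right ((h₂ l).trans (Nat.mul_le_mul_right _ h₁)) 3

theorem Orders.Describes.length_encode_le {n : ℕ} {G : SimpleGraph (Fin n)} {D : Orders n}
    (h : D.Describes G) : D.encode.length ≤ sizeBound n := by
  obtain ⟨H, ⟨nx, -⟩, ⟨ny, -⟩, -⟩ := h
  have h₁ := length_encodeOrder_le nx
  have h₂ := length_encodeOrder_le ny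
  rw [Orders.encode, List.length_append, sizeBound]
  have : 6 * n * (2 * Nat.size n + 3) = 2 * (3 * n * (2 * Nat.size n + 3)) := by ring
  omega

theorem sizeBound_isBigO :
    (fun n : ℕ => (sizeBound n : ℝ)) =O[atTop] fun n : ℕ => (n : ℝ) * Real.log n := by
  refine IsBigO.of_bound 96 (eventually_atTop.mpr ⟨2, fun n hn => ?_⟩)
  have hn' : (2 : ℝ) ≤ n := by exact_mod_cast hn
  have hlog2 : (1 / 2 : ℝ) ≤ Real.log 2 := by linarith [Real.log_two_gt_d9]
  have hlog : (1 / 2 : ℝ) ≤ Real.log n := hlog2.trans (Real.log_le_log (by norm_num) hn')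
  have hsize : (Nat.size n : ℝ) ≤ 2 * Real.log n + 1 := by
    have h₁ : Nat.size n ≤ Nat.log 2 n + 1 :=
      Nat.size_le.mpr (Nat.lt_pow_succ_log_self (by norm_num) n)
    have h₂ : (Nat.log 2 n : ℝ) ≤ Real.logb 2 n := Real.natLog_le_logb n 2
    have h₃ : Real.logb 2 n ≤ 2 * Real.log n := by
      rw [Real.logb, div_le_iff₀ (by linarith)]
      nlinarith
    have h₄ : (Nat.size n : ℝ) ≤ Nat.log 2 n + 1 := by exact_mod_cast h₁
    linarith
  rw [Real.norm_of_nonneg (by positivity), Real.norm_of_nonneg (by positivity)]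
  have e : (sizeBound n : ℝ) = 6 * n * (2 * Nat.size n + 3) + 6 := by
    simp only [sizeBound]
    push_cast
    ring
  rw [e]
  have h₁ : 6 * (n : ℝ) * (2 * Nat.size n + 3) ≤ 6 * n * (2 * (2 * Real.log n + 1) + 3) := by
    gcongr
  nlinarith

end UnitGrid

namespace UnitGrid

/-! ### Parsing certificates -/

/-- The code of the event of kind `m` of the vertex with number `v`. -/
def code (v : ℕ) (m : Mark) : List Bool :=
  (Nat.bits v).flatMap (fun b => [true, b]) ++ encodeMark m

theorem length_code (v : ℕ) (m : Mark) : (code v m).length = 2 * Nat.size v + 3 :=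
  length_encodeEvent (n := v + 1) (⟨v, Nat.lt_succ_self v⟩, m)

theorem digits_prefix_free {l l' r r' : List Bool}
    (h : l.flatMap (fun b => [true, b]) ++ false :: r = l'.flatMap (fun b => [true, b]) ++ false :: r') :
    l = l' ∧ r = r' := by
  induction l generalizing l' with
  | nil =>
    cases l' with
    | nil => exact ⟨rfl, by simpa using h⟩
    | cons b l' => simp at h
  | cons b l ih =>
    cases l' with
    | nil => simp at h
    | cons b' l' =>
      simp only [List.flatMap_cons, List.cons_append, List.nil_append, List.cons.injEq, true_and] at h
      obtain ⟨rfl, h⟩ := h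
      obtain ⟨rfl, rfl⟩ := ih h
      exact ⟨rfl, rfl⟩

theorem bits_inj {u v : ℕ} (h : Nat.bits u = Nat.bits v) : u = v :=
  Nat.eq_of_testBit_eq fun i => by rw [Nat.testBit_eq_inth, Nat.testBit_eq_inth, h]

/-- The codes of events form a prefix code. -/
theorem code_prefix_free {u v : ℕ} {m m' : Mark} {l : List Bool} (h : code u m <+: l)
    (h' : code v m' <+: l) : u = v ∧ m = m' := by
  obtain ⟨r, hr⟩ := h
  obtain ⟨r', hr'⟩ := h'
  rw [← hr'] at hr
  have : ∀ m : Mark, ∃ b c, encodeMark m = [false, b, c] := by rintro ⟨⟩ <;> exact ⟨_, _, rfl⟩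
  obtain ⟨b, c, hm⟩ := this m
  obtain ⟨b', c', hm'⟩ := this m'
  simp only [code, List.append_assoc, hm, hm', List.cons_append, List.nil_append] at hr
  obtain ⟨h₁, h₂⟩ := digits_prefix_free hr
  simp only [List.cons.injEq] at h₂
  obtain ⟨rfl, rfl, -⟩ := h₂
  refine ⟨bits_inj h₁, ?_⟩
  cases m <;> cases m' <;> simp_all [encodeMark]

theorem not_code_prefix (v : ℕ) (m : Mark) (r : List Bool) :
    ¬ code v m <+: [false, false, false] ++ r := by
  rintro ⟨r', h⟩
  have : ∃ b c, encodeMark m = [false, b, c] ∧ (b = true ∨ c = true) := by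
    cases m <;> exact ⟨_, _, rfl, by simp⟩
  obtain ⟨b, c, hm, hbc⟩ := this
  simp only [code, List.append_assoc, hm, List.cons_append, List.nil_append] at h
  have := (digits_prefix_free (l' := []) h).2
  simp only [List.cons.injEq] at this
  obtain ⟨rfl, rfl, -⟩ := this
  simp at hbc

/-- In `w`, an event of a vertex below `n` is encoded from the position `p` to the position `q`. -/
def Advance (w : List Bool) (n p q : ℕ) : Prop :=
  ∃ v < n, ∃ m, code v m <+: w.drop p ∧ q = p + (2 * Nat.size v + 3)

theorem Advance.unique {w : List Bool} {n p q q' : ℕ} (h : Advance w n p q)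
    (h' : Advance w n p q') : q = q' := by
  obtain ⟨v, _, m, h, rfl⟩ := h
  obtain ⟨v', _, m', h', rfl⟩ := h'
  rw [(code_prefix_free h h').1]

theorem le_length_of_code_prefix {w : List Bool} {p v : ℕ} {m : Mark} (h : code v m <+: w.drop p) :
    p + (2 * Nat.size v + 3) ≤ w.length := by
  have := h.length_le
  rw [length_code, List.length_drop] at this
  omega

theorem Advance.le_length {w : List Bool} {n p q : ℕ} (h : Advance w n p q) : q ≤ w.length := by
  obtain ⟨v, _, m, h, rfl⟩ := h
  exact le_length_of_code_prefix h

open scoped Classical in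
/-- The position after the event encoded from `p` on, or `p` itself if there is none. -/
noncomputable def next (w : List Bool) (n p : ℕ) : ℕ :=
  if h : ∃ q, Advance w n p q then h.choose else p

theorem next_eq {w : List Bool} {n p q : ℕ} (h : Advance w n p q) : next w n p = q := by
  have h' : ∃ q, Advance w n p q := ⟨q, h⟩
  rw [next, dif_pos h']
  exact h'.choose_spec.unique h

theorem next_eq_self {w : List Bool} {n p : ℕ} (h : ∀ v < n, ∀ m, ¬ code v m <+: w.drop p) :
    next w n p = p := by
  rw [next, dif_neg]
  rintro ⟨q, v, hv, m, h', -⟩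
  exact h v hv m h'

/-- The position of the event of index `i` in a list of events that starts at `p`, or the end of the
list if there is no such event. -/
noncomputable def evPos (w : List Bool) (n p i : ℕ) : ℕ := (next w n)^[i] p

theorem Advance.drop {w : List Bool} {n : ℕ} {p : ℕ} {e : Event n} {r : List Bool}
    (h : w.drop p = encodeEvent e ++ r) : Advance w n p (p + (encodeEvent e).length) ∧
      w.drop (p + (encodeEvent e).length) = r := by
  refine ⟨⟨e.1, e.1.isLt, e.2, ⟨r, h.symm⟩, by rw [length_encodeEvent]⟩, ?_⟩
  rw [← List.drop_drop, h, List.drop_left]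

theorem code_prefix_evPos_iff {w : List Bool} {n p : ℕ} {l : List (Event n)} {r : List Bool}
    (h : w.drop p = encodeOrder l ++ r) (i : ℕ) (v : Fin n) (m : Mark) :
    code v m <+: w.drop (evPos w n p i) ↔ l[i]? = some (v, m) := by
  induction l generalizing p i with
  | nil =>
    have h' : w.drop p = [false, false, false] ++ r := h
    have : evPos w n p i = p :=
      Function.iterate_fixed (next_eq_self fun v _ m => by rw [h']; exact not_code_prefix v m r) i
    rw [this, h']
    simpa using not_code_prefix v m r
  | cons e l ih =>
    have h' : w.drop p = encodeEvent e ++ (encodeOrder l ++ r) := by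
      rw [h]
      simp [encodeOrder]
    obtain ⟨h₁, h₂⟩ := Advance.drop h'
    cases i with
    | zero =>
      show code v m <+: w.drop p ↔ _
      rw [h', List.getElem?_cons_zero, Option.some.injEq]
      constructor
      · intro hc
        obtain ⟨h₃, h₄⟩ := code_prefix_free hc (List.prefix_append _ _)
        exact (Prod.ext (Fin.ext h₃) h₄).symm
      · rintro rfl
        exact List.prefix_append _ _
    | succ i =>
      rw [List.getElem?_cons_succ, ← ih h₂ i]
      show code v m <+: w.drop ((next w n)^[i + 1] p) ↔ _
      rw [Function.iterate_succ_apply, next_eq h₁]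
      rfl

theorem evPos_eq {w : List Bool} {n p : ℕ} {l : List (Event n)} {r : List Bool}
    (h : w.drop p = encodeOrder l ++ r) {i : ℕ} (hi : l.length ≤ i) :
    evPos w n p i = p + (l.flatMap encodeEvent).length := by
  induction l generalizing p i with
  | nil =>
    have h' : w.drop p = [false, false, false] ++ r := h
    exact Function.iterate_fixed
      (next_eq_self fun v _ m => by rw [h']; exact not_code_prefix v m r) i
  | cons e l ih =>
    have h' : w.drop p = encodeEvent e ++ (encodeOrder l ++ r) := by
      rw [h]
      simp [encodeOrder]
    obtain ⟨h₁, h₂⟩ := Advance.drop h'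
    obtain ⟨i, rfl⟩ : ∃ j, i = j + 1 := ⟨i - 1, by simp at hi; omega⟩
    show (next w n)^[i + 1] p = _
    rw [Function.iterate_succ_apply, next_eq h₁]
    refine (ih h₂ (by simpa using hi)).trans ?_
    rw [List.flatMap_cons, List.length_append, add_assoc]

theorem exists_drop_eq (w : List Bool) (n p i : ℕ) :
    ∃ l : List (Event n), w.drop p = l.flatMap encodeEvent ++ w.drop (evPos w n p i) := by
  induction i with
  | zero => exact ⟨[], rfl⟩
  | succ i ih =>
    obtain ⟨l, hl⟩ := ih
    have e : evPos w n p (i + 1) = next w n (evPos w n p i) := Function.iterate_succ_apply' _ _ _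
    rw [e]
    by_cases h : ∃ v, ∃ hv : v < n, ∃ m, code v m <+: w.drop (evPos w n p i)
    · obtain ⟨v, hv, m, r, hr⟩ := h
      obtain ⟨h₁, h₂⟩ := Advance.drop (n := n) (e := (⟨v, hv⟩, m)) hr.symm
      refine ⟨l ++ [(⟨v, hv⟩, m)], ?_⟩
      rw [next_eq h₁, h₂, hl, ← hr]
      simp [encodeEvent, code]
    · rw [next_eq_self fun v hv m h' => h ⟨v, hv, m, h'⟩]
      exact ⟨l, hl⟩

/-- The position at which the second list of a certificate starts. -/
noncomputable def second (w : List Bool) (n : ℕ) : ℕ := evPos w n 0 w.length + 3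

/-- The string `w` consists of two lists of events. -/
def WellFormed (w : List Bool) (n : ℕ) : Prop :=
  [false, false, false] <+: w.drop (evPos w n 0 w.length) ∧
    [false, false, false] <+: w.drop (evPos w n (second w n) w.length) ∧
    evPos w n (second w n) w.length + 3 = w.length

theorem length_le_flatMap {n : ℕ} (l : List (Event n)) :
    l.length ≤ (l.flatMap encodeEvent).length := by
  induction l with
  | nil => simp
  | cons e l ih =>
    rw [List.flatMap_cons, List.length_append, length_encodeEvent, List.length_cons]
    omega

theorem drop_second {n : ℕ} (D : Orders n) :
    D.encode.drop (second D.encode n) = encodeOrder D.ys ++ [] := by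
  have h₁ : D.xs.length ≤ D.encode.length := by
    have := length_le_flatMap D.xs
    simp only [Orders.encode, encodeOrder, List.length_append]
    omega
  rw [second, evPos_eq (w := D.encode) (p := 0) (l := D.xs) (r := encodeOrder D.ys) rfl h₁, Orders.encode]
  rw [show 0 + (D.xs.flatMap encodeEvent).length + 3 = (encodeOrder D.xs).length by
    simp [encodeOrder], List.drop_left, List.append_nil]

theorem wellFormed_iff {w : List Bool} {n : ℕ} :
    WellFormed w n ↔ ∃ D : Orders n, w = D.encode := by
  constructor
  · rintro ⟨⟨r, h₁⟩, ⟨r', h₂⟩, h₃⟩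
    obtain ⟨l, hl⟩ := exists_drop_eq w n 0 w.length
    obtain ⟨l', hl'⟩ := exists_drop_eq w n (second w n) w.length
    have hr : w.drop (second w n) = r := by
      rw [second, ← List.drop_drop, ← h₁]
      rfl
    have hr' : r' = [] := by
      have := congrArg List.length h₂
      rw [List.length_append, List.length_drop, List.length_cons, List.length_cons, List.length_cons,
        List.length_nil] at this
      exact List.eq_nil_of_length_eq_zero (by omega)
    refine ⟨⟨l, l'⟩, ?_⟩
    rw [List.drop_zero, ← h₁, ← hr, hl', ← h₂, hr'] at hl
    rw [Orders.encode, encodeOrder, encodeOrder, hl]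
    simp
  · rintro ⟨D, rfl⟩
    have h₁ : D.xs.length ≤ D.encode.length := by
      have := length_le_flatMap D.xs
      simp only [Orders.encode, encodeOrder, List.length_append]
      omega
    have h₂ : D.ys.length ≤ D.encode.length := by
      have := length_le_flatMap D.ys
      simp only [Orders.encode, encodeOrder, List.length_append]
      omega
    have e₁ := evPos_eq (w := D.encode) (p := 0) (l := D.xs) (r := encodeOrder D.ys) rfl h₁
    have e₂ := evPos_eq (drop_second D) h₂
    have e₃ : second D.encode n = (encodeOrder D.xs).length := by
      rw [second, e₁]
      simp [encodeOrder]
    refine ⟨?_, ?_, ?_⟩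
    · rw [e₁, zero_add]
      conv_rhs => rw [Orders.encode, encodeOrder, List.append_assoc, List.drop_left]
      exact List.prefix_append _ _
    · rw [e₂, ← List.drop_drop, drop_second, List.append_nil]
      conv_rhs => rw [encodeOrder, List.drop_left]
    · rw [e₂, e₃]
      simp [Orders.encode, encodeOrder]
      omega

/-- The list of events that starts at `p` contains the event of kind `m` of the vertex `v`. -/
def MemAt (w : List Bool) (n p v : ℕ) (m : Mark) : Prop :=
  ∃ i < w.length, code v m <+: w.drop (evPos w n p i)

/-- In the list of events that starts at `p`, the event of kind `m` of `v` occurs before the event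
of kind `m'` of `v'`. -/
def BeforeAt (w : List Bool) (n p v : ℕ) (m : Mark) (v' : ℕ) (m' : Mark) : Prop :=
  ∃ i < w.length, ∃ j < w.length, i < j ∧ code v m <+: w.drop (evPos w n p i) ∧
    code v' m' <+: w.drop (evPos w n p j)

theorem index_lt_length {w : List Bool} {n p : ℕ} {l : List (Event n)} {r : List Bool}
    (h : w.drop p = encodeOrder l ++ r) {i : ℕ} {e : Event n} (hi : l[i]? = some e) :
    i < w.length := by
  have h₁ := (List.getElem?_eq_some_iff.mp hi).1
  have h₂ := length_le_flatMap l
  have h₃ := congrArg List.length h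
  rw [List.length_drop, List.length_append, encodeOrder, List.length_append] at h₃
  omega

theorem memAt_iff {w : List Bool} {n p : ℕ} {l : List (Event n)} {r : List Bool}
    (h : w.drop p = encodeOrder l ++ r) (v : Fin n) (m : Mark) :
    MemAt w n p v m ↔ (v, m) ∈ l := by
  simp only [MemAt, code_prefix_evPos_iff h, List.mem_iff_getElem?]
  exact ⟨fun ⟨i, _, h⟩ => ⟨i, h⟩, fun ⟨i, hi⟩ => ⟨i, index_lt_length h hi, hi⟩⟩

theorem beforeAt_iff {w : List Bool} {n p : ℕ} {l : List (Event n)} {r : List Bool}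
    (h : w.drop p = encodeOrder l ++ r) (v : Fin n) (m : Mark) (v' : Fin n) (m' : Mark) :
    BeforeAt w n p v m v' m' ↔ Before l (v, m) (v', m') := by
  simp only [BeforeAt, code_prefix_evPos_iff h, before_iff_getElem?]
  exact ⟨fun ⟨i, _, j, _, h⟩ => ⟨i, j, h⟩,
    fun ⟨i, j, hij, hi, hj⟩ => ⟨i, index_lt_length h hi, j, index_lt_length h hj, hij, hi, hj⟩⟩

/-! ### Parsing graphs -/

theorem getElem?_flatMap_of_length {ι β : Type*} {n : ℕ} {l : List ι} {f : ι → List β}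
    (hf : ∀ i, (f i).length = n) (i : ℕ) {j : ℕ} (hj : j < n) :
    (l.flatMap f)[i * n + j]? = l[i]?.bind fun a => (f a)[j]? := by
  induction l generalizing i with
  | nil => simp
  | cons a l ih =>
    rw [List.flatMap_cons]
    cases i with
    | zero => rw [List.getElem?_append_left (by rw [hf]; omega)]; simp
    | succ i =>
      have : (i + 1) * n + j = n + (i * n + j) := by ring
      rw [this, List.getElem?_append_right (by rw [hf]; omega), hf, Nat.add_sub_cancel_left, ih]
      simp

theorem encodeGraph_getElem? {n : ℕ} (G : SimpleGraph (Fin n)) (u v : Fin n) :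
    (encodeGraph G)[n + 1 + (u.val * n + v.val)]? = some true ↔ G.Adj u v := by
  rw [encodeGraph, List.getElem?_append_right (by simp; omega)]
  rw [show n + 1 + (u.val * n + v.val) - (List.replicate n true).length =
    u.val * n + v.val + 1 by simp; omega, List.getElem?_cons_succ,
    getElem?_flatMap_of_length (by simp) _ v.isLt]
  simp

/-- The string `x` encodes a graph on `n` vertices. -/
def IsGraphCode (x : List Bool) (n : ℕ) : Prop :=
  (∀ i < n, x[i]? = some true) ∧ x[n]? = some false ∧ x.length = n + 1 + n * n ∧
    ∀ i < n, ¬ x[n + 1 + (i * n + i)]? = some true ∧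
      ∀ j < n, x[n + 1 + (i * n + j)]? = some true → x[n + 1 + (j * n + i)]? = some true

theorem length_encodeGraph {n : ℕ} (G : SimpleGraph (Fin n)) :
    (encodeGraph G).length = n + 1 + n * n := by
  simp [encodeGraph, List.length_flatMap]
  omega

theorem isGraphCode_iff {x : List Bool} {n : ℕ} :
    IsGraphCode x n ↔ ∃ G : SimpleGraph (Fin n), x = encodeGraph G := by
  constructor
  · rintro ⟨h₁, h₂, h₃, h₄⟩
    let G : SimpleGraph (Fin n) :=
      { Adj := fun u v => x[n + 1 + (u.val * n + v.val)]? = some true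
        symm := ⟨fun u v h => (h₄ u u.isLt).2 v v.isLt h⟩
        loopless := ⟨fun u => (h₄ u u.isLt).1⟩ }
    refine ⟨G, List.ext_getElem? fun k => ?_⟩
    rcases lt_trichotomy k n with hk | rfl | hk
    · rw [h₁ k hk, encodeGraph, List.getElem?_append_left (by simpa using hk),
        List.getElem?_replicate, if_pos hk]
    · rw [h₂, encodeGraph, List.getElem?_append_right (by simp)]
      simp
    · by_cases hk' : k < n + 1 + n * n
      · have hn : 0 < n := by
          rcases Nat.eq_zero_or_pos n with rfl | h
          · omega
          · exact h
        obtain ⟨k, rfl⟩ : ∃ j, k = n + 1 + j := ⟨k - (n + 1), by omega⟩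
        have hkn : k < n * n := by omega
        have e : k / n * n + k % n = k := Nat.div_add_mod' k n
        have hk₁ : n + 1 + k < x.length := by omega
        have hk₂ : n + 1 + k < (encodeGraph G).length := by rw [length_encodeGraph]; omega
        have : (encodeGraph G)[n + 1 + k]? = some true ↔ x[n + 1 + k]? = some true := by
          have := encodeGraph_getElem? G ⟨k / n, Nat.div_lt_of_lt_mul hkn⟩ ⟨k % n, Nat.mod_lt k hn⟩
          simp only [e] at this
          refine this.trans (Iff.of_eq ?_)
          show (x[n + 1 + (k / n * n + k % n)]? = some true) = _
          rw [e]
        rw [List.getElem?_eq_getElem hk₁, List.getElem?_eq_getElem hk₂] at this ⊢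
        simp only [Option.some.injEq] at this ⊢
        exact Bool.eq_iff_iff.mpr this.symm
      · rw [List.getElem?_eq_none (by omega),
          List.getElem?_eq_none (by rw [length_encodeGraph]; omega)]
  · rintro ⟨G, rfl⟩
    refine ⟨fun i hi => ?_, ?_, length_encodeGraph G, fun i hi => ⟨fun h => ?_, fun j hj h => ?_⟩⟩
    · rw [encodeGraph, List.getElem?_append_left (by simpa using hi),
        List.getElem?_replicate, if_pos hi]
    · rw [encodeGraph, List.getElem?_append_right (by simp)]
      simp
    · exact G.loopless.irrefl _ ((encodeGraph_getElem? G ⟨i, hi⟩ ⟨i, hi⟩).mp h)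
    · exact (encodeGraph_getElem? G ⟨j, hj⟩ ⟨i, hi⟩).mpr
        ((encodeGraph_getElem? G ⟨i, hi⟩ ⟨j, hj⟩).mp h).symm

/-! ### The conditions on certificates, read off from the strings -/

/-- The list of events that starts at `p` contains no event of the vertex `v` twice. -/
def NodupAt (w : List Bool) (n p v : ℕ) : Prop :=
  ¬ BeforeAt w n p v Mark.lo v Mark.lo ∧ ¬ BeforeAt w n p v Mark.hi v Mark.hi ∧
    ¬ BeforeAt w n p v Mark.pt v Mark.pt

/-- The segments `h` and `v` cross in the orderings that start at `p` and `q`. -/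
def CrossAt (w : List Bool) (n p q h v : ℕ) : Prop :=
  (BeforeAt w n p h Mark.lo v Mark.pt ∧ BeforeAt w n p v Mark.pt h Mark.hi) ∧
    (BeforeAt w n q v Mark.lo h Mark.pt ∧ BeforeAt w n q h Mark.pt v Mark.hi)

/-- The orderings that start at `p` and `q` describe the graph encoded by `x`. The horizontal
segments are those that have a lower endpoint in the first ordering. -/
def DescribesAt (x w : List Bool) (n p q : ℕ) : Prop :=
  (∀ v < n, NodupAt w n p v) ∧ (∀ v < n, NodupAt w n q v) ∧ (∀ v < n,
    (MemAt w n p v Mark.hi ↔ MemAt w n p v Mark.lo) ∧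
    (MemAt w n p v Mark.pt ↔ ¬ MemAt w n p v Mark.lo) ∧
    (MemAt w n q v Mark.lo ↔ ¬ MemAt w n p v Mark.lo) ∧
    (MemAt w n q v Mark.hi ↔ ¬ MemAt w n p v Mark.lo) ∧
    (MemAt w n q v Mark.pt ↔ MemAt w n p v Mark.lo) ∧
    (MemAt w n p v Mark.lo → BeforeAt w n p v Mark.lo v Mark.hi) ∧
    (¬ MemAt w n p v Mark.lo → BeforeAt w n q v Mark.lo v Mark.hi)) ∧
  ∀ u < n, ∀ v < n, x[n + 1 + (u * n + v)]? = some true ↔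
    (MemAt w n p u Mark.lo ∧ ¬ MemAt w n p v Mark.lo ∧ CrossAt w n p q u v) ∨
    (MemAt w n p v Mark.lo ∧ ¬ MemAt w n p u Mark.lo ∧ CrossAt w n p q v u)

/-- The ordering that starts at `p` is proper. -/
def ProperAt (w : List Bool) (n p : ℕ) : Prop :=
  ¬ ∃ u < n, ∃ v < n, BeforeAt w n p u Mark.lo v Mark.lo ∧ BeforeAt w n p v Mark.hi u Mark.hi

theorem properAt_iff {w : List Bool} {n p : ℕ} {l : List (Event n)} {r : List Bool}
    (h : w.drop p = encodeOrder l ++ r) : ProperAt w n p ↔ Proper l := by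
  refine not_congr ⟨?_, ?_⟩
  · rintro ⟨u, hu, v, hv, h₁, h₂⟩
    exact ⟨⟨u, hu⟩, ⟨v, hv⟩, (beforeAt_iff h ⟨u, hu⟩ _ ⟨v, hv⟩ _).mp h₁,
      (beforeAt_iff h ⟨v, hv⟩ _ ⟨u, hu⟩ _).mp h₂⟩
  · rintro ⟨u, v, h₁, h₂⟩
    exact ⟨u, u.isLt, v, v.isLt, (beforeAt_iff h u _ v _).mpr h₁, (beforeAt_iff h v _ u _).mpr h₂⟩

theorem nodupAt_iff {w : List Bool} {n p : ℕ} {l : List (Event n)} {r : List Bool}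
    (h : w.drop p = encodeOrder l ++ r) : (∀ v < n, NodupAt w n p v) ↔ l.Nodup := by
  rw [List.nodup_iff_sublist]
  constructor
  · rintro h' ⟨v, m⟩ hb
    obtain ⟨h₁, h₂, h₃⟩ := h' v v.isLt
    have := (beforeAt_iff h v m v m).mpr hb
    cases m
    · exact h₁ this
    · exact h₂ this
    · exact h₃ this
  · intro h' v hv
    refine ⟨fun hb => ?_, fun hb => ?_, fun hb => ?_⟩
    · exact h' _ ((beforeAt_iff h ⟨v, hv⟩ _ ⟨v, hv⟩ _).mp hb)
    · exact h' _ ((beforeAt_iff h ⟨v, hv⟩ _ ⟨v, hv⟩ _).mp hb)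
    · exact h' _ ((beforeAt_iff h ⟨v, hv⟩ _ ⟨v, hv⟩ _).mp hb)

theorem describesAt_iff {n : ℕ} {G : SimpleGraph (Fin n)} {D : Orders n} :
    DescribesAt (encodeGraph G) D.encode n 0 (second D.encode n) ↔ D.Describes G := by
  have hx : D.encode.drop 0 = encodeOrder D.xs ++ encodeOrder D.ys := rfl
  have hy := drop_second D
  have cross : ∀ u v : Fin n, CrossAt D.encode n 0 (second D.encode n) u v ↔ D.Cross u v := by
    intro u v
    simp only [CrossAt, Orders.Cross, beforeAt_iff hx, beforeAt_iff hy]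
  have adj : (∀ u < n, ∀ v < n, (encodeGraph G)[n + 1 + (u * n + v)]? = some true ↔
      (MemAt D.encode n 0 u Mark.lo ∧ ¬ MemAt D.encode n 0 v Mark.lo ∧
        CrossAt D.encode n 0 (second D.encode n) u v) ∨
      (MemAt D.encode n 0 v Mark.lo ∧ ¬ MemAt D.encode n 0 u Mark.lo ∧
        CrossAt D.encode n 0 (second D.encode n) v u)) ↔
      ∀ u v, G.Adj u v ↔ ((u, Mark.lo) ∈ D.xs ∧ (v, Mark.lo) ∉ D.xs ∧ D.Cross u v) ∨
        ((v, Mark.lo) ∈ D.xs ∧ (u, Mark.lo) ∉ D.xs ∧ D.Cross v u) := by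
    simp only [← cross, ← memAt_iff hx, ← encodeGraph_getElem?]
    exact ⟨fun h u v => h u u.isLt v v.isLt, fun h u hu v hv => h ⟨u, hu⟩ ⟨v, hv⟩⟩
  have lists : (∀ v < n,
      (MemAt D.encode n 0 v Mark.hi ↔ MemAt D.encode n 0 v Mark.lo) ∧
      (MemAt D.encode n 0 v Mark.pt ↔ ¬ MemAt D.encode n 0 v Mark.lo) ∧
      (MemAt D.encode n (second D.encode n) v Mark.lo ↔ ¬ MemAt D.encode n 0 v Mark.lo) ∧
      (MemAt D.encode n (second D.encode n) v Mark.hi ↔ ¬ MemAt D.encode n 0 v Mark.lo) ∧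
      (MemAt D.encode n (second D.encode n) v Mark.pt ↔ MemAt D.encode n 0 v Mark.lo) ∧
      (MemAt D.encode n 0 v Mark.lo → BeforeAt D.encode n 0 v Mark.lo v Mark.hi) ∧
      (¬ MemAt D.encode n 0 v Mark.lo →
        BeforeAt D.encode n (second D.encode n) v Mark.lo v Mark.hi)) ↔
      ∀ v, ((v, Mark.hi) ∈ D.xs ↔ (v, Mark.lo) ∈ D.xs) ∧
      ((v, Mark.pt) ∈ D.xs ↔ (v, Mark.lo) ∉ D.xs) ∧
      ((v, Mark.lo) ∈ D.ys ↔ (v, Mark.lo) ∉ D.xs) ∧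
      ((v, Mark.hi) ∈ D.ys ↔ (v, Mark.lo) ∉ D.xs) ∧
      ((v, Mark.pt) ∈ D.ys ↔ (v, Mark.lo) ∈ D.xs) ∧
      ((v, Mark.lo) ∈ D.xs → Before D.xs (v, Mark.lo) (v, Mark.hi)) ∧
      ((v, Mark.lo) ∉ D.xs → Before D.ys (v, Mark.lo) (v, Mark.hi)) := by
    simp only [← memAt_iff hx, ← memAt_iff hy, ← beforeAt_iff hx, ← beforeAt_iff hy]
    exact ⟨fun h v => h v v.isLt, fun h v hv => h ⟨v, hv⟩⟩
  rw [DescribesAt, nodupAt_iff hx, nodupAt_iff hy, lists, adj]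
  constructor
  · rintro ⟨nx, ny, h, hG⟩
    refine ⟨{v | (v, Mark.lo) ∈ D.xs}, ⟨nx, ?_⟩, ⟨ny, ?_⟩, fun v => (h v).2.2.2.2.2.1,
      fun v => (h v).2.2.2.2.2.2, hG⟩
    · rintro ⟨v, m⟩
      cases m <;> simp [IsEventOf, h v]
    · rintro ⟨v, m⟩
      cases m <;> simp [IsEventOf, h v]
  · rintro ⟨H, ⟨nx, hx'⟩, ⟨ny, hy'⟩, hlx, hly, hG⟩
    have hH : ∀ v, (v, Mark.lo) ∈ D.xs ↔ v ∈ H := fun v => by simp [hx', IsEventOf]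
    refine ⟨nx, ny, fun v => ?_, fun u v => ?_⟩
    · simp only [hH]
      exact ⟨by simp [hx', IsEventOf], by simp [hx', IsEventOf], by simp [hy', IsEventOf],
        by simp [hy', IsEventOf], by simp [hy', IsEventOf], hlx v, hly v⟩
    · simp only [hH]
      exact hG u v

/-- The relation of being a certificate, for certificates that are characterized by a condition on
the strings. -/
theorem certifies_iff {W : (n : ℕ) → SimpleGraph (Fin n) → Orders n → Prop}
    {C : List Bool → ℕ → ℕ → ℕ → Prop}
    (h : ∀ (n : ℕ) (G : SimpleGraph (Fin n)) (D : Orders n),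
      W n G D ↔ D.Describes G ∧ C D.encode n 0 (second D.encode n)) (x w : List Bool) :
    certifies W x w ↔ ∃ n < x.length, IsGraphCode x n ∧ WellFormed w n ∧
      DescribesAt x w n 0 (second w n) ∧ C w n 0 (second w n) := by
  constructor
  · rintro ⟨n, G, D, rfl, rfl, hW⟩
    obtain ⟨hD, hC⟩ := (h n G D).mp hW
    refine ⟨n, ?_, isGraphCode_iff.mpr ⟨G, rfl⟩, wellFormed_iff.mpr ⟨D, rfl⟩,
      describesAt_iff.mpr hD, hC⟩
    rw [length_encodeGraph]
    omega
  · rintro ⟨n, -, hx, hw, hD, hC⟩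
    obtain ⟨G, rfl⟩ := isGraphCode_iff.mp hx
    obtain ⟨D, rfl⟩ := wellFormed_iff.mp hw
    exact ⟨n, G, D, rfl, rfl, (h n G D).mpr ⟨describesAt_iff.mp hD, hC⟩⟩

theorem certifies_ugigWitness_iff (x w : List Bool) :
    certifies (fun _ G D => UGIGWitness G D) x w ↔ ∃ n < x.length, IsGraphCode x n ∧
      WellFormed w n ∧ DescribesAt x w n 0 (second w n) ∧
        (ProperAt w n 0 ∧ ProperAt w n (second w n)) := by
  refine certifies_iff (C := fun w n p q => ProperAt w n p ∧ ProperAt w n q) (fun n G D => ?_) x w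
  rw [properAt_iff (p := 0) (w := D.encode) rfl, properAt_iff (drop_second D)]
  exact ugigWitness_iff

theorem certifies_usegWitness_iff (x w : List Bool) :
    certifies (fun _ G D => USEGWitness G D) x w ↔ ∃ n < x.length, IsGraphCode x n ∧
      WellFormed w n ∧ DescribesAt x w n 0 (second w n) ∧
        (ProperAt w n 0 ∨ ProperAt w n (second w n)) := by
  refine certifies_iff (C := fun w n p q => ProperAt w n p ∨ ProperAt w n q) (fun n G D => ?_) x w
  rw [properAt_iff (p := 0) (w := D.encode) rfl, properAt_iff (drop_second D)]
  exact usegWitness_iff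

end UnitGrid

namespace UnitGrid

/-! ### Binary digits -/

section Digits

variable {α : Type} [Ctx α] {f g k : α → ℕ} {P Q : α → Prop}

/-- A function that is computed by a program and whose values do not exceed the length of the
tape. -/
structure BddComp (f : α → ℕ) : Prop where
  comp : Comp f
  bdd : Bdd f

theorem BddComp.weaken (hf : BddComp f) : BddComp fun a : α × ℕ => f a.1 :=
  ⟨hf.comp.weaken, hf.bdd.weaken⟩

theorem BddComp.snd : BddComp fun a : α × ℕ => a.2 := ⟨.snd, bdd_snd⟩

theorem BddComp.const {c : ℕ} (hc : c ≤ 9) : BddComp fun _ : α => c := ⟨.const c, bdd_const hc⟩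

theorem BddComp.trunc (hf : Comp f) : BddComp fun a => min (cap a) (f a) :=
  ⟨hf.trunc, bdd_trunc f⟩

theorem BddComp.length_fst : BddComp fun a : α => (Ctx.base a).1.length :=
  ⟨.length_fst, bdd_length_fst⟩

theorem BddComp.length_snd : BddComp fun a : α => (Ctx.base a).2.length :=
  ⟨.length_snd, bdd_length_snd⟩

theorem BddComp.eq (hf : BddComp f) (hg : BddComp g) : CompPred fun a => f a = g a :=
  .eq hf.comp hg.comp hf.bdd hg.bdd

theorem BddComp.lt (hf : BddComp f) (hg : BddComp g) : CompPred fun a => f a < g a :=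
  .lt hf.comp hg.comp hf.bdd hg.bdd

theorem BddComp.sub (hf : BddComp f) (hg : BddComp g) : BddComp fun a => f a - g a :=
  ⟨.sub hf.comp hg.comp hf.bdd hg.bdd, hf.bdd.of_le fun _ _ => Nat.sub_le _ _⟩

theorem BddComp.half (hf : BddComp f) : BddComp fun a => f a / 2 := by
  have bdd : Bdd fun a => f a / 2 := hf.bdd.of_le fun _ _ => Nat.div_le_self _ _
  refine ⟨.of_graph bdd ?_, bdd⟩
  have h := hf.weaken.sub .snd
  exact ((h.eq .snd).or ((BddComp.snd.lt hf.weaken).and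
    ((h.sub (.const (by norm_num : 1 ≤ 9))).eq .snd))).congr fun a _ => by omega

theorem BddComp.shift (hf : BddComp f) (hg : BddComp g) : BddComp fun a => f a / 2 ^ g a := by
  have bdd : Bdd fun a => f a / 2 ^ g a := hf.bdd.of_le fun _ _ => Nat.div_le_self _ _
  have h := (BddComp.snd (α := α × ℕ)).half
  refine ⟨(Comp.rec hf.comp hg.comp h.comp hf.bdd hg.bdd h.bdd).congr fun a _ => ?_, bdd⟩
  generalize g a = n
  induction n with
  | zero => simp
  | succ n ih => rw [pow_succ, ← Nat.div_div_eq_div_mul, ← ih]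

/-- The parity of a number is read off by comparing the two halves of it. -/
theorem CompPred.testBit (hf : BddComp f) (hg : BddComp g) :
    CompPred fun a => (f a).testBit (g a) = true := by
  have h := hf.shift hg
  refine ((h.sub h.half).eq h.half).not.congr fun a _ => ?_
  rw [Nat.testBit_eq_decide_div_mod_eq, decide_eq_true_iff]
  generalize f a / 2 ^ g a = x
  omega

theorem BddComp.size (hf : BddComp f) : BddComp fun a => Nat.size (f a) := by
  have bdd : Bdd fun a => Nat.size (f a) :=
    hf.bdd.of_le fun a _ => Nat.size_le.mpr Nat.lt_two_pow_self
  refine ⟨.of_graph bdd ?_, bdd⟩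
  have h₀ := BddComp.const (α := α × ℕ) (c := 0) (by norm_num)
  refine (((hf.weaken.shift .snd).eq h₀).and (CompPred.forall_lt
    (P := fun a i => ¬ f a.1 / 2 ^ i = 0) .snd bdd_snd
    ((hf.weaken.weaken.shift .snd).eq h₀.weaken).not)).congr fun a _ => ?_
  simp only [Nat.div_eq_zero_iff, Nat.pow_eq_zero, OfNat.ofNat_ne_zero, false_and, false_or,
    ← Nat.size_le, not_le]
  constructor
  · rintro ⟨h₁, h₂⟩
    exact le_antisymm (not_lt.mp fun h => lt_irrefl _ (h₂ _ h)) h₁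
  · intro h
    exact ⟨h.ge, fun i hi => h ▸ hi⟩

/-! ### Reading codes of events -/

theorem cons_prefix_iff {β : Type*} {b : β} {l l' : List β} :
    b :: l <+: l' ↔ l'[0]? = some b ∧ l <+: l'.drop 1 := by
  cases l' with
  | nil => simp
  | cons c l' => simp [List.cons_prefix_cons, eq_comm]

/-- A string of digits `b`, each of them written as `1b`, occurs at the beginning of `w`. -/
theorem digits_prefix_iff {l m w : List Bool} :
    l.flatMap (fun b => [true, b]) ++ m <+: w ↔
      (∀ i < l.length, w[2 * i]? = some true ∧ w[2 * i + 1]? = some (l.getI i)) ∧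
        m <+: w.drop (2 * l.length) := by
  induction l generalizing w with
  | nil => simp
  | cons b l ih =>
    simp only [List.flatMap_cons, List.cons_append, List.nil_append, cons_prefix_iff, ih,
      List.drop_drop, List.getElem?_drop, List.length_cons, Nat.forall_lt_succ_left]
    simp only [List.getI_cons_zero, List.getI_cons_succ, mul_zero, zero_add, add_zero, mul_add_one,
      and_assoc]
    refine and_congr_right fun _ => and_congr_right fun _ => and_congr ?_ ?_
    · refine forall₂_congr fun i _ => ?_
      rw [show 1 + 1 + 2 * i = 2 * i + 2 by omega, show 1 + 1 + (2 * i + 1) = 2 * i + 2 + 1 by omega]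
    · rw [show 1 + 1 + 2 * l.length = 2 * l.length + 2 by omega]

theorem code_prefix_iff {v : ℕ} {m : Mark} {w : List Bool} {p : ℕ} :
    code v m <+: w.drop p ↔
      (∀ i < Nat.size v, w[p + 2 * i]? = some true ∧ w[p + 2 * i + 1]? = some (v.testBit i)) ∧
        encodeMark m <+: w.drop (p + 2 * Nat.size v) := by
  simp only [code, digits_prefix_iff, Nat.size_eq_bits_len, Nat.testBit_eq_inth,
    List.getElem?_drop, List.drop_drop, add_assoc]

theorem CompPred.three_prefix (hf : Comp f) (b c d : Bool) :
    CompPred fun a => [b, c, d] <+: (Ctx.base a).2.drop (f a) :=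
  ((CompPred.snd_eq hf b).and ((CompPred.snd_eq (hf.add (.const 1)) c).and
    (CompPred.snd_eq (hf.add (.const 2)) d))).congr fun a _ => by
      simp [cons_prefix_iff]

theorem CompPred.code_prefix (hf : Comp f) (hg : BddComp g) (m : Mark) :
    CompPred fun a => code (g a) m <+: (Ctx.base a).2.drop (f a) := by
  have h₁ : Comp fun a : α × ℕ => f a.1 + 2 * a.2 := hf.weaken.add ((Comp.const 2).mul .snd)
  have h₂ : CompPred fun a : α × ℕ =>
      (Ctx.base a.1).2[f a.1 + 2 * a.2 + 1]? = some ((g a.1).testBit a.2) :=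
    (((CompPred.testBit hg.weaken .snd).and (CompPred.snd_eq (h₁.add (.const 1)) true)).or
      ((CompPred.testBit hg.weaken .snd).not.and
        (CompPred.snd_eq (h₁.add (.const 1)) false))).congr fun a _ => by
      show ((g a.1).testBit a.2 = true ∧ (Ctx.base a.1).2[f a.1 + 2 * a.2 + 1]? = _ ∨
        ¬ (g a.1).testBit a.2 = true ∧ (Ctx.base a.1).2[f a.1 + 2 * a.2 + 1]? = _) ↔ _
      cases (g a.1).testBit a.2 <;> simp
  have h₃ := CompPred.forall_lt (P := fun a i => (Ctx.base a).2[f a + 2 * i]? = some true ∧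
    (Ctx.base a).2[f a + 2 * i + 1]? = some ((g a).testBit i)) hg.size.comp hg.size.bdd
    ((CompPred.snd_eq h₁ true).and h₂)
  have h₄ : CompPred fun a => encodeMark m <+: (Ctx.base a).2.drop (f a + 2 * Nat.size (g a)) := by
    have := hf.add ((Comp.const 2).mul hg.size.comp)
    cases m <;> exact CompPred.three_prefix this _ _ _
  exact (h₃.and h₄).congr fun a _ => code_prefix_iff.symm

end Digits
end UnitGrid

namespace UnitGrid

/-! ### The verification of certificates by programs -/

section Verification

variable {α : Type} [Ctx α] {n p q u v i : α → ℕ}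

theorem CompPred.forall_mark {P : Mark → α → Prop} (h : ∀ m, CompPred (P m)) :
    CompPred fun a => ∀ m, P m a :=
  ((h .lo).and ((h .hi).and (h .pt))).congr fun _ _ =>
    ⟨fun ⟨h₁, h₂, h₃⟩ m => by cases m <;> assumption, fun h => ⟨h _, h _, h _⟩⟩

theorem CompPred.exists_mark {P : Mark → α → Prop} (h : ∀ m, CompPred (P m)) :
    CompPred fun a => ∃ m, P m a :=
  (CompPred.forall_mark fun m => (h m).not).not.congr fun a _ => by simp

theorem eq_next_iff {w : List Bool} {n p q : ℕ} :
    q = next w n p ↔ Advance w n p q ∨ (∀ v < n, ∀ m, ¬ code v m <+: w.drop p) ∧ q = p := by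
  constructor
  · rintro rfl
    by_cases h : ∀ v < n, ∀ m, ¬ code v m <+: w.drop p
    · exact .inr ⟨h, next_eq_self h⟩
    · push Not at h
      obtain ⟨v, hv, m, h⟩ := h
      have : Advance w n p (p + (2 * Nat.size v + 3)) := ⟨v, hv, m, h, rfl⟩
      exact .inl ((next_eq this).symm ▸ this)
  · rintro (h | ⟨h, rfl⟩)
    · exact (next_eq h).symm
    · exact (next_eq_self h).symm

theorem next_le (w : List Bool) (n p : ℕ) : next w n p ≤ max p w.length := by
  rcases eq_next_iff.mp (rfl : next w n p = _) with h | ⟨-, h⟩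
  · exact h.le_length.trans (le_max_right _ _)
  · exact h.le.trans (le_max_left _ _)

theorem evPos_le (w : List Bool) (n p i : ℕ) : evPos w n p i ≤ max p w.length := by
  induction i with
  | zero => exact le_max_left _ _
  | succ i ih =>
    rw [evPos, Function.iterate_succ_apply']
    exact (next_le _ _ _).trans (max_le ih (le_max_right _ _))

theorem BddComp.next (hn : BddComp n) (hp : BddComp p) :
    BddComp fun a => next (Ctx.base a).2 (n a) (p a) := by
  have bdd : Bdd fun a => UnitGrid.next (Ctx.base a).2 (n a) (p a) := fun a ha =>
    (next_le _ _ _).trans (max_le (hp.bdd a ha) (bdd_length_snd a ha))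
  refine ⟨.of_graph bdd ?_, bdd⟩
  have hc (m : Mark) := CompPred.code_prefix hp.weaken.weaken.comp (BddComp.snd (α := α × ℕ)) m
  -- the position after a code that has been read does not exceed `|w|`, so it survives truncation
  have he := (BddComp.snd (α := α)).weaken.eq (.trunc (hp.comp.weaken.weaken.add
    (((Comp.const 2).mul (BddComp.snd (α := α × ℕ)).size.comp).add (.const 3))))
  have h₁ := CompPred.exists_lt (P := fun a v => ∃ m, code v m <+: (Ctx.base a.1).2.drop (p a.1) ∧
      a.2 = min (cap a) (p a.1 + (2 * Nat.size v + 3))) hn.weaken.comp hn.weaken.bdd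
    (.exists_mark fun m => (hc m).and he)
  have h₂ := CompPred.forall_lt (P := fun a v => ∀ m, ¬ code v m <+: (Ctx.base a.1).2.drop (p a.1))
    hn.weaken.comp hn.weaken.bdd (.forall_mark fun m => (hc m).not)
  refine (h₁.or (h₂.and (BddComp.snd.eq hp.weaken))).congr fun a ha => ?_
  rw [eq_next_iff]
  refine or_congr_left (exists_congr fun v => and_congr_right fun _ => exists_congr fun m =>
    and_congr_right fun h => ?_)
  rw [min_eq_right ((le_length_of_code_prefix h).trans (bdd_length_snd a ha))]

theorem BddComp.evPos (hn : BddComp n) (hp : BddComp p) (hi : BddComp i) :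
    BddComp fun a => evPos (Ctx.base a).2 (n a) (p a) (i a) := by
  have h := BddComp.next hn.weaken.weaken (BddComp.snd (α := α × ℕ))
  refine ⟨(Comp.rec hp.comp hi.comp h.comp hp.bdd hi.bdd h.bdd).congr fun a _ => ?_,
    fun a ha => (evPos_le _ _ _ _).trans (max_le (hp.bdd a ha) (bdd_length_snd a ha))⟩
  generalize i a = k
  induction k with
  | zero => rfl
  | succ k ih =>
    rw [UnitGrid.evPos, Function.iterate_succ_apply']
    exact congrArg (UnitGrid.next (Ctx.base a).2 (n a)) ih

theorem BddComp.second (hn : BddComp n) : BddComp fun a => second (Ctx.base a).2 (n a) := by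
  have h := BddComp.evPos hn (.const (by norm_num : 0 ≤ 9)) .length_snd
  refine ⟨h.comp.add (.const 3), fun a ha => ?_⟩
  have h₁ := evPos_le (Ctx.base a).2 (n a) 0 (Ctx.base a).2.length
  have h₂ := cap_eq a
  rw [UnitGrid.second]
  omega

theorem CompPred.wellFormed (hn : BddComp n) : CompPred fun a => WellFormed (Ctx.base a).2 (n a) := by
  have h₁ := BddComp.evPos hn (.const (by norm_num : 0 ≤ 9)) .length_snd
  have h₂ := BddComp.evPos hn (.second hn) .length_snd
  -- the tape is longer than `w`, so truncation does not affect the comparison with `|w|`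
  refine ((CompPred.three_prefix h₁.comp _ _ _).and ((CompPred.three_prefix h₂.comp _ _ _).and
    ((BddComp.trunc (h₂.comp.add (.const 3))).eq .length_snd))).congr fun a _ =>
    and_congr_right fun _ => and_congr_right fun _ => ?_
  have := cap_eq a
  omega

theorem CompPred.memAt (hn : BddComp n) (hp : BddComp p) (hv : BddComp v) (m : Mark) :
    CompPred fun a => MemAt (Ctx.base a).2 (n a) (p a) (v a) m :=
  CompPred.exists_lt (P := fun a i => code (v a) m <+:
    (Ctx.base a).2.drop (UnitGrid.evPos (Ctx.base a).2 (n a) (p a) i)) .length_snd bdd_length_snd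
    (.code_prefix (BddComp.evPos hn.weaken hp.weaken .snd).comp hv.weaken m)

theorem CompPred.beforeAt (hn : BddComp n) (hp : BddComp p) (hu : BddComp u) (m : Mark)
    (hv : BddComp v) (m' : Mark) :
    CompPred fun a => BeforeAt (Ctx.base a).2 (n a) (p a) (u a) m (v a) m' :=
  CompPred.exists_lt (P := fun a i => ∃ j < (Ctx.base a).2.length, i < j ∧
      code (u a) m <+: (Ctx.base a).2.drop (UnitGrid.evPos (Ctx.base a).2 (n a) (p a) i) ∧
      code (v a) m' <+: (Ctx.base a).2.drop (UnitGrid.evPos (Ctx.base a).2 (n a) (p a) j))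
    .length_snd bdd_length_snd <|
  CompPred.exists_lt (P := fun a j => a.2 < j ∧
      code (u a.1) m <+: (Ctx.base a.1).2.drop (UnitGrid.evPos (Ctx.base a.1).2 (n a.1) (p a.1) a.2) ∧
      code (v a.1) m' <+: (Ctx.base a.1).2.drop (UnitGrid.evPos (Ctx.base a.1).2 (n a.1) (p a.1) j))
    Comp.length_snd.weaken bdd_length_snd.weaken <|
  ((BddComp.snd (α := α)).weaken.lt .snd).and
    ((CompPred.code_prefix (BddComp.evPos hn.weaken hp.weaken .snd).weaken.comp
      hu.weaken.weaken m).and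
    (.code_prefix (BddComp.evPos hn.weaken.weaken hp.weaken.weaken .snd).comp hv.weaken.weaken m'))

theorem CompPred.nodupAt (hn : BddComp n) (hp : BddComp p) (hv : BddComp v) :
    CompPred fun a => NodupAt (Ctx.base a).2 (n a) (p a) (v a) :=
  (CompPred.beforeAt hn hp hv _ hv _).not.and
    ((CompPred.beforeAt hn hp hv _ hv _).not.and (CompPred.beforeAt hn hp hv _ hv _).not)

theorem CompPred.crossAt (hn : BddComp n) (hp : BddComp p) (hq : BddComp q) (hu : BddComp u)
    (hv : BddComp v) :
    CompPred fun a => CrossAt (Ctx.base a).2 (n a) (p a) (q a) (u a) (v a) :=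
  ((CompPred.beforeAt hn hp hu _ hv _).and (.beforeAt hn hp hv _ hu _)).and
    ((CompPred.beforeAt hn hq hv _ hu _).and (.beforeAt hn hq hu _ hv _))

theorem CompPred.properAt (hn : BddComp n) (hp : BddComp p) :
    CompPred fun a => ProperAt (Ctx.base a).2 (n a) (p a) := by
  have hu := (BddComp.snd (α := α)).weaken
  have hv := BddComp.snd (α := α × ℕ)
  have h₁ := CompPred.beforeAt hn.weaken.weaken hp.weaken.weaken hu .lo hv .lo
  have h₂ := CompPred.beforeAt hn.weaken.weaken hp.weaken.weaken hv .hi hu .hi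
  exact (CompPred.exists_lt (P := fun a u => ∃ v < n a,
      BeforeAt (Ctx.base a).2 (n a) (p a) u Mark.lo v Mark.lo ∧
        BeforeAt (Ctx.base a).2 (n a) (p a) v Mark.hi u Mark.hi) hn.comp hn.bdd
    (CompPred.exists_lt (P := fun a v =>
      BeforeAt (Ctx.base a.1).2 (n a.1) (p a.1) a.2 Mark.lo v Mark.lo ∧
        BeforeAt (Ctx.base a.1).2 (n a.1) (p a.1) v Mark.hi a.2 Mark.hi)
      hn.weaken.comp hn.weaken.bdd (h₁.and h₂))).not

theorem CompPred.entry (hn : BddComp n) (hu : BddComp u) (hv : BddComp v) :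
    CompPred fun a => (Ctx.base a).1[n a + 1 + (u a * n a + v a)]? = some true :=
  .fst_eq ((hn.comp.add (.const 1)).add ((hu.comp.mul hn.comp).add hv.comp)) true

theorem CompPred.isGraphCode (hn : BddComp n) :
    CompPred fun a => IsGraphCode (Ctx.base a).1 (n a) := by
  have hv := BddComp.snd (α := α)
  have hv' := BddComp.snd (α := α × ℕ)
  have h₁ := CompPred.forall_lt (P := fun a i => (Ctx.base a).1[i]? = some true) hn.comp hn.bdd
    (.fst_eq .snd true)
  -- the tape is longer than `x`, so truncation does not affect the comparison with `|x|`
  have h₂ := (BddComp.length_fst (α := α)).eq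
    (.trunc ((hn.comp.add (.const 1)).add (hn.comp.mul hn.comp)))
  have h₃ := CompPred.forall_lt (P := fun a j =>
      (Ctx.base a.1).1[n a.1 + 1 + (a.2 * n a.1 + j)]? = some true →
        (Ctx.base a.1).1[n a.1 + 1 + (j * n a.1 + a.2)]? = some true) hn.weaken.comp hn.weaken.bdd
    ((CompPred.entry hn.weaken.weaken hv.weaken hv').imp (.entry hn.weaken.weaken hv' hv.weaken))
  have h₄ := CompPred.forall_lt (P := fun a i =>
      ¬ (Ctx.base a).1[n a + 1 + (i * n a + i)]? = some true ∧
      ∀ j < n a, (Ctx.base a).1[n a + 1 + (i * n a + j)]? = some true →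
        (Ctx.base a).1[n a + 1 + (j * n a + i)]? = some true) hn.comp hn.bdd
    ((CompPred.entry hn.weaken hv hv).not.and h₃)
  refine (h₁.and ((CompPred.fst_eq hn.comp false).and (h₂.and h₄))).congr fun a _ =>
    and_congr_right fun _ => and_congr_right fun _ => and_congr_left fun _ => ?_
  have := cap_eq a
  omega

theorem CompPred.describesAt (hn : BddComp n) (hp : BddComp p) (hq : BddComp q) :
    CompPred fun a => DescribesAt (Ctx.base a).1 (Ctx.base a).2 (n a) (p a) (q a) := by
  have nodup {p : α → ℕ} (hp : BddComp p) := CompPred.forall_lt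
    (P := fun a v => NodupAt (Ctx.base a).2 (n a) (p a) v) hn.comp hn.bdd
    (.nodupAt hn.weaken hp.weaken .snd)
  have hv := BddComp.snd (α := α)
  have memp (m : Mark) := CompPred.memAt hn.weaken hp.weaken hv m
  have memq (m : Mark) := CompPred.memAt hn.weaken hq.weaken hv m
  have lists := CompPred.forall_lt (P := fun a v => (
      (MemAt (Ctx.base a).2 (n a) (p a) v Mark.hi ↔ MemAt (Ctx.base a).2 (n a) (p a) v Mark.lo) ∧
      (MemAt (Ctx.base a).2 (n a) (p a) v Mark.pt ↔ ¬ MemAt (Ctx.base a).2 (n a) (p a) v Mark.lo) ∧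
      (MemAt (Ctx.base a).2 (n a) (q a) v Mark.lo ↔ ¬ MemAt (Ctx.base a).2 (n a) (p a) v Mark.lo) ∧
      (MemAt (Ctx.base a).2 (n a) (q a) v Mark.hi ↔ ¬ MemAt (Ctx.base a).2 (n a) (p a) v Mark.lo) ∧
      (MemAt (Ctx.base a).2 (n a) (q a) v Mark.pt ↔ MemAt (Ctx.base a).2 (n a) (p a) v Mark.lo) ∧
      (MemAt (Ctx.base a).2 (n a) (p a) v Mark.lo →
        BeforeAt (Ctx.base a).2 (n a) (p a) v Mark.lo v Mark.hi) ∧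
      (¬ MemAt (Ctx.base a).2 (n a) (p a) v Mark.lo →
        BeforeAt (Ctx.base a).2 (n a) (q a) v Mark.lo v Mark.hi))) hn.comp hn.bdd
    (((memp .hi).iff (memp .lo)).and (((memp .pt).iff (memp .lo).not).and
      (((memq .lo).iff (memp .lo).not).and (((memq .hi).iff (memp .lo).not).and
      (((memq .pt).iff (memp .lo)).and
      (((memp .lo).imp (.beforeAt hn.weaken hp.weaken hv .lo hv .hi)).and
      ((memp .lo).not.imp (.beforeAt hn.weaken hq.weaken hv .lo hv .hi))))))))
  have hv' := BddComp.snd (α := α × ℕ)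
  have edge {u v : (α × ℕ) × ℕ → ℕ} (hu : BddComp u) (hv : BddComp v) :=
    (CompPred.memAt hn.weaken.weaken hp.weaken.weaken hu .lo).and
      ((CompPred.memAt hn.weaken.weaken hp.weaken.weaken hv .lo).not.and
      (CompPred.crossAt hn.weaken.weaken hp.weaken.weaken hq.weaken.weaken hu hv))
  have adj := CompPred.forall_lt (P := fun a u => ∀ v < n a,
      (Ctx.base a).1[n a + 1 + (u * n a + v)]? = some true ↔
      (MemAt (Ctx.base a).2 (n a) (p a) u Mark.lo ∧ ¬ MemAt (Ctx.base a).2 (n a) (p a) v Mark.lo ∧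
        CrossAt (Ctx.base a).2 (n a) (p a) (q a) u v) ∨
      (MemAt (Ctx.base a).2 (n a) (p a) v Mark.lo ∧ ¬ MemAt (Ctx.base a).2 (n a) (p a) u Mark.lo ∧
        CrossAt (Ctx.base a).2 (n a) (p a) (q a) v u)) hn.comp hn.bdd
    (.forall_lt (P := fun a v => (Ctx.base a.1).1[n a.1 + 1 + (a.2 * n a.1 + v)]? = some true ↔
      (MemAt (Ctx.base a.1).2 (n a.1) (p a.1) a.2 Mark.lo ∧
        ¬ MemAt (Ctx.base a.1).2 (n a.1) (p a.1) v Mark.lo ∧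
        CrossAt (Ctx.base a.1).2 (n a.1) (p a.1) (q a.1) a.2 v) ∨
      (MemAt (Ctx.base a.1).2 (n a.1) (p a.1) v Mark.lo ∧
        ¬ MemAt (Ctx.base a.1).2 (n a.1) (p a.1) a.2 Mark.lo ∧
        CrossAt (Ctx.base a.1).2 (n a.1) (p a.1) (q a.1) v a.2)) hn.weaken.comp hn.weaken.bdd
    ((CompPred.entry hn.weaken.weaken hv.weaken hv').iff
      ((edge hv.weaken hv').or (edge hv' hv.weaken))))
  exact (nodup hp).and ((nodup hq).and (lists.and adj))

end Verification

theorem polyTimeDecidable_certifies_ugigWitness :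
    PolyTimeDecidable (certifies fun _ G D => UGIGWitness G D) := by
  refine CompPred.polyTimeDecidable (CompPred.congr ?_ fun x _ =>
    (certifies_ugigWitness_iff x.1 x.2).symm)
  have hn := BddComp.snd (α := List Bool × List Bool)
  have h₀ := BddComp.const (α := (List Bool × List Bool) × ℕ) (c := 0) (by norm_num)
  exact CompPred.exists_lt (P := fun (x : List Bool × List Bool) n => IsGraphCode x.1 n ∧
    WellFormed x.2 n ∧ DescribesAt x.1 x.2 n 0 (second x.2 n) ∧
      (ProperAt x.2 n 0 ∧ ProperAt x.2 n (second x.2 n))) .length_fst bdd_length_fst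
    ((CompPred.isGraphCode hn).and ((CompPred.wellFormed hn).and
      ((CompPred.describesAt hn h₀ (.second hn)).and
      ((CompPred.properAt hn h₀).and (CompPred.properAt hn (.second hn))))))

theorem polyTimeDecidable_certifies_usegWitness :
    PolyTimeDecidable (certifies fun _ G D => USEGWitness G D) := by
  refine CompPred.polyTimeDecidable (CompPred.congr ?_ fun x _ =>
    (certifies_usegWitness_iff x.1 x.2).symm)
  have hn := BddComp.snd (α := List Bool × List Bool)
  have h₀ := BddComp.const (α := (List Bool × List Bool) × ℕ) (c := 0) (by norm_num)
  exact CompPred.exists_lt (P := fun (x : List Bool × List Bool) n => IsGraphCode x.1 n ∧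
    WellFormed x.2 n ∧ DescribesAt x.1 x.2 n 0 (second x.2 n) ∧
      (ProperAt x.2 n 0 ∨ ProperAt x.2 n (second x.2 n))) .length_fst bdd_length_fst
    ((CompPred.isGraphCode hn).and ((CompPred.wellFormed hn).and
      ((CompPred.describesAt hn h₀ (.second hn)).and
      ((CompPred.properAt hn h₀).or (CompPred.properAt hn (.second hn))))))

end UnitGrid

namespace UnitGrid

/-! ### The recognition problems are in NP -/

/-- A graph class that is characterized by certificates of length `O(n log n)` has its recognition
problem in NP if the certificates are verified in polynomial time. -/
theorem inNP_recognition {C : (n : ℕ) → SimpleGraph (Fin n) → Prop}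
    {W : (n : ℕ) → SimpleGraph (Fin n) → Orders n → Prop}
    (hC : ∀ (n : ℕ) (G : SimpleGraph (Fin n)), C n G ↔ ∃ D : Orders n, W n G D)
    (hW : ∀ (n : ℕ) (G : SimpleGraph (Fin n)) (D : Orders n), W n G D → D.Describes G)
    (h : PolyTimeDecidable (certifies W)) : InNP (recognition C) := by
  refine ⟨certifies W, 6 * Polynomial.X * (2 * Polynomial.X + 3) + 6, h, fun x => ?_⟩
  constructor
  · rintro ⟨n, G, rfl, hG⟩
    obtain ⟨D, hD⟩ := (hC n G).mp hG
    refine ⟨D.encode, (hW n G D hD).length_encode_le.trans ?_, n, G, D, rfl, rfl, hD⟩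
    have h₁ : n ≤ (encodeGraph G).length := by
      rw [length_encodeGraph]
      omega
    have h₂ : Nat.size n ≤ (encodeGraph G).length :=
      (Nat.size_le.mpr Nat.lt_two_pow_self).trans h₁
    simp only [sizeBound, Polynomial.eval_add, Polynomial.eval_mul, Polynomial.eval_ofNat,
      Polynomial.eval_X]
    gcongr
  · rintro ⟨w, -, n, G, D, hx, -, hD⟩
    exact ⟨n, G, hx, (hC n G).mpr ⟨D, hD⟩⟩

end UnitGrid

theorem theorem4 :
    -- both recognition problems are in NP
    UnitGrid.InNP (UnitGrid.recognition fun _ G => UnitGrid.IsUGIG G) ∧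
    UnitGrid.InNP (UnitGrid.recognition fun _ G => UnitGrid.IsUSEG G) ∧
    -- every graph of the class has a pair of endpoint orderings as a certificate
    (∀ (n : ℕ) (G : SimpleGraph (Fin n)),
      UnitGrid.IsUGIG G ↔ ∃ D : UnitGrid.Orders n, UnitGrid.UGIGWitness G D) ∧
    (∀ (n : ℕ) (G : SimpleGraph (Fin n)),
      UnitGrid.IsUSEG G ↔ ∃ D : UnitGrid.Orders n, UnitGrid.USEGWitness G D) ∧
    -- the certificates have `O(n log n)` bits
    (∃ s : ℕ → ℕ,
      (fun n : ℕ => (s n : ℝ)) =O[Filter.atTop] (fun n : ℕ => (n : ℝ) * Real.log n) ∧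
      ∀ (n : ℕ) (G : SimpleGraph (Fin n)) (D : UnitGrid.Orders n),
        UnitGrid.UGIGWitness G D ∨ UnitGrid.USEGWitness G D → D.encode.length ≤ s n) ∧
    -- they are verified in polynomial time
    UnitGrid.PolyTimeDecidable
      (UnitGrid.certifies fun _ G D => UnitGrid.UGIGWitness G D) ∧
    UnitGrid.PolyTimeDecidable
      (UnitGrid.certifies fun _ G D => UnitGrid.USEGWitness G D) ∧
    -- orderings are realizable by unit segments exactly when they are free of containments
    (∀ (n : ℕ) (G : SimpleGraph (Fin n)) (D : UnitGrid.Orders n),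
      UnitGrid.UGIGWitness G D ↔
        D.Describes G ∧ UnitGrid.Proper D.xs ∧ UnitGrid.Proper D.ys) ∧
    (∀ (n : ℕ) (G : SimpleGraph (Fin n)) (D : UnitGrid.Orders n),
      UnitGrid.USEGWitness G D ↔
        D.Describes G ∧ (UnitGrid.Proper D.xs ∨ UnitGrid.Proper D.ys)) := by
  have hU (n : ℕ) (G : SimpleGraph (Fin n)) (D : UnitGrid.Orders n) :=
    UnitGrid.ugigWitness_iff (G := G) (D := D)
  have hS (n : ℕ) (G : SimpleGraph (Fin n)) (D : UnitGrid.Orders n) :=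
    UnitGrid.usegWitness_iff (G := G) (D := D)
  refine ⟨?_, ?_, fun n G => UnitGrid.isUGIG_iff, fun n G => UnitGrid.isUSEG_iff,
    ⟨UnitGrid.sizeBound, UnitGrid.sizeBound_isBigO, fun n G D h => ?_⟩,
    UnitGrid.polyTimeDecidable_certifies_ugigWitness,
    UnitGrid.polyTimeDecidable_certifies_usegWitness, hU, hS⟩
  · exact UnitGrid.inNP_recognition (fun n G => UnitGrid.isUGIG_iff)
      (fun n G D h => ((hU n G D).mp h).1) UnitGrid.polyTimeDecidable_certifies_ugigWitness
  · exact UnitGrid.inNP_recognition (fun n G => UnitGrid.isUSEG_iff)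
      (fun n G D h => ((hS n G D).mp h).1) UnitGrid.polyTimeDecidable_certifies_usegWitness
  · rcases h with h | h
    · exact ((hU n G D).mp h).1.length_encode_le
    · exact ((hS n G D).mp h).1.length_encode_le
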